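/- Let $0<\rho<1$, $c>0$, $N\ge 0$, and let $f_0,f_1$ be probability densities on $\mathbb R$. **Functions.** For $p\in[0,1]$ put $\Phi_0(p)=p+(1-p)\rho$, $\ \Phi_1(x,p)=\dfrac{\Phi_0(p)f_1(x)}{\Phi_0(p)f_1(x)+(1-\Phi_0(p))f_0(x)}$ and $p_k=p+\sum_{i=1}^k(1-p)\rho(1-\rho)^{i-1}$. For $m\ge1$ and a function $V$ on $[0,1]$ let $$C_V(p,m)=\mathbb E\Big[c\sum_{k=0}^{m-1}p_k+V\big(\Phi_1(X,p_{m-1})\big)\Big],\qquad X\sim p_mf_1+(1-p_m)f_0 .$$ Define $V_0(p)=\min_{m\ge0}\big[c\sum_{k=0}^{m-1}p_k+1-p_m\big]$, $\ V_{n}(p)=\min\{1-p,\ \inf_{m\ge1}C_{V_{n-1}}(p,m)\}$ for $n=1,\dots,N$, and $\pi^U_n=\inf\{p\in[0,1]:1-p=V_{N-n}(p)\}$ for $n=0,\dots,N$. **Model.** Let $0\le\pi<1$. The change point $\Lambda$ satisfies $P(\Lambda=0)=\pi$ and $P(\Lambda=\lambda)=(1-\pi)\rho(1-\rho)^{\lambda-1}$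 for $\lambda\ge1$; given $\Lambda=\lambda$, the variables $X_1,X_2,\dots$ are independent, $X_k$ having density $f_0$ for $k<\lambda$ and $f_1$ for $k\ge\lambda$. A sampling strategy is a sequence $\mu_k\in\{0,1\}$, $k\ge1$; put $Z_k=X_k$ if $\mu_k=1$ and $Z_k=\phi$ (no observation) if $\mu_k=0$, and $\mathcal F_k=\mathcal F_0\vee\sigma(Z_1,\dots,Z_k)$, where the initial information $\mathcal F_0$ is either trivial (so that $\pi_0=\pi$ below) or generated by the event $\{\Lambda=0\}$. A pair $(\tau,\mu)$ is admissible if $\mu_k$ is $\mathcal F_{k-1}$-measurable for every $k\ge1$, $\sum_k\mu_k\le N$, and $\tau$ is a stopping time of $(\mathcal F_k)_{k\ge0}$, possibly infinite. Let $\pi_k=P(\Lambda\le k\mid\mathcal F_k)$ and $U(\tau,\mu)=\mathbb E[c(\tau-\Lambda)^++\mathbf 1_{\{\tau<\Lambda\}}]$. **Theorem.** 1. The expectations that define $V_1,\dots,V_N$ exist, and for each $n\le N$ the function $V_n$ is concave on $[0,1]$ with $V_n(1)=0$. 2. For $n<N$ the stopping domain $\{p\in[0,1]:1-p\le\inf_{m\ge1}C_{V_{N-n-1}}(p,m)\}$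 equals $\{p\in[0,1]:p\ge\pi^U_n\}$. 3. Consider the following threshold rule. Put $t^*_0=0$. For $n<N$, if $\pi_{t^*_n}\ge\pi^U_n$, stop at time $\tau^*=t^*_n$, having used $\eta^*=n$ samples; otherwise take the next sample at a time $t^*_{n+1}$ with $t^*_{n+1}-t^*_n\in\operatorname{argmin}_{m\ge1}C_{V_{N-n-1}}(\pi_{t^*_n},m)$. If all $N$ samples are used ($\eta^*=N$), stop at $\tau^*=\inf\{k\ge t^*_N:\pi_k\ge\pi^U_N\}$. There is an admissible pair which almost surely follows this rule, and every admissible pair $(\tau^*,\mu^*)$ which almost surely follows it is optimal: $U(\tau^*,\mu^*)\le U(\tau,\mu)$ for every admissible pair $(\tau,\mu)$. -/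

import Mathlib

open MeasureTheory ProbabilityTheory Set

noncomputable section

namespace QuickestDetection

/-- `f` is a probability density function on the real line. -/
structure IsPdf (f : ℝ → ℝ) : Prop where
  measurable : Measurable f
  nonneg : ∀ x, 0 ≤ f x
  lintegral_eq_one : ∫⁻ x, ENNReal.ofReal (f x) = 1

/-! ### The dynamic programming functions -/

/-- One-step update of the posterior probability when no observation is taken. -/
def Phi0 (ρ p : ℝ) : ℝ := p + (1 - p) * ρ

/-- One-step update of the posterior probability when the value `x` is observed. -/
def Phi1 (ρ : ℝ) (f₀ f₁ : ℝ → ℝ) (x p : ℝ) : ℝ :=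
  Phi0 ρ p * f₁ x / (Phi0 ρ p * f₁ x + (1 - Phi0 ρ p) * f₀ x)

/-- The posterior probability `π_k` after `k` steps without any observation, from `π_0 = p`. -/
def blindPost (ρ p : ℝ) (k : ℕ) : ℝ :=
  p + ∑ i ∈ Finset.Icc 1 k, (1 - p) * ρ * (1 - ρ) ^ (i - 1)

/-- The law of `X_m` under `P_p`: it has density `f₁` on `{Λ ≤ m}`, an event of probability
`blindPost ρ p m`, and density `f₀` on the complement. -/
def obsLaw (ρ : ℝ) (f₀ f₁ : ℝ → ℝ) (p : ℝ) (m : ℕ) : Measure ℝ :=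
  volume.withDensity fun x =>
    ENNReal.ofReal (blindPost ρ p m * f₁ x + (1 - blindPost ρ p m) * f₀ x)

/-- `E_p[c ∑_{k<m} π_k + V(π_m)]`, when the next observation is taken after `m` steps. -/
def continuationCost (c ρ : ℝ) (f₀ f₁ : ℝ → ℝ) (V : ℝ → ℝ) (p : ℝ) (m : ℕ) : ℝ :=
  ∫ x, (c * ∑ k ∈ Finset.range m, blindPost ρ p k
      + V (Phi1 ρ f₀ f₁ x (blindPost ρ p (m - 1)))) ∂(obsLaw ρ f₀ f₁ p m)

/-- The operator `𝒢`. -/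
def opG (c ρ : ℝ) (f₀ f₁ : ℝ → ℝ) (V : ℝ → ℝ) (p : ℝ) : ℝ :=
  min (1 - p) (⨅ m : ℕ+, continuationCost c ρ f₀ f₁ V p m)

/-- The functions `V_n`. -/
def V (c ρ : ℝ) (f₀ f₁ : ℝ → ℝ) : ℕ → ℝ → ℝ
  | 0 => fun p => ⨅ m : ℕ, (c * ∑ k ∈ Finset.range m, blindPost ρ p k + 1 - blindPost ρ p m)
  | n + 1 => opG c ρ f₀ f₁ (V c ρ f₀ f₁ n)

/-- The thresholds `π^U_n = inf {p ∈ [0,1] | 1 - p = V_{N-n}(p)}`, for `n ≤ N`. -/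
def threshold (c ρ : ℝ) (f₀ f₁ : ℝ → ℝ) (N n : ℕ) : ℝ :=
  sInf {p : ℝ | p ∈ Icc (0 : ℝ) 1 ∧ 1 - p = V c ρ f₀ f₁ (N - n) p}

/-! ### The change-point model and the strategies of the observer -/

/-- Under `P`, the change point `Λ` has the zero-modified geometric prior with parameters `π₀`
and `ρ`; given `Λ = l`, the variables `X 1, X 2, …` are independent, `X k` has density `f₀` if
`k < l` and density `f₁` if `k ≥ l`.  (`X 0` plays no role.) -/
structure IsChangePointModel {Ω : Type*} [MeasurableSpace Ω] (P : Measure Ω)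
    (π₀ ρ : ℝ) (f₀ f₁ : ℝ → ℝ) (Λ : Ω → ℕ) (X : ℕ → Ω → ℝ) : Prop where
  measurable_changePoint : Measurable Λ
  measurable_obs : ∀ k, Measurable (X k)
  prior_zero : P {ω | Λ ω = 0} = ENNReal.ofReal π₀
  prior_pos : ∀ l : ℕ, 1 ≤ l →
    P {ω | Λ ω = l} = ENNReal.ofReal ((1 - π₀) * ρ * (1 - ρ) ^ (l - 1))
  joint_law : ∀ (l n : ℕ) (A : ℕ → Set ℝ), (∀ k, MeasurableSet (A k)) →
    P {ω | Λ ω = l ∧ ∀ k ∈ Finset.Icc 1 n, X k ω ∈ A k} =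
      P {ω | Λ ω = l} *
        ∏ k ∈ Finset.Icc 1 n, ∫⁻ x in A k, ENNReal.ofReal (if k < l then f₀ x else f₁ x)

/-- The observation `Z_k`: equal to `X k` if a sample is taken at time `k` (`μ k ω = true`), and
to the symbol `Sum.inl ()` (no observation) otherwise. -/
def Z {Ω : Type*} (X : ℕ → Ω → ℝ) (μ : ℕ → Ω → Bool) (k : ℕ) (ω : Ω) : Unit ⊕ ℝ :=
  if μ k ω then Sum.inr (X k ω) else Sum.inl ()

/-- The information `ℱ_k` generated by the initial information `𝒢` and by `Z_1, …, Z_k`. -/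
abbrev info {Ω : Type*} (𝒢 : MeasurableSpace Ω) (X : ℕ → Ω → ℝ) (μ : ℕ → Ω → Bool) (k : ℕ) :
    MeasurableSpace Ω :=
  𝒢 ⊔ ⨆ i ∈ Finset.Icc 1 k, MeasurableSpace.comap (Z X μ i) inferInstance

/-- The pair of the sampling strategy `μ` and the stopping time `τ` is admissible with `N` sampling
rights: the decision to sample at time `k ≥ 1` is based on `ℱ_{k-1}`, at most `N` samples are taken,
and `τ` is a stopping time of the filtration `(ℱ_k)` (possibly infinite). -/
structure IsAdmissible {Ω : Type*} (𝒢 : MeasurableSpace Ω) (X : ℕ → Ω → ℝ) (N : ℕ)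
    (μ : ℕ → Ω → Bool) (τ : Ω → ℕ∞) : Prop where
  causal : ∀ k : ℕ, Measurable[info 𝒢 X μ k] (μ (k + 1))
  budget : ∀ (ω : Ω) (k : ℕ), ((Finset.Icc 1 k).filter fun i => μ i ω = true).card ≤ N
  stopping : ∀ k : ℕ, MeasurableSet[info 𝒢 X μ k] {ω | τ ω ≤ (k : ℕ∞)}

/-- The Bayes risk `E[c (τ - Λ)⁺ + 1_{τ < Λ}]`, in `[0, ∞]`. -/
def risk {Ω : Type*} [MeasurableSpace Ω] (P : Measure Ω) (c : ℝ) (Λ : Ω → ℕ) (τ : Ω → ℕ∞) :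
    ENNReal :=
  ∫⁻ ω, (ENNReal.ofReal c * ((τ ω - (Λ ω : ℕ∞) : ℕ∞) : ENNReal)
    + {ω' | τ ω' < (Λ ω' : ℕ∞)}.indicator 1 ω) ∂P

/-- The pair is admissible and minimizes the Bayes risk among all admissible pairs. -/
def IsOptimal {Ω : Type*} (𝒢 : MeasurableSpace Ω) [MeasurableSpace Ω] (P : Measure Ω) (c : ℝ)
    (Λ : Ω → ℕ) (X : ℕ → Ω → ℝ) (N : ℕ) (μ : ℕ → Ω → Bool) (τ : Ω → ℕ∞) : Prop :=
  IsAdmissible 𝒢 X N μ τ ∧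
    ∀ (μ' : ℕ → Ω → Bool) (τ' : Ω → ℕ∞), IsAdmissible 𝒢 X N μ' τ' →
      risk P c Λ τ ≤ risk P c Λ τ'

/-- The posterior probability `π_k = P(Λ ≤ k | ℱ_k)`. -/
def post {Ω : Type*} (𝒢 : MeasurableSpace Ω) [MeasurableSpace Ω] (P : Measure Ω)
    (Λ : Ω → ℕ) (X : ℕ → Ω → ℝ) (μ : ℕ → Ω → Bool) (k : ℕ) : Ω → ℝ :=
  P[{ω | Λ ω ≤ k}.indicator (fun _ => (1 : ℝ)) | info 𝒢 X μ k]

/-- One trajectory follows the threshold rule.  Here `q k = π_k` is the trajectory of the posterior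
probability, `s k` tells whether a sample is taken at time `k`, and `T` is the time of stopping.
There are a sample size `η ≤ N` and times `t 0 = 0`, `t 1, …, t η` such that

* `η` is the least `n ≤ N` with `π_{t n} ∈ S_n`, where `S_n` is `π_{t n} ≥ π^U_n` for `n < N`
  and always holds for `n = N`;
* for `n < η`, the waiting time `t (n+1) - t n` minimizes over `m ≥ 1` the expected cost
  `E_{π_{t n}}[c ∑_{k<m} π_k + V_{N-n-1}(π_m)]`;
* up to the time of stopping, the sampling times are exactly `t 1, …, t η`;
* `T = t η` if `η < N`, and `T` is the least `k ≥ t N` with `π_k ≥ π^U_N` if `η = N`. -/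
def FollowsThresholdRule (c ρ : ℝ) (f₀ f₁ : ℝ → ℝ) (N : ℕ)
    (q : ℕ → ℝ) (s : ℕ → Bool) (T : ℕ∞) : Prop :=
  ∃ (η : ℕ) (t : ℕ → ℕ),
    η ≤ N ∧ t 0 = 0 ∧
    (∀ n < η, q (t n) < threshold c ρ f₀ f₁ N n) ∧
    (η < N → threshold c ρ f₀ f₁ N η ≤ q (t η)) ∧
    (∀ n < η, ∃ m : ℕ, 1 ≤ m ∧ t (n + 1) = t n + m ∧
      ∀ m' : ℕ, 1 ≤ m' →
        continuationCost c ρ f₀ f₁ (V c ρ f₀ f₁ (N - n - 1)) (q (t n)) m ≤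
          continuationCost c ρ f₀ f₁ (V c ρ f₀ f₁ (N - n - 1)) (q (t n)) m') ∧
    (∀ k : ℕ, 1 ≤ k → (k : ℕ∞) ≤ T → (s k = true ↔ ∃ n, 1 ≤ n ∧ n ≤ η ∧ t n = k)) ∧
    (η < N → T = (t η : ℕ∞)) ∧
    (η = N → ∃ k : ℕ, T = (k : ℕ∞) ∧
      IsLeast {j : ℕ | t N ≤ j ∧ threshold c ρ f₀ f₁ N N ≤ q j} k)

end QuickestDetection

end

noncomputable section

namespace QuickestDetection

/-! ### The blind posterior -/

/-! The proof is dynamic programming on the state (posterior, number of samples left), followed by a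
verification argument. On `[0,1]` the functions `V_n` satisfy three inequalities. Stopping gives
`V_n(p) ≤ 1 - p`. A step without observation gives `V_n(p) ≤ c p + V_n(Φ₀ p)`. A step with
observation gives `V_{n+1}(p) ≤ c p + E V_n(Φ₁(X, p))`. The second is the delicate one
(`V_le_blind`): for `n ≥ 1` the definition does not offer to stop between samples. But sampling is
free, and by Jensen's inequality for the concave `V_n` (`obsValue_le`) sampling at the moment of
stopping never raises the expected cost.

Hence `c ∑_{j<k} π_j + V(π_k)`, where `V` is indexed by the samples still available, is a
submartingale under every admissible strategy. Since `P(Λ > K) → 0`, summation bounds every risk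
below by `E V_N(π_0)` (`value_le_risk`). Along a trajectory of the threshold rule all the
inequalities used are equalities (`FollowsThresholdRule.isTight`), so the bound is attained
(`risk_le_value`).

Concavity is inherited because the expected value after an observation, as a function of the prior,
is an integral of perspectives `s V(u/s)` with `s` and `u` affine in the prior, and infima preserve
concavity. With continuity and `0 ≤ V ≤ 1 - p`, the contact set `{V = 1 - p}` is then a closed
interval ending at `1`, which yields the thresholds (`IsRegular.sInf_le_iff`).

The link to the model is that the recursion by `Φ₀` and `Φ₁` computes the conditional probabilities
under every causal strategy (`IsCondProb.update`). This rests on the memoryless prior and Bayes'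
formula, and holds whether or not the initial information reveals `{Λ = 0}`.

For existence, a sample is taken at the next step exactly when a wait of length one is optimal from
the current posterior. The first such time realizes an optimal wait (`exists_first_sampling`), and
the decision is a measurable function of the state. -/

lemma blindPost_eq (ρ p : ℝ) (k : ℕ) : blindPost ρ p k = 1 - (1 - p) * (1 - ρ) ^ k := by
  induction k with
  | zero => simp [blindPost]
  | succ k ih =>
    unfold blindPost at *
    rw [Finset.sum_Icc_succ_top (by omega), ← add_assoc, ih, Nat.add_sub_cancel]
    ring

@[simp] lemma blindPost_zero (ρ p : ℝ) : blindPost ρ p 0 = p := by simp [blindPost]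

lemma Phi0_blindPost (ρ p : ℝ) (k : ℕ) : Phi0 ρ (blindPost ρ p k) = blindPost ρ p (k + 1) := by
  simp only [blindPost_eq, Phi0]; ring

lemma blindPost_Phi0 (ρ p : ℝ) (k : ℕ) : blindPost ρ (Phi0 ρ p) k = blindPost ρ p (k + 1) := by
  simp only [blindPost_eq, Phi0]; ring

lemma blindPost_mem {ρ p : ℝ} (hρ₀ : 0 < ρ) (hρ₁ : ρ < 1) (hp : p ∈ Icc (0 : ℝ) 1) (k : ℕ) :
    blindPost ρ p k ∈ Icc (0 : ℝ) 1 := by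
  have h1 : 0 ≤ (1 - ρ) ^ k := pow_nonneg (by linarith) k
  have h2 : (1 - ρ) ^ k ≤ 1 := pow_le_one₀ (by linarith) (by linarith)
  have h3 : 0 ≤ 1 - p := by linarith [hp.2]
  rw [blindPost_eq]
  constructor
  · nlinarith [hp.1]
  · nlinarith [mul_nonneg h3 h1]

lemma Phi0_mem {ρ p : ℝ} (hρ₀ : 0 < ρ) (hρ₁ : ρ < 1) (hp : p ∈ Icc (0 : ℝ) 1) :
    Phi0 ρ p ∈ Icc (0 : ℝ) 1 := by
  have := blindPost_mem hρ₀ hρ₁ hp 1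
  rwa [← Phi0_blindPost, blindPost_zero] at this

lemma le_blindPost_succ {ρ p : ℝ} (hρ₀ : 0 < ρ) (hρ₁ : ρ < 1) (hp : p ∈ Icc (0 : ℝ) 1) (k : ℕ) :
    ρ ≤ blindPost ρ p (k + 1) := by
  rw [← Phi0_blindPost]
  have := blindPost_mem hρ₀ hρ₁ hp k
  unfold Phi0
  nlinarith [this.1, this.2]

lemma blindPost_combo (ρ p q a b : ℝ) (hab : a + b = 1) (k : ℕ) :
    blindPost ρ (a * p + b * q) k = a * blindPost ρ p k + b * blindPost ρ q k := by
  simp only [blindPost_eq]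
  obtain rfl : b = 1 - a := by linarith
  ring

lemma continuous_blindPost (ρ : ℝ) (k : ℕ) : Continuous fun p => blindPost ρ p k := by
  simp only [blindPost_eq]; fun_prop

lemma continuous_Phi0 (ρ : ℝ) : Continuous (Phi0 ρ) := by
  unfold Phi0; fun_prop

/-! ### Updating a prior `q` by one observation -/

/-- The density of an observation when the probability of `{Λ ≤ k}` is `q`. -/
def mixDens (f₀ f₁ : ℝ → ℝ) (q x : ℝ) : ℝ := q * f₁ x + (1 - q) * f₀ x

/-- Bayes' rule for the prior `q` and the observation `x`. -/
def bayes (f₀ f₁ : ℝ → ℝ) (q x : ℝ) : ℝ := q * f₁ x / mixDens f₀ f₁ q x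

/-- The expected value of `V` at the posterior after an observation, for the prior `q`. -/
def obsValue (f₀ f₁ : ℝ → ℝ) (V : ℝ → ℝ) (q : ℝ) : ℝ :=
  ∫ x, mixDens f₀ f₁ q x * V (bayes f₀ f₁ q x)

lemma Phi1_eq_bayes (ρ : ℝ) (f₀ f₁ : ℝ → ℝ) (x p : ℝ) :
    Phi1 ρ f₀ f₁ x p = bayes f₀ f₁ (Phi0 ρ p) x := rfl

/-- A continuous concave function on `[0,1]` with values between `0` and `1 - p`. -/
structure IsRegular (V : ℝ → ℝ) : Prop where
  continuousOn : ContinuousOn V (Icc 0 1)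
  concaveOn : ConcaveOn ℝ (Icc 0 1) V
  nonneg : ∀ p ∈ Icc (0 : ℝ) 1, 0 ≤ V p
  le : ∀ p ∈ Icc (0 : ℝ) 1, V p ≤ 1 - p

lemma IsRegular.map_one {V : ℝ → ℝ} (hV : IsRegular V) : V 1 = 0 :=
  le_antisymm (by simpa using hV.le 1 (by simp)) (hV.nonneg 1 (by simp))

lemma IsRegular.le_one {V : ℝ → ℝ} (hV : IsRegular V) {p : ℝ} (hp : p ∈ Icc (0 : ℝ) 1) :
    V p ≤ 1 := (hV.le p hp).trans (by linarith [hp.1])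

/-- Nothing is known about `V` outside `[0,1]`; composing with the projection onto `[0,1]` gives a
Borel function that agrees with `V` at all posteriors. -/
lemma IsRegular.exists_measurable {V : ℝ → ℝ} (hV : IsRegular V) :
    ∃ W : ℝ → ℝ, Measurable W ∧ ∀ p ∈ Icc (0 : ℝ) 1, W p = V p := by
  refine ⟨fun p => V (projIcc (0 : ℝ) 1 zero_le_one p), ?_, ?_⟩
  · have h : Continuous fun p => V (projIcc (0 : ℝ) 1 zero_le_one p) :=
      hV.continuousOn.comp_continuous (by fun_prop) fun p => (projIcc (0 : ℝ) 1 zero_le_one p).2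
    exact h.measurable
  · intro p hp
    simp [projIcc_of_mem zero_le_one hp]

section Density

variable {f₀ f₁ : ℝ → ℝ}

lemma IsPdf.integrable {f : ℝ → ℝ} (hf : IsPdf f) : Integrable f := by
  refine ⟨hf.measurable.aestronglyMeasurable, ?_⟩
  rw [hasFiniteIntegral_iff_ofReal (Filter.Eventually.of_forall hf.nonneg), hf.lintegral_eq_one]
  simp

lemma IsPdf.integral_eq_one {f : ℝ → ℝ} (hf : IsPdf f) : ∫ x, f x = 1 := by
  rw [integral_eq_lintegral_of_nonneg_ae (Filter.Eventually.of_forall hf.nonneg)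
    hf.measurable.aestronglyMeasurable, hf.lintegral_eq_one]
  simp

lemma mixDens_nonneg (hf₀ : IsPdf f₀) (hf₁ : IsPdf f₁) {q : ℝ} (hq : q ∈ Icc (0 : ℝ) 1) (x : ℝ) :
    0 ≤ mixDens f₀ f₁ q x :=
  add_nonneg (mul_nonneg hq.1 (hf₁.nonneg x)) (mul_nonneg (by linarith [hq.2]) (hf₀.nonneg x))

lemma measurable_mixDens (hf₀ : IsPdf f₀) (hf₁ : IsPdf f₁) :
    Measurable fun z : ℝ × ℝ => mixDens f₀ f₁ z.1 z.2 := by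
  have := hf₀.measurable
  have := hf₁.measurable
  unfold mixDens
  fun_prop

lemma measurable_bayes (hf₀ : IsPdf f₀) (hf₁ : IsPdf f₁) :
    Measurable fun z : ℝ × ℝ => bayes f₀ f₁ z.1 z.2 := by
  have := hf₁.measurable
  have := measurable_mixDens hf₀ hf₁
  unfold bayes
  fun_prop

lemma measurable_mixDens_right (hf₀ : IsPdf f₀) (hf₁ : IsPdf f₁) (q : ℝ) :
    Measurable (mixDens f₀ f₁ q) :=
  (measurable_mixDens hf₀ hf₁).comp (g := fun z : ℝ × ℝ => mixDens f₀ f₁ z.1 z.2)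
    (f := fun x => (q, x)) (by fun_prop)

lemma measurable_bayes_right (hf₀ : IsPdf f₀) (hf₁ : IsPdf f₁) (q : ℝ) :
    Measurable (bayes f₀ f₁ q) :=
  (measurable_bayes hf₀ hf₁).comp (g := fun z : ℝ × ℝ => bayes f₀ f₁ z.1 z.2)
    (f := fun x => (q, x)) (by fun_prop)

lemma integrable_mixDens (hf₀ : IsPdf f₀) (hf₁ : IsPdf f₁) (q : ℝ) :
    Integrable (mixDens f₀ f₁ q) :=
  (hf₁.integrable.const_mul q).add (hf₀.integrable.const_mul (1 - q))

lemma integral_mixDens (hf₀ : IsPdf f₀) (hf₁ : IsPdf f₁) (q : ℝ) :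
    ∫ x, mixDens f₀ f₁ q x = 1 := by
  unfold mixDens
  rw [integral_add (hf₁.integrable.const_mul q) (hf₀.integrable.const_mul (1 - q)),
    integral_const_mul, integral_const_mul, hf₀.integral_eq_one, hf₁.integral_eq_one]
  ring

lemma bayes_mem (hf₀ : IsPdf f₀) (hf₁ : IsPdf f₁) {q : ℝ} (hq : q ∈ Icc (0 : ℝ) 1) (x : ℝ) :
    bayes f₀ f₁ q x ∈ Icc (0 : ℝ) 1 := by
  have h1 : 0 ≤ q * f₁ x := mul_nonneg hq.1 (hf₁.nonneg x)
  have h0 : 0 ≤ (1 - q) * f₀ x := mul_nonneg (by linarith [hq.2]) (hf₀.nonneg x)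
  exact ⟨div_nonneg h1 (mixDens_nonneg hf₀ hf₁ hq x),
    div_le_one_of_le₀ (by unfold mixDens; linarith) (mixDens_nonneg hf₀ hf₁ hq x)⟩

/-- Where the density vanishes the quotient is `0` by convention, and the identity survives because
`q * f₁ x` is one of two nonnegative terms with sum `0`. -/
lemma mixDens_mul_bayes (hf₀ : IsPdf f₀) (hf₁ : IsPdf f₁) {q : ℝ} (hq : q ∈ Icc (0 : ℝ) 1)
    (x : ℝ) : mixDens f₀ f₁ q x * bayes f₀ f₁ q x = q * f₁ x := by
  have h1 : 0 ≤ q * f₁ x := mul_nonneg hq.1 (hf₁.nonneg x)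
  have h0 : 0 ≤ (1 - q) * f₀ x := mul_nonneg (by linarith [hq.2]) (hf₀.nonneg x)
  rcases eq_or_ne (mixDens f₀ f₁ q x) 0 with h | h
  · rw [h, zero_mul]; unfold mixDens at h; linarith
  · exact mul_div_cancel₀ _ h

variable {V : ℝ → ℝ}

lemma measurable_comp_bayes (hf₀ : IsPdf f₀) (hf₁ : IsPdf f₁) (hV : IsRegular V) {q : ℝ}
    (hq : q ∈ Icc (0 : ℝ) 1) : Measurable fun x => V (bayes f₀ f₁ q x) := by
  obtain ⟨W, hW, h⟩ := hV.exists_measurable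
  have : (fun x => V (bayes f₀ f₁ q x)) = fun x => W (bayes f₀ f₁ q x) :=
    funext fun x => (h _ (bayes_mem hf₀ hf₁ hq x)).symm
  rw [this]
  exact hW.comp (measurable_bayes_right hf₀ hf₁ q)

lemma integrable_mixDens_mul (hf₀ : IsPdf f₀) (hf₁ : IsPdf f₁) (hV : IsRegular V) {q : ℝ}
    (hq : q ∈ Icc (0 : ℝ) 1) :
    Integrable fun x => mixDens f₀ f₁ q x * V (bayes f₀ f₁ q x) := by
  refine (integrable_mixDens hf₀ hf₁ q).mul_bdd (c := 1)
    (measurable_comp_bayes hf₀ hf₁ hV hq).aestronglyMeasurable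
    (Filter.Eventually.of_forall fun x => ?_)
  rw [Real.norm_eq_abs, abs_of_nonneg (hV.nonneg _ (bayes_mem hf₀ hf₁ hq x))]
  exact hV.le_one (bayes_mem hf₀ hf₁ hq x)

/-- The perspective `(s, u) ↦ s V(u/s)` of a concave function is concave and positively homogeneous,
so the weights `a`, `b` need not sum to `1`. -/
lemma perspective_concave {V : ℝ → ℝ} (hV : ConcaveOn ℝ (Icc 0 1) V)
    {s₁ s₂ u₁ u₂ a b : ℝ} (h₁ : 0 ≤ u₁) (h₁' : u₁ ≤ s₁) (h₂ : 0 ≤ u₂) (h₂' : u₂ ≤ s₂)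
    (ha : 0 ≤ a) (hb : 0 ≤ b) :
    a * (s₁ * V (u₁ / s₁)) + b * (s₂ * V (u₂ / s₂)) ≤
      (a * s₁ + b * s₂) * V ((a * u₁ + b * u₂) / (a * s₁ + b * s₂)) := by
  have hs₁ := h₁.trans h₁'
  have hs₂ := h₂.trans h₂'
  have hA := mul_nonneg ha hs₁
  have hB := mul_nonneg hb hs₂
  rcases (add_nonneg hA hB).eq_or_lt with hs | hs
  · have e1 : a * s₁ = 0 := by linarith
    have e2 : b * s₂ = 0 := by linarith
    rw [← mul_assoc, ← mul_assoc, e1, e2]; simp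
  · have key := hV.2
      (show u₁ / s₁ ∈ Icc (0 : ℝ) 1 from ⟨div_nonneg h₁ hs₁, div_le_one_of_le₀ h₁' hs₁⟩)
      (show u₂ / s₂ ∈ Icc (0 : ℝ) 1 from ⟨div_nonneg h₂ hs₂, div_le_one_of_le₀ h₂' hs₂⟩)
      (show 0 ≤ a * s₁ / (a * s₁ + b * s₂) from div_nonneg hA hs.le)
      (show 0 ≤ b * s₂ / (a * s₁ + b * s₂) from div_nonneg hB hs.le) (by field_simp)
    -- If `s₁ = 0`, then `0 ≤ u₁ ≤ s₁` forces `u₁ = 0`, so the convention for division by zero does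
    -- no harm.
    have c1 : s₁ * (u₁ / s₁) = u₁ := by
      rcases hs₁.eq_or_lt with h | h
      · rw [← h]; linarith
      · field_simp
    have c2 : s₂ * (u₂ / s₂) = u₂ := by
      rcases hs₂.eq_or_lt with h | h
      · rw [← h]; linarith
      · field_simp
    have e : (a * s₁ / (a * s₁ + b * s₂)) * (u₁ / s₁) + (b * s₂ / (a * s₁ + b * s₂)) * (u₂ / s₂) =
        (a * u₁ + b * u₂) / (a * s₁ + b * s₂) := by
      rw [div_mul_eq_mul_div, div_mul_eq_mul_div, ← add_div, mul_assoc, mul_assoc, c1, c2]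
    simp only [smul_eq_mul] at key
    rw [e] at key
    have := mul_le_mul_of_nonneg_left key hs.le
    refine le_trans (le_of_eq ?_) this
    field_simp

/-- For fixed `x` the integrand is the perspective of `V` at the pair `(mixDens f₀ f₁ q x, q * f₁
x)`, which is affine in `q`. -/
lemma obsValue_concaveOn (hf₀ : IsPdf f₀) (hf₁ : IsPdf f₁) (hV : IsRegular V) :
    ConcaveOn ℝ (Icc 0 1) (obsValue f₀ f₁ V) := by
  refine ⟨convex_Icc 0 1, fun p hp q hq a b ha hb hab => ?_⟩
  have hpq : a • p + b • q ∈ Icc (0 : ℝ) 1 := convex_Icc 0 1 hp hq ha hb hab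
  have ip := (integrable_mixDens_mul hf₀ hf₁ hV hp).const_mul a
  have iq := (integrable_mixDens_mul hf₀ hf₁ hV hq).const_mul b
  simp only [smul_eq_mul] at hpq ⊢
  unfold obsValue
  rw [← integral_const_mul, ← integral_const_mul, ← integral_add ip iq]
  refine integral_mono (ip.add iq) (integrable_mixDens_mul hf₀ hf₁ hV hpq) fun x => ?_
  have hle : ∀ r ∈ Icc (0 : ℝ) 1, r * f₁ x ≤ mixDens f₀ f₁ r x := fun r hr =>
    le_add_of_nonneg_right (mul_nonneg (by linarith [hr.2]) (hf₀.nonneg x))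
  have key := perspective_concave hV.concaveOn (mul_nonneg hp.1 (hf₁.nonneg x)) (hle p hp)
    (mul_nonneg hq.1 (hf₁.nonneg x)) (hle q hq) ha hb
  have e1 : a * mixDens f₀ f₁ p x + b * mixDens f₀ f₁ q x = mixDens f₀ f₁ (a * p + b * q) x := by
    obtain rfl : b = 1 - a := by linarith
    unfold mixDens; ring
  have e2 : a * (p * f₁ x) + b * (q * f₁ x) = (a * p + b * q) * f₁ x := by ring
  rw [e1, e2] at key
  exact key

lemma obsValue_nonneg (hf₀ : IsPdf f₀) (hf₁ : IsPdf f₁) (hV : IsRegular V) {q : ℝ}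
    (hq : q ∈ Icc (0 : ℝ) 1) : 0 ≤ obsValue f₀ f₁ V q :=
  integral_nonneg fun x => mul_nonneg (mixDens_nonneg hf₀ hf₁ hq x)
    (hV.nonneg _ (bayes_mem hf₀ hf₁ hq x))

/-- The law of an observation for the prior `q`. -/
def mixLaw (f₀ f₁ : ℝ → ℝ) (q : ℝ) : Measure ℝ :=
  volume.withDensity fun x => ENNReal.ofReal (mixDens f₀ f₁ q x)

lemma isProbabilityMeasure_mixLaw (hf₀ : IsPdf f₀) (hf₁ : IsPdf f₁) {q : ℝ}
    (hq : q ∈ Icc (0 : ℝ) 1) : IsProbabilityMeasure (mixLaw f₀ f₁ q) := by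
  refine ⟨?_⟩
  rw [mixLaw, withDensity_apply _ MeasurableSet.univ, Measure.restrict_univ,
    ← ofReal_integral_eq_lintegral_ofReal (integrable_mixDens hf₀ hf₁ q)
      (Filter.Eventually.of_forall (mixDens_nonneg hf₀ hf₁ hq)), integral_mixDens hf₀ hf₁]
  simp

lemma integral_mixLaw (hf₀ : IsPdf f₀) (hf₁ : IsPdf f₁) {q : ℝ}
    (hq : q ∈ Icc (0 : ℝ) 1) (g : ℝ → ℝ) :
    ∫ x, g x ∂(mixLaw f₀ f₁ q) = ∫ x, mixDens f₀ f₁ q x * g x := by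
  unfold mixLaw
  rw [integral_withDensity_eq_integral_toReal_smul
    (measurable_mixDens_right hf₀ hf₁ q).ennreal_ofReal (by simp)]
  refine integral_congr_ae (Filter.Eventually.of_forall fun x => ?_)
  simp only [smul_eq_mul]
  rw [ENNReal.toReal_ofReal (mixDens_nonneg hf₀ hf₁ hq x)]

lemma integrable_mixLaw (hf₀ : IsPdf f₀) (hf₁ : IsPdf f₁) (hV : IsRegular V) {q : ℝ}
    (hq : q ∈ Icc (0 : ℝ) 1) : Integrable (fun x => V (bayes f₀ f₁ q x)) (mixLaw f₀ f₁ q) := by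
  have := isProbabilityMeasure_mixLaw hf₀ hf₁ hq
  refine Integrable.of_bound (measurable_comp_bayes hf₀ hf₁ hV hq).aestronglyMeasurable 1
    (Filter.Eventually.of_forall fun x => ?_)
  rw [Real.norm_eq_abs, abs_of_nonneg (hV.nonneg _ (bayes_mem hf₀ hf₁ hq x))]
  exact hV.le_one (bayes_mem hf₀ hf₁ hq x)

/-- Jensen's inequality: the posterior has mean `q` under the law of the observation, so information
does not raise a concave cost. -/
lemma obsValue_le (hf₀ : IsPdf f₀) (hf₁ : IsPdf f₁) (hV : IsRegular V) {q : ℝ}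
    (hq : q ∈ Icc (0 : ℝ) 1) : obsValue f₀ f₁ V q ≤ V q := by
  have := isProbabilityMeasure_mixLaw hf₀ hf₁ hq
  have hb : Integrable (bayes f₀ f₁ q) (mixLaw f₀ f₁ q) := by
    refine Integrable.of_bound (measurable_bayes_right hf₀ hf₁ q).aestronglyMeasurable 1
      (Filter.Eventually.of_forall fun x => ?_)
    rw [Real.norm_eq_abs, abs_of_nonneg (bayes_mem hf₀ hf₁ hq x).1]
    exact (bayes_mem hf₀ hf₁ hq x).2
  have key := hV.concaveOn.le_map_integral hV.continuousOn isClosed_Icc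
    (Filter.Eventually.of_forall (bayes_mem hf₀ hf₁ hq)) hb (integrable_mixLaw hf₀ hf₁ hV hq)
  rw [integral_mixLaw hf₀ hf₁ hq, integral_mixLaw hf₀ hf₁ hq] at key
  simp only [mixDens_mul_bayes hf₀ hf₁ hq] at key
  rw [integral_const_mul, hf₁.integral_eq_one, mul_one] at key
  exact key

lemma ofReal_obsValue (hf₀ : IsPdf f₀) (hf₁ : IsPdf f₁) (hV : IsRegular V) {q : ℝ}
    (hq : q ∈ Icc (0 : ℝ) 1) :
    ENNReal.ofReal (obsValue f₀ f₁ V q) =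
      ∫⁻ x, ENNReal.ofReal (mixDens f₀ f₁ q x) * ENNReal.ofReal (V (bayes f₀ f₁ q x)) := by
  unfold obsValue
  rw [ofReal_integral_eq_lintegral_ofReal (integrable_mixDens_mul hf₀ hf₁ hV hq)
    (Filter.Eventually.of_forall fun x => mul_nonneg (mixDens_nonneg hf₀ hf₁ hq x)
      (hV.nonneg _ (bayes_mem hf₀ hf₁ hq x)))]
  simp only [ENNReal.ofReal_mul (mixDens_nonneg hf₀ hf₁ hq _)]

lemma exists_measurable_obsValue (hf₀ : IsPdf f₀) (hf₁ : IsPdf f₁) (hV : IsRegular V) :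
    ∃ W : ℝ → ℝ, Measurable W ∧ ∀ q ∈ Icc (0 : ℝ) 1, W q = obsValue f₀ f₁ V q := by
  obtain ⟨W, hW, h⟩ := hV.exists_measurable
  refine ⟨obsValue f₀ f₁ W, ?_, fun q hq => ?_⟩
  · have : Measurable fun z : ℝ × ℝ => mixDens f₀ f₁ z.1 z.2 * W (bayes f₀ f₁ z.1 z.2) :=
      (measurable_mixDens hf₀ hf₁).mul (hW.comp (measurable_bayes hf₀ hf₁))
    exact (this.stronglyMeasurable.integral_prod_right (ν := volume)).measurable
  · unfold obsValue
    exact integral_congr_ae (Filter.Eventually.of_forall fun x => by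
      simp only [h _ (bayes_mem hf₀ hf₁ hq x)])

end Density

/-! ### Regularity of the functions `V_n` -/

open Filter Topology in
-- Concavity gives continuity in the open interval, and `0 ≤ g p ≤ 1 - p` squeezes `g` at `1`. At
-- `0` the chord to `1` bounds `g` from below, but a concave function may jump up just to the right
-- of `0`; `husc` excludes this.
lemma IsRegular.of_concaveOn {g : ℝ → ℝ} (hg : ConcaveOn ℝ (Icc 0 1) g)
    (h0 : ∀ p ∈ Icc (0 : ℝ) 1, 0 ≤ g p) (h1 : ∀ p ∈ Icc (0 : ℝ) 1, g p ≤ 1 - p)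
    (husc : ∀ ε > 0, ∃ h : ℝ → ℝ, ContinuousWithinAt h (Icc 0 1) 0 ∧ h 0 < g 0 + ε ∧
      ∀ p ∈ Icc (0 : ℝ) 1, g p ≤ h p) : IsRegular g := by
  refine ⟨fun p hp => ?_, hg, h0, h1⟩
  rcases hp.1.eq_or_lt with rfl | hp0
  · have hlow : Tendsto (fun p : ℝ => (1 - p) * g 0) (𝓝[Icc 0 1] 0) (𝓝 (g 0)) := by
      have : Continuous fun p : ℝ => (1 - p) * g 0 := by fun_prop
      simpa using (this.tendsto 0).mono_left nhdsWithin_le_nhds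
    refine tendsto_order.2 ⟨fun a ha => ?_, fun a ha => ?_⟩
    · filter_upwards [(tendsto_order.1 hlow).1 a ha, self_mem_nhdsWithin] with q hq hq'
      have := hg.2 (show (0 : ℝ) ∈ Icc (0 : ℝ) 1 by simp)
        (show (1 : ℝ) ∈ Icc (0 : ℝ) 1 by simp) (show 0 ≤ 1 - q by linarith [hq'.2]) hq'.1 (by ring)
      simp only [smul_eq_mul, mul_zero, zero_add, mul_one] at this
      nlinarith [h0 1 (by simp), hq'.1]
    · obtain ⟨h, hc, hlt, hle⟩ := husc (a - g 0) (by linarith)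
      filter_upwards [(tendsto_order.1 hc.tendsto).2 a (by linarith), self_mem_nhdsWithin]
        with q hq hq'
      exact (hle q hq').trans_lt hq
  · rcases hp.2.eq_or_lt with rfl | hp1
    · have e : g 1 = 0 := le_antisymm (by simpa using h1 1 (by simp)) (h0 1 (by simp))
      have hup : Tendsto (fun p : ℝ => 1 - p) (𝓝[Icc 0 1] 1) (𝓝 0) := by
        have : Continuous fun p : ℝ => 1 - p := by fun_prop
        simpa using (this.tendsto 1).mono_left nhdsWithin_le_nhds
      unfold ContinuousWithinAt
      rw [e]
      exact tendsto_of_tendsto_of_tendsto_of_le_of_le' tendsto_const_nhds hup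
        (eventually_mem_nhdsWithin.mono h0) (eventually_mem_nhdsWithin.mono h1)
    · have := (hg.subset Ioo_subset_Icc_self (convex_Ioo 0 1)).continuousOn isOpen_Ioo
      exact (this.continuousAt (Ioo_mem_nhds hp0 hp1)).continuousWithinAt

/-- The lower bound `0` matters: a real infimum of a family unbounded below is a default value. -/
lemma concaveOn_iInf {ι : Type*} [Nonempty ι] {s : Set ℝ} {g : ι → ℝ → ℝ}
    (hs : Convex ℝ s) (hg : ∀ i, ConcaveOn ℝ s (g i)) (h0 : ∀ i, ∀ p ∈ s, 0 ≤ g i p) :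
    ConcaveOn ℝ s fun p => ⨅ i, g i p := by
  refine ⟨hs, fun p hp q hq a b ha hb hab => le_ciInf fun i => ?_⟩
  refine le_trans ?_ ((hg i).2 hp hq ha hb hab)
  simp only [smul_eq_mul]
  exact add_le_add
    (mul_le_mul_of_nonneg_left (ciInf_le ⟨0, by rintro _ ⟨j, rfl⟩; exact h0 j p hp⟩ i) ha)
    (mul_le_mul_of_nonneg_left (ciInf_le ⟨0, by rintro _ ⟨j, rfl⟩; exact h0 j q hq⟩ i) hb)

/-- The expected cost of stopping after `m` steps without observation. -/
def stopCost (c ρ p : ℝ) (m : ℕ) : ℝ :=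
  c * ∑ k ∈ Finset.range m, blindPost ρ p k + 1 - blindPost ρ p m

/-- The expected cost of an observation after `m` steps, in terms of `obsValue`. -/
def waitCost (c ρ : ℝ) (f₀ f₁ : ℝ → ℝ) (V : ℝ → ℝ) (p : ℝ) (m : ℕ) : ℝ :=
  c * ∑ k ∈ Finset.range m, blindPost ρ p k + obsValue f₀ f₁ V (blindPost ρ p m)

lemma sum_blindPost_succ (ρ p : ℝ) (m : ℕ) :
    ∑ k ∈ Finset.range (m + 1), blindPost ρ p k =
      p + ∑ k ∈ Finset.range m, blindPost ρ (Phi0 ρ p) k := by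
  rw [Finset.sum_range_succ', add_comm]
  simp [blindPost_Phi0]

/-- First-step analysis: the present instant costs `c * p`, and the problem restarts at `Phi0 ρ p`.
The same recursion holds for `waitCost`. -/
lemma stopCost_succ (c ρ p : ℝ) (m : ℕ) :
    stopCost c ρ p (m + 1) = c * p + stopCost c ρ (Phi0 ρ p) m := by
  unfold stopCost
  rw [sum_blindPost_succ, blindPost_Phi0]
  ring

@[simp] lemma stopCost_zero (c ρ p : ℝ) : stopCost c ρ p 0 = 1 - p := by
  simp [stopCost]

lemma waitCost_succ (c ρ : ℝ) (f₀ f₁ : ℝ → ℝ) (V : ℝ → ℝ) (p : ℝ) (m : ℕ) :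
    waitCost c ρ f₀ f₁ V p (m + 1) = c * p + waitCost c ρ f₀ f₁ V (Phi0 ρ p) m := by
  unfold waitCost
  rw [sum_blindPost_succ, blindPost_Phi0]
  ring

@[simp] lemma waitCost_zero (c ρ : ℝ) (f₀ f₁ : ℝ → ℝ) (V : ℝ → ℝ) (p : ℝ) :
    waitCost c ρ f₀ f₁ V p 0 = obsValue f₀ f₁ V p := by
  simp [waitCost]

lemma sum_blindPost_combo (ρ p q a b : ℝ) (hab : a + b = 1) (m : ℕ) :
    ∑ k ∈ Finset.range m, blindPost ρ (a * p + b * q) k =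
      a * ∑ k ∈ Finset.range m, blindPost ρ p k + b * ∑ k ∈ Finset.range m, blindPost ρ q k := by
  simp only [blindPost_combo ρ p q a b hab, Finset.sum_add_distrib, Finset.mul_sum]

section

variable {c ρ : ℝ} {f₀ f₁ : ℝ → ℝ} {V : ℝ → ℝ}

lemma sum_blindPost_nonneg (hρ₀ : 0 < ρ) (hρ₁ : ρ < 1) {p : ℝ} (hp : p ∈ Icc (0 : ℝ) 1) (m : ℕ) :
    0 ≤ ∑ k ∈ Finset.range m, blindPost ρ p k :=
  Finset.sum_nonneg fun k _ => (blindPost_mem hρ₀ hρ₁ hp k).1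

lemma stopCost_nonneg (hc : 0 < c) (hρ₀ : 0 < ρ) (hρ₁ : ρ < 1) {p : ℝ} (hp : p ∈ Icc (0 : ℝ) 1)
    (m : ℕ) : 0 ≤ stopCost c ρ p m := by
  have := mul_nonneg hc.le (sum_blindPost_nonneg hρ₀ hρ₁ hp m)
  have := (blindPost_mem hρ₀ hρ₁ hp m).2
  unfold stopCost
  linarith

lemma stopCost_concaveOn : ConcaveOn ℝ (Icc 0 1) fun p => stopCost c ρ p m := by
  refine ⟨convex_Icc 0 1, fun p _ q _ a b _ _ hab => le_of_eq ?_⟩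
  simp only [smul_eq_mul]
  unfold stopCost
  rw [blindPost_combo ρ p q a b hab, sum_blindPost_combo ρ p q a b hab]
  obtain rfl : b = 1 - a := by linarith
  ring

lemma continuous_sum_blindPost (ρ : ℝ) (m : ℕ) :
    Continuous fun p => ∑ k ∈ Finset.range m, blindPost ρ p k :=
  continuous_finsetSum _ fun k _ => continuous_blindPost ρ k

lemma bddBelow_stopCost (hc : 0 < c) (hρ₀ : 0 < ρ) (hρ₁ : ρ < 1) {p : ℝ}
    (hp : p ∈ Icc (0 : ℝ) 1) : BddBelow (range fun m : ℕ => stopCost c ρ p m) :=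
  ⟨0, by rintro _ ⟨m, rfl⟩; exact stopCost_nonneg hc hρ₀ hρ₁ hp m⟩

lemma V_zero_le (hc : 0 < c) (hρ₀ : 0 < ρ) (hρ₁ : ρ < 1) {p : ℝ} (hp : p ∈ Icc (0 : ℝ) 1)
    (m : ℕ) : QuickestDetection.V c ρ f₀ f₁ 0 p ≤ stopCost c ρ p m :=
  ciInf_le (bddBelow_stopCost hc hρ₀ hρ₁ hp) m

lemma isRegular_V_zero (hc : 0 < c) (hρ₀ : 0 < ρ) (hρ₁ : ρ < 1) :
    IsRegular (QuickestDetection.V c ρ f₀ f₁ 0) := by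
  refine IsRegular.of_concaveOn
    (concaveOn_iInf (convex_Icc 0 1) (fun m => stopCost_concaveOn)
      fun m p hp => stopCost_nonneg hc hρ₀ hρ₁ hp m)
    (fun p hp => le_ciInf fun m => stopCost_nonneg hc hρ₀ hρ₁ hp m)
    (fun p hp => (V_zero_le hc hρ₀ hρ₁ hp 0).trans_eq (stopCost_zero c ρ p)) fun ε hε => ?_
  -- An `ε`-optimal `m` at `p = 0` provides the continuous majorant.
  obtain ⟨m, hm⟩ := exists_lt_of_ciInf_lt
    (lt_add_of_pos_right (QuickestDetection.V c ρ f₀ f₁ 0 0) hε)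
  refine ⟨fun p => stopCost c ρ p m, ?_, hm, fun p hp => V_zero_le hc hρ₀ hρ₁ hp m⟩
  have h1 := continuous_sum_blindPost ρ m
  have h2 := continuous_blindPost ρ m
  unfold stopCost
  fun_prop

lemma obsLaw_eq (p : ℝ) (m : ℕ) : obsLaw ρ f₀ f₁ p m = mixLaw f₀ f₁ (blindPost ρ p m) := rfl

/-- At `m = 0` the truncated `m - 1` would make the update one step too long. -/
lemma Phi1_blindPost {m : ℕ} (hm : 1 ≤ m) (p x : ℝ) :
    Phi1 ρ f₀ f₁ x (blindPost ρ p (m - 1)) = bayes f₀ f₁ (blindPost ρ p m) x := by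
  rw [Phi1_eq_bayes, Phi0_blindPost, Nat.sub_add_cancel hm]

lemma continuationCost_eq (hρ₀ : 0 < ρ) (hρ₁ : ρ < 1) (hf₀ : IsPdf f₀) (hf₁ : IsPdf f₁)
    (hV : IsRegular V) {p : ℝ} (hp : p ∈ Icc (0 : ℝ) 1) {m : ℕ} (hm : 1 ≤ m) :
    continuationCost c ρ f₀ f₁ V p m = waitCost c ρ f₀ f₁ V p m := by
  have hq := blindPost_mem hρ₀ hρ₁ hp m
  have := isProbabilityMeasure_mixLaw hf₀ hf₁ hq
  unfold continuationCost waitCost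
  simp only [Phi1_blindPost hm, obsLaw_eq]
  rw [integral_add (integrable_const _) (integrable_mixLaw hf₀ hf₁ hV hq), integral_const,
    integral_mixLaw hf₀ hf₁ hq]
  simp [obsValue]

lemma waitCost_nonneg (hc : 0 < c) (hρ₀ : 0 < ρ) (hρ₁ : ρ < 1) (hf₀ : IsPdf f₀) (hf₁ : IsPdf f₁)
    (hV : IsRegular V) {p : ℝ} (hp : p ∈ Icc (0 : ℝ) 1) (m : ℕ) :
    0 ≤ waitCost c ρ f₀ f₁ V p m :=
  add_nonneg (mul_nonneg hc.le (sum_blindPost_nonneg hρ₀ hρ₁ hp m))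
    (obsValue_nonneg hf₀ hf₁ hV (blindPost_mem hρ₀ hρ₁ hp m))

lemma waitCost_concaveOn (hρ₀ : 0 < ρ) (hρ₁ : ρ < 1) (hf₀ : IsPdf f₀) (hf₁ : IsPdf f₁)
    (hV : IsRegular V) (m : ℕ) :
    ConcaveOn ℝ (Icc 0 1) fun p => waitCost c ρ f₀ f₁ V p m := by
  refine ⟨convex_Icc 0 1, fun p hp q hq a b ha hb hab => ?_⟩
  have key := (obsValue_concaveOn hf₀ hf₁ hV).2 (blindPost_mem hρ₀ hρ₁ hp m)
    (blindPost_mem hρ₀ hρ₁ hq m) ha hb hab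
  simp only [smul_eq_mul] at key ⊢
  unfold waitCost
  rw [blindPost_combo ρ p q a b hab, sum_blindPost_combo ρ p q a b hab]
  linarith

/-- From `p = 0`, after at least one step the prior of the observation lies in the open unit
interval, where the concave `obsValue` is continuous. For `m = 0` it would sit at the endpoint. -/
lemma continuousWithinAt_waitCost (hρ₀ : 0 < ρ) (hρ₁ : ρ < 1) (hf₀ : IsPdf f₀) (hf₁ : IsPdf f₁)
    (hV : IsRegular V) {m : ℕ} (hm : 1 ≤ m) :
    ContinuousWithinAt (fun p => waitCost c ρ f₀ f₁ V p m) (Icc 0 1) 0 := by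
  have h : blindPost ρ 0 m ∈ Ioo (0 : ℝ) 1 := by
    rw [blindPost_eq]
    have h1 : 0 < (1 - ρ) ^ m := pow_pos (by linarith) m
    have h2 : (1 - ρ) ^ m < 1 := pow_lt_one₀ (by linarith) (by linarith) (by omega)
    constructor <;> linarith
  have hD : ContinuousAt (obsValue f₀ f₁ V) (blindPost ρ 0 m) :=
    (((obsValue_concaveOn hf₀ hf₁ hV).subset Ioo_subset_Icc_self
      (convex_Ioo 0 1)).continuousOn isOpen_Ioo).continuousAt (Ioo_mem_nhds h.1 h.2)
  have hD' : ContinuousAt (fun p => obsValue f₀ f₁ V (blindPost ρ p m)) 0 :=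
    ContinuousAt.comp (f := fun p => blindPost ρ p m) hD (continuous_blindPost ρ m).continuousAt
  exact (((continuous_sum_blindPost ρ m).const_mul c).continuousAt.add hD').continuousWithinAt

lemma opG_eq (hρ₀ : 0 < ρ) (hρ₁ : ρ < 1) (hf₀ : IsPdf f₀) (hf₁ : IsPdf f₁)
    (hV : IsRegular V) {p : ℝ} (hp : p ∈ Icc (0 : ℝ) 1) :
    opG c ρ f₀ f₁ V p = min (1 - p) (⨅ m : ℕ+, waitCost c ρ f₀ f₁ V p m) := by
  unfold opG
  congr 2
  exact funext fun m => continuationCost_eq hρ₀ hρ₁ hf₀ hf₁ hV hp m.2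

lemma bddBelow_waitCost (hc : 0 < c) (hρ₀ : 0 < ρ) (hρ₁ : ρ < 1) (hf₀ : IsPdf f₀)
    (hf₁ : IsPdf f₁) (hV : IsRegular V) {p : ℝ} (hp : p ∈ Icc (0 : ℝ) 1) :
    BddBelow (range fun m : ℕ+ => waitCost c ρ f₀ f₁ V p m) :=
  ⟨0, by rintro _ ⟨m, rfl⟩; exact waitCost_nonneg hc hρ₀ hρ₁ hf₀ hf₁ hV hp m⟩

lemma opG_le_waitCost (hc : 0 < c) (hρ₀ : 0 < ρ) (hρ₁ : ρ < 1) (hf₀ : IsPdf f₀)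
    (hf₁ : IsPdf f₁) (hV : IsRegular V) {p : ℝ} (hp : p ∈ Icc (0 : ℝ) 1) {m : ℕ} (hm : 1 ≤ m) :
    opG c ρ f₀ f₁ V p ≤ waitCost c ρ f₀ f₁ V p m := by
  rw [opG_eq hρ₀ hρ₁ hf₀ hf₁ hV hp]
  exact (min_le_right _ _).trans
    (ciInf_le (bddBelow_waitCost hc hρ₀ hρ₁ hf₀ hf₁ hV hp) (⟨m, hm⟩ : ℕ+))

lemma isRegular_opG (hc : 0 < c) (hρ₀ : 0 < ρ) (hρ₁ : ρ < 1) (hf₀ : IsPdf f₀) (hf₁ : IsPdf f₁)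
    (hV : IsRegular V) : IsRegular (opG c ρ f₀ f₁ V) := by
  have hlin : ConcaveOn ℝ (Icc 0 1) fun p : ℝ => 1 - p :=
    ⟨convex_Icc 0 1, fun p _ q _ a b _ _ hab => le_of_eq (by
      simp only [smul_eq_mul]; obtain rfl : b = 1 - a := by linarith
      ring)⟩
  have hinf := concaveOn_iInf (ι := ℕ+) (convex_Icc 0 1)
    (fun m => waitCost_concaveOn (c := c) hρ₀ hρ₁ hf₀ hf₁ hV m)
    fun m p hp => waitCost_nonneg hc hρ₀ hρ₁ hf₀ hf₁ hV hp m
  refine IsRegular.of_concaveOn ((hlin.inf hinf).congr fun p hp =>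
      (opG_eq hρ₀ hρ₁ hf₀ hf₁ hV hp).symm) (fun p hp => ?_)
    (fun p hp => min_le_left _ _) fun ε hε => ?_
  · rw [opG_eq hρ₀ hρ₁ hf₀ hf₁ hV hp]
    exact le_min (by linarith [hp.2])
      (le_ciInf fun m => waitCost_nonneg hc hρ₀ hρ₁ hf₀ hf₁ hV hp m)
  · have h0 : (0 : ℝ) ∈ Icc (0 : ℝ) 1 := by simp
    rcases min_lt_iff.1 ((opG_eq hρ₀ hρ₁ hf₀ hf₁ hV h0).symm.trans_lt
      (lt_add_of_pos_right _ hε)) with h | h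
    · exact ⟨fun p => 1 - p, by fun_prop, h, fun p hp => min_le_left _ _⟩
    · obtain ⟨m, hm⟩ := exists_lt_of_ciInf_lt h
      exact ⟨fun p => waitCost c ρ f₀ f₁ V p m,
        continuousWithinAt_waitCost hρ₀ hρ₁ hf₀ hf₁ hV m.2, hm,
        fun p hp => opG_le_waitCost hc hρ₀ hρ₁ hf₀ hf₁ hV hp m.2⟩

lemma isRegular_V (hc : 0 < c) (hρ₀ : 0 < ρ) (hρ₁ : ρ < 1) (hf₀ : IsPdf f₀) (hf₁ : IsPdf f₁)
    (n : ℕ) : IsRegular (QuickestDetection.V c ρ f₀ f₁ n) := by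
  induction n with
  | zero => exact isRegular_V_zero hc hρ₀ hρ₁
  | succ n ih => exact isRegular_opG hc hρ₀ hρ₁ hf₀ hf₁ ih

/-! ### The dynamic programming inequalities -/

/-- A plan from `Phi0 ρ p` becomes a plan from `p` with a wait longer by one. For `n ≥ 1` one plan
has no counterpart at `p`: stopping at `Phi0 ρ p` unobserved. It is dominated by sampling at that
very time. -/
lemma V_le_blind (hc : 0 < c) (hρ₀ : 0 < ρ) (hρ₁ : ρ < 1) (hf₀ : IsPdf f₀) (hf₁ : IsPdf f₁)
    (n : ℕ) {p : ℝ} (hp : p ∈ Icc (0 : ℝ) 1) :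
    QuickestDetection.V c ρ f₀ f₁ n p ≤
      c * p + QuickestDetection.V c ρ f₀ f₁ n (Phi0 ρ p) := by
  have hp' := Phi0_mem hρ₀ hρ₁ hp
  rw [← sub_le_iff_le_add']
  cases n with
  | zero =>
    refine le_ciInf fun m => ?_
    have h := V_zero_le (f₀ := f₀) (f₁ := f₁) hc hρ₀ hρ₁ hp (m + 1)
    rw [stopCost_succ] at h
    exact sub_le_iff_le_add'.2 h
  | succ n =>
    have hV := isRegular_V hc hρ₀ hρ₁ hf₀ hf₁ n
    have hle : ∀ m : ℕ, QuickestDetection.V c ρ f₀ f₁ (n + 1) p - c * p ≤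
        waitCost c ρ f₀ f₁ (QuickestDetection.V c ρ f₀ f₁ n) (Phi0 ρ p) m := fun m => by
      have h := opG_le_waitCost hc hρ₀ hρ₁ hf₀ hf₁ hV hp (Nat.le_add_left 1 m)
      rw [waitCost_succ] at h
      exact sub_le_iff_le_add'.2 h
    refine le_trans (le_min ?_ (le_ciInf fun m : ℕ+ => hle m))
      (opG_eq hρ₀ hρ₁ hf₀ hf₁ hV hp').ge
    exact (hle 0).trans (by
      rw [waitCost_zero]; exact (obsValue_le hf₀ hf₁ hV hp').trans (hV.le _ hp'))

lemma V_succ_le_obsValue (hc : 0 < c) (hρ₀ : 0 < ρ) (hρ₁ : ρ < 1) (hf₀ : IsPdf f₀)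
    (hf₁ : IsPdf f₁) (n : ℕ) {p : ℝ} (hp : p ∈ Icc (0 : ℝ) 1) :
    QuickestDetection.V c ρ f₀ f₁ (n + 1) p ≤
      c * p + obsValue f₀ f₁ (QuickestDetection.V c ρ f₀ f₁ n) (Phi0 ρ p) := by
  have h := opG_le_waitCost hc hρ₀ hρ₁ hf₀ hf₁ (isRegular_V hc hρ₀ hρ₁ hf₀ hf₁ n) hp le_rfl
  rwa [← zero_add 1, waitCost_succ, waitCost_zero] at h

/-- Principle of optimality: if `m + 1` is an optimal wait at `p`, then `V(p) ≤ c p + V(Φ₀ p) ≤ c p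
+ waitCost (Φ₀ p) m = V(p)`, so both inequalities are equalities and `m` is optimal at `Φ₀ p`. -/
lemma V_succ_eq_of_waitCost (hc : 0 < c) (hρ₀ : 0 < ρ) (hρ₁ : ρ < 1) (hf₀ : IsPdf f₀)
    (hf₁ : IsPdf f₁) {n : ℕ} {p : ℝ} (hp : p ∈ Icc (0 : ℝ) 1) {m : ℕ} (hm : 1 ≤ m)
    (h : QuickestDetection.V c ρ f₀ f₁ (n + 1) p =
      waitCost c ρ f₀ f₁ (QuickestDetection.V c ρ f₀ f₁ n) p (m + 1)) :
    QuickestDetection.V c ρ f₀ f₁ (n + 1) p =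
        c * p + QuickestDetection.V c ρ f₀ f₁ (n + 1) (Phi0 ρ p) ∧
      QuickestDetection.V c ρ f₀ f₁ (n + 1) (Phi0 ρ p) =
        waitCost c ρ f₀ f₁ (QuickestDetection.V c ρ f₀ f₁ n) (Phi0 ρ p) m := by
  have h1 := V_le_blind hc hρ₀ hρ₁ hf₀ hf₁ (n + 1) hp
  have h2 : QuickestDetection.V c ρ f₀ f₁ (n + 1) (Phi0 ρ p) ≤ _ :=
    opG_le_waitCost hc hρ₀ hρ₁ hf₀ hf₁ (isRegular_V hc hρ₀ hρ₁ hf₀ hf₁ n)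
      (Phi0_mem hρ₀ hρ₁ hp) hm
  rw [waitCost_succ] at h
  constructor <;> linarith

/-- Every plan either stops now or makes one blind step, so `V_0(p)` is at least the minimum of the
two costs; the first is excluded. -/
lemma V_zero_eq_of_lt (hc : 0 < c) (hρ₀ : 0 < ρ) (hρ₁ : ρ < 1) (hf₀ : IsPdf f₀) (hf₁ : IsPdf f₁)
    {p : ℝ} (hp : p ∈ Icc (0 : ℝ) 1) (h : QuickestDetection.V c ρ f₀ f₁ 0 p < 1 - p) :
    QuickestDetection.V c ρ f₀ f₁ 0 p =
      c * p + QuickestDetection.V c ρ f₀ f₁ 0 (Phi0 ρ p) := by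
  refine le_antisymm (V_le_blind hc hρ₀ hρ₁ hf₀ hf₁ 0 hp) ?_
  have : min (1 - p) (c * p + QuickestDetection.V c ρ f₀ f₁ 0 (Phi0 ρ p)) ≤
      QuickestDetection.V c ρ f₀ f₁ 0 p := by
    refine le_ciInf fun m => ?_
    cases m with
    | zero => exact (min_le_left _ _).trans_eq (stopCost_zero c ρ p).symm
    | succ m =>
      refine (min_le_right _ _).trans ?_
      have := V_zero_le (f₀ := f₀) (f₁ := f₁) hc hρ₀ hρ₁ (Phi0_mem hρ₀ hρ₁ hp) m
      exact (add_le_add le_rfl this).trans_eq (stopCost_succ c ρ p m).symm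
  rcases min_le_iff.1 this with h' | h'
  · linarith
  · exact h'

/-- After the first instant the posterior is at least `ρ`, so each further step costs at least `c *
ρ`. Long waits are worse than a wait of one step, and only finitely many candidates remain. -/
lemma exists_argmin_waitCost (hc : 0 < c) (hρ₀ : 0 < ρ) (hρ₁ : ρ < 1) (hf₀ : IsPdf f₀)
    (hf₁ : IsPdf f₁) (hV : IsRegular V) {p : ℝ} (hp : p ∈ Icc (0 : ℝ) 1) :
    ∃ m : ℕ, 1 ≤ m ∧ ∀ m' : ℕ, 1 ≤ m' →
      waitCost c ρ f₀ f₁ V p m ≤ waitCost c ρ f₀ f₁ V p m' := by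
  obtain ⟨M, hM⟩ := exists_nat_gt (waitCost c ρ f₀ f₁ V p 1 / (c * ρ))
  rw [div_lt_iff₀ (mul_pos hc hρ₀)] at hM
  obtain ⟨m, hm, hmin⟩ := (Finset.Icc 1 (M + 1)).exists_min_image
    (fun m => waitCost c ρ f₀ f₁ V p m) ⟨1, by simp⟩
  refine ⟨m, (Finset.mem_Icc.1 hm).1, fun m' hm' => ?_⟩
  rcases le_or_gt m' (M + 1) with h | h
  · exact hmin m' (Finset.mem_Icc.2 ⟨hm', h⟩)
  · refine (hmin 1 (by simp)).trans ?_
    obtain ⟨j, rfl⟩ : ∃ j, m' = j + 1 := ⟨m' - 1, by omega⟩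
    have h1 : (j : ℝ) * ρ ≤ ∑ k ∈ Finset.range j, blindPost ρ p (k + 1) := by
      have := Finset.card_nsmul_le_sum (Finset.range j) (fun k => blindPost ρ p (k + 1)) ρ
        fun k _ => le_blindPost_succ hρ₀ hρ₁ hp k
      simpa using this
    have h2 : (M : ℝ) ≤ j := by exact_mod_cast (by omega : M ≤ j)
    have h3 := obsValue_nonneg hf₀ hf₁ hV (blindPost_mem hρ₀ hρ₁ hp (j + 1))
    have h4 : (M : ℝ) * ρ ≤ j * ρ := mul_le_mul_of_nonneg_right h2 hρ₀.le
    have h5 := mul_le_mul_of_nonneg_left (h4.trans h1) hc.le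
    have h6 := mul_nonneg hc.le hp.1
    refine hM.le.trans ?_
    -- The summand `k = 0` is `p`, which may be `0`; this is why the finite search goes up to `M +
    -- 1`.
    conv_rhs => rw [waitCost, Finset.sum_range_succ', blindPost_zero]
    nlinarith

/-! ### Thresholds -/

/-- The contact set is closed and contains `1`, hence contains its infimum `a`. On `[a, 1]` the
chord of `V` is `1 - p`, so concavity gives `V p ≥ 1 - p`, and the reverse inequality always holds.
-/
lemma IsRegular.sInf_le_iff (hV : IsRegular V) {p : ℝ} (hp : p ∈ Icc (0 : ℝ) 1) :
    sInf {p : ℝ | p ∈ Icc (0 : ℝ) 1 ∧ 1 - p = V p} ≤ p ↔ 1 - p = V p := by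
  set S := {p : ℝ | p ∈ Icc (0 : ℝ) 1 ∧ 1 - p = V p} with hS
  have hbdd : BddBelow S := ⟨0, fun x hx => hx.1.1⟩
  refine ⟨fun h => ?_, fun h => csInf_le hbdd ⟨hp, h⟩⟩
  have hclosed : IsClosed S := by
    have : S = Icc 0 1 ∩ (fun p => V p - (1 - p)) ⁻¹' {0} := by
      ext x; simp only [hS, mem_ofPred_eq, mem_inter_iff, mem_preimage, mem_singleton_iff]
      refine and_congr_right fun _ => ⟨fun h => by linarith, fun h => by linarith⟩
    rw [this]
    exact (hV.continuousOn.sub (by fun_prop)).preimage_isClosed_of_isClosed isClosed_Icc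
      isClosed_singleton
  have h1 : (1 : ℝ) ∈ S := ⟨by simp, by rw [hV.map_one]; ring⟩
  obtain ⟨ha, hVa⟩ := hclosed.csInf_mem ⟨1, h1⟩ hbdd
  generalize sInf S = a at *
  rcases h.eq_or_lt with rfl | hlt
  · exact hVa
  refine le_antisymm ?_ (hV.le p hp)
  have ha1 : 0 < 1 - a := by linarith [hp.2]
  have key := hV.concaveOn.2 ha (show (1 : ℝ) ∈ Icc (0 : ℝ) 1 by simp)
    (show 0 ≤ (1 - p) / (1 - a) from div_nonneg (by linarith [hp.2]) ha1.le)
    (show 0 ≤ (p - a) / (1 - a) from div_nonneg (by linarith) ha1.le) (by field_simp; ring)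
  simp only [smul_eq_mul, hV.map_one, ← hVa] at key
  have e : (1 - p) / (1 - a) * a + (p - a) / (1 - a) * 1 = p := by field_simp; ring
  rw [e, div_mul_cancel₀ _ ha1.ne'] at key
  linarith

lemma threshold_le_iff (hc : 0 < c) (hρ₀ : 0 < ρ) (hρ₁ : ρ < 1) (hf₀ : IsPdf f₀)
    (hf₁ : IsPdf f₁) (N n : ℕ) {p : ℝ} (hp : p ∈ Icc (0 : ℝ) 1) :
    threshold c ρ f₀ f₁ N n ≤ p ↔ QuickestDetection.V c ρ f₀ f₁ (N - n) p = 1 - p :=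
  ((isRegular_V hc hρ₀ hρ₁ hf₀ hf₁ (N - n)).sInf_le_iff hp).trans eq_comm

lemma lt_threshold_iff (hc : 0 < c) (hρ₀ : 0 < ρ) (hρ₁ : ρ < 1) (hf₀ : IsPdf f₀)
    (hf₁ : IsPdf f₁) (N n : ℕ) {p : ℝ} (hp : p ∈ Icc (0 : ℝ) 1) :
    p < threshold c ρ f₀ f₁ N n ↔ QuickestDetection.V c ρ f₀ f₁ (N - n) p < 1 - p := by
  rw [← not_le, threshold_le_iff hc hρ₀ hρ₁ hf₀ hf₁ N n hp,
    ((isRegular_V hc hρ₀ hρ₁ hf₀ hf₁ (N - n)).le p hp).lt_iff_ne]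

/-- Below the threshold, the value is the cost of the best waiting time. -/
lemma V_succ_eq_waitCost (hc : 0 < c) (hρ₀ : 0 < ρ) (hρ₁ : ρ < 1) (hf₀ : IsPdf f₀)
    (hf₁ : IsPdf f₁) {n : ℕ} {p : ℝ} (hp : p ∈ Icc (0 : ℝ) 1)
    (hlt : QuickestDetection.V c ρ f₀ f₁ (n + 1) p < 1 - p) {m : ℕ} (hm : 1 ≤ m)
    (hmin : ∀ m' : ℕ, 1 ≤ m' →
      waitCost c ρ f₀ f₁ (QuickestDetection.V c ρ f₀ f₁ n) p m ≤
        waitCost c ρ f₀ f₁ (QuickestDetection.V c ρ f₀ f₁ n) p m') :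
    QuickestDetection.V c ρ f₀ f₁ (n + 1) p =
      waitCost c ρ f₀ f₁ (QuickestDetection.V c ρ f₀ f₁ n) p m := by
  have hV := isRegular_V hc hρ₀ hρ₁ hf₀ hf₁ n
  have e : QuickestDetection.V c ρ f₀ f₁ (n + 1) p = _ := opG_eq hρ₀ hρ₁ hf₀ hf₁ hV hp
  refine le_antisymm (opG_le_waitCost hc hρ₀ hρ₁ hf₀ hf₁ hV hp hm) ?_
  rw [e] at hlt ⊢
  rcases min_lt_iff.1 hlt with h | h
  · exact absurd h (lt_irrefl _)
  · rw [min_eq_right h.le]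
    exact le_ciInf fun m' => hmin m' m'.2

/-- The hypothesis says that one more step costs at least as much in delay as it saves in false
alarm. It is inherited by `Phi0 ρ q`, because the posterior increases, so no longer wait pays
either. -/
lemma one_sub_le_stopCost (hc : 0 < c) (hρ₀ : 0 < ρ) (hρ₁ : ρ < 1) (m : ℕ) {q : ℝ}
    (hq : q ∈ Icc (0 : ℝ) 1) (h : (1 - q) * ρ ≤ c * q) : 1 - q ≤ stopCost c ρ q m := by
  induction m generalizing q with
  | zero => simp
  | succ m ih =>
    have h1 : 0 ≤ (1 - q) * ρ := mul_nonneg (by linarith [hq.2]) hρ₀.le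
    rw [stopCost_succ]
    refine le_trans ?_ (add_le_add le_rfl (ih (Phi0_mem hρ₀ hρ₁ hq) ?_))
    · unfold Phi0; linarith
    · unfold Phi0; nlinarith [mul_nonneg hc.le h1, mul_nonneg h1 hρ₀.le]

/-- The blind posterior tends to `1`, so the last phase, without samples, ends in finite time. -/
lemma exists_threshold_le_blindPost (hc : 0 < c) (hρ₀ : 0 < ρ) (hρ₁ : ρ < 1) (hf₀ : IsPdf f₀)
    (hf₁ : IsPdf f₁) (N : ℕ) {p : ℝ} (hp : p ∈ Icc (0 : ℝ) 1) :
    ∃ k : ℕ, threshold c ρ f₀ f₁ N N ≤ blindPost ρ p k := by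
  -- The bound `1 - q ≤ c / (c + ρ)` is equivalent to `(1 - q) * ρ ≤ c * q`.
  obtain ⟨k, hk⟩ := exists_pow_lt_of_lt_one (show 0 < c / (c + ρ) by positivity)
    (show 1 - ρ < 1 by linarith)
  refine ⟨k, (threshold_le_iff hc hρ₀ hρ₁ hf₀ hf₁ N N (blindPost_mem hρ₀ hρ₁ hp k)).2 ?_⟩
  have hq := blindPost_mem hρ₀ hρ₁ hp k
  rw [Nat.sub_self]
  refine le_antisymm ((isRegular_V hc hρ₀ hρ₁ hf₀ hf₁ 0).le _ hq)
    (le_ciInf fun m => one_sub_le_stopCost hc hρ₀ hρ₁ m hq ?_)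
  rw [lt_div_iff₀ (by positivity)] at hk
  have h1 : 0 ≤ (1 - ρ) ^ k := pow_nonneg (by linarith) k
  have h2 : (1 - p) * (1 - ρ) ^ k ≤ (1 - ρ) ^ k := by nlinarith [hp.1]
  rw [blindPost_eq]
  nlinarith

end

/-! ### Consequences of the change-point model -/

/-- The measure with density `f`. -/
def pdfLaw (f : ℝ → ℝ) : Measure ℝ := volume.withDensity fun x => ENNReal.ofReal (f x)

lemma IsPdf.isProbabilityMeasure {f : ℝ → ℝ} (hf : IsPdf f) : IsProbabilityMeasure (pdfLaw f) :=
  ⟨by rw [pdfLaw, withDensity_apply _ MeasurableSet.univ, Measure.restrict_univ,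
    hf.lintegral_eq_one]⟩

section

variable {Ω : Type*}

/-- The information generated by `X 1, …, X k`. -/
abbrev obsInfo (X : ℕ → Ω → ℝ) (k : ℕ) : MeasurableSpace Ω :=
  ⨆ i ∈ Finset.Icc 1 k, MeasurableSpace.comap (X i) inferInstance

/-- The sets `{X 1 ∈ E 1, …, X k ∈ E k}`. -/
def obsCylinders (X : ℕ → Ω → ℝ) (k : ℕ) : Set (Set Ω) :=
  {A | ∃ E : ℕ → Set ℝ, (∀ i, MeasurableSet (E i)) ∧ A = {ω | ∀ i ∈ Finset.Icc 1 k, X i ω ∈ E i}}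

lemma isPiSystem_obsCylinders (X : ℕ → Ω → ℝ) (k : ℕ) : IsPiSystem (obsCylinders X k) := by
  rintro _ ⟨E, hE, rfl⟩ _ ⟨F, hF, rfl⟩ -
  refine ⟨fun i => E i ∩ F i, fun i => (hE i).inter (hF i), ?_⟩
  ext ω
  simp only [mem_inter_iff, mem_ofPred_eq]
  exact ⟨fun h i hi => ⟨h.1 i hi, h.2 i hi⟩,
    fun h => ⟨fun i hi => (h i hi).1, fun i hi => (h i hi).2⟩⟩

lemma measurable_obsInfo (X : ℕ → Ω → ℝ) {k i : ℕ} (hi : i ∈ Finset.Icc 1 k) :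
    Measurable[obsInfo X k] (X i) :=
  Measurable.of_comap_le
    (le_iSup₂ (f := fun i (_ : i ∈ Finset.Icc 1 k) =>
      MeasurableSpace.comap (X i) (inferInstance : MeasurableSpace ℝ)) i hi)

lemma obsInfo_eq_generateFrom (X : ℕ → Ω → ℝ) (k : ℕ) :
    obsInfo X k = MeasurableSpace.generateFrom (obsCylinders X k) := by
  refine le_antisymm (iSup₂_le fun i hi => ?_) (MeasurableSpace.generateFrom_le ?_)
  · rintro _ ⟨B, hB, rfl⟩
    refine MeasurableSpace.measurableSet_generateFrom
      ⟨Function.update (fun _ => univ) i B, fun j => ?_, ?_⟩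
    · rcases eq_or_ne j i with rfl | h
      · simpa using hB
      · simp [Function.update_of_ne h]
    · ext ω
      simp only [mem_preimage, mem_ofPred_eq]
      refine ⟨fun h j _ => ?_, fun h => by simpa using h i hi⟩
      rcases eq_or_ne j i with rfl | hj
      · simpa using h
      · simp [Function.update_of_ne hj]
  · rintro _ ⟨E, hE, rfl⟩
    have : {ω | ∀ i ∈ Finset.Icc 1 k, X i ω ∈ E i} = ⋂ i ∈ Finset.Icc 1 k, X i ⁻¹' E i := by
      ext; simp
    rw [this]
    exact Finset.measurableSet_biInter _ fun i hi => measurable_obsInfo X hi (hE i)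

/-- The sets that agree with a set of `m` on `S` and with another one on `Sᶜ`. -/
abbrev splitSpace (m : MeasurableSpace Ω) (S : Set Ω) : MeasurableSpace Ω where
  MeasurableSet' A := ∃ A₁ A₂, MeasurableSet[m] A₁ ∧ MeasurableSet[m] A₂ ∧
    ∀ ω, (ω ∈ S → (ω ∈ A ↔ ω ∈ A₁)) ∧ (ω ∉ S → (ω ∈ A ↔ ω ∈ A₂))
  measurableSet_empty := ⟨∅, ∅, MeasurableSet.empty, MeasurableSet.empty, by simp⟩
  measurableSet_compl := by
    rintro A ⟨A₁, A₂, h₁, h₂, h⟩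
    exact ⟨A₁ᶜ, A₂ᶜ, h₁.compl, h₂.compl, fun ω =>
      ⟨fun hω => not_congr ((h ω).1 hω), fun hω => not_congr ((h ω).2 hω)⟩⟩
  measurableSet_iUnion := by
    intro f hf
    choose A₁ A₂ h₁ h₂ h using hf
    refine ⟨⋃ i, A₁ i, ⋃ i, A₂ i, MeasurableSet.iUnion h₁, MeasurableSet.iUnion h₂, fun ω => ?_⟩
    simp only [mem_iUnion]
    exact ⟨fun hω => exists_congr fun i => (h i ω).1 hω,
      fun hω => exists_congr fun i => (h i ω).2 hω⟩

lemma sup_le_splitSpace {𝒢 : MeasurableSpace Ω} (m : MeasurableSpace Ω) {S : Set Ω}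
    (h : 𝒢 ≤ MeasurableSpace.generateFrom {S}) : 𝒢 ⊔ m ≤ splitSpace m S := by
  refine sup_le (h.trans (MeasurableSpace.generateFrom_le ?_)) fun A hA =>
    ⟨A, A, hA, hA, fun ω => by simp⟩
  rintro _ rfl
  exact ⟨univ, ∅, MeasurableSet.univ, MeasurableSet.empty, fun ω => by simp⟩

/-- The initial information tells at most whether `Λ = 0`. So on each `{Λ = l}` the event is an
event of the observations alone, and the same one for all `l ≥ 1`, which allows comparing `{Λ = l}`
with `{Λ = l + 1}`. -/
lemma exists_obsInfo_trace {𝒢 : MeasurableSpace Ω} {Λ : Ω → ℕ} {X : ℕ → Ω → ℝ}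
    (h𝒢 : 𝒢 ≤ MeasurableSpace.generateFrom {{ω | Λ ω = 0}}) {k : ℕ}
    {A : Set Ω} (hA : MeasurableSet[𝒢 ⊔ obsInfo X k] A) :
    ∃ A' : ℕ → Set Ω, (∀ l, MeasurableSet[obsInfo X k] (A' l)) ∧
      (∀ l, A ∩ Λ ⁻¹' {l} = A' l ∩ Λ ⁻¹' {l}) ∧ ∀ l, A' (l + 1) = A' 1 := by
  obtain ⟨A₁, A₂, h₁, h₂, h⟩ := sup_le_splitSpace (obsInfo X k) h𝒢 A hA
  refine ⟨fun l => if l = 0 then A₁ else A₂, fun l => ?_, fun l => ?_, fun l => by simp⟩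
  · dsimp only
    split_ifs
    exacts [h₁, h₂]
  · ext ω
    simp only [mem_inter_iff, mem_preimage, mem_singleton_iff]
    refine and_congr_left fun hl => ?_
    split_ifs with h0
    · exact (h ω).1 (hl.trans h0)
    · exact (h ω).2 fun h' => h0 (hl.symm.trans h')

section

variable {𝒢 : MeasurableSpace Ω} [m0 : MeasurableSpace Ω] {P : Measure Ω} {Λ : Ω → ℕ}

lemma measure_inter_mem_eq_tsum (hΛ : Measurable Λ) {T : Set Ω} (hT : MeasurableSet T)
    (D : Set ℕ) : P (T ∩ Λ ⁻¹' D) = ∑' l : D, P (T ∩ Λ ⁻¹' {(l : ℕ)}) := by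
  rw [← measure_iUnion]
  · congr 1
    ext ω
    simp
  · intro a b hab
    refine disjoint_left.2 fun ω h1 h2 => hab (Subtype.ext ?_)
    exact h1.2.symm.trans h2.2
  · exact fun l => hT.inter (hΛ (measurableSet_singleton _))

variable {π₀ ρ : ℝ} {f₀ f₁ : ℝ → ℝ} {X : ℕ → Ω → ℝ}

lemma obsInfo_le (h : IsChangePointModel P π₀ ρ f₀ f₁ Λ X) (k : ℕ) : obsInfo X k ≤ m0 :=
  iSup₂_le fun i _ => (h.measurable_obs i).comap_le

lemma initial_le (h : IsChangePointModel P π₀ ρ f₀ f₁ Λ X)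
    (h𝒢 : 𝒢 ≤ MeasurableSpace.generateFrom {{ω | Λ ω = 0}}) : 𝒢 ≤ m0 := by
  refine h𝒢.trans (MeasurableSpace.generateFrom_le ?_)
  rintro _ rfl
  exact h.measurable_changePoint (measurableSet_singleton 0)

variable [IsProbabilityMeasure P]

/-- Given `Λ = l`, the next observation is independent of the earlier ones. On cylinders this is the
joint law; both sides are finite measures in `A`, so they agree on the generated σ-algebra. -/
lemma measure_obsInfo_inter (h : IsChangePointModel P π₀ ρ f₀ f₁ Λ X)
    (l k : ℕ) {B : Set ℝ} (hB : MeasurableSet B) {A : Set Ω}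
    (hA : MeasurableSet[obsInfo X k] A) :
    P (A ∩ X (k + 1) ⁻¹' B ∩ Λ ⁻¹' {l}) =
      pdfLaw (if k + 1 < l then f₀ else f₁) B * P (A ∩ Λ ⁻¹' {l}) := by
  set ν := pdfLaw (if k + 1 < l then f₀ else f₁) with hν
  have hνB : ν B = ∫⁻ x in B, ENNReal.ofReal (if k + 1 < l then f₀ x else f₁ x) := by
    rw [hν, pdfLaw, withDensity_apply _ hB]
    split_ifs <;> rfl
  have key : ∀ A ∈ obsCylinders X k, P (A ∩ X (k + 1) ⁻¹' B ∩ Λ ⁻¹' {l}) =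
      ν B * P (A ∩ Λ ⁻¹' {l}) := by
    rintro _ ⟨E, hE, rfl⟩
    have h1 := h.joint_law l (k + 1) (Function.update E (k + 1) B) fun i => by
      rcases eq_or_ne i (k + 1) with rfl | hi
      · simpa using hB
      · simpa [Function.update_of_ne hi] using hE i
    have h2 := h.joint_law l k E hE
    have hup : ∀ i ∈ Finset.Icc 1 k, Function.update E (k + 1) B i = E i := fun i hi =>
      Function.update_of_ne (by have := (Finset.mem_Icc.1 hi).2; omega) _ _
    have e1 : {ω | ∀ i ∈ Finset.Icc 1 k, X i ω ∈ E i} ∩ X (k + 1) ⁻¹' B ∩ Λ ⁻¹' {l} =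
        {ω | Λ ω = l ∧ ∀ i ∈ Finset.Icc 1 (k + 1), X i ω ∈ Function.update E (k + 1) B i} := by
      ext ω
      simp only [mem_inter_iff, mem_ofPred_eq, mem_preimage, mem_singleton_iff]
      constructor
      · rintro ⟨⟨ha, hb⟩, hl⟩
        refine ⟨hl, fun i hi => ?_⟩
        rcases eq_or_ne i (k + 1) with rfl | hne
        · simpa using hb
        · have hi' : i ∈ Finset.Icc 1 k := by simp only [Finset.mem_Icc] at *; omega
          rw [hup i hi']; exact ha i hi'
      · rintro ⟨hl, ha⟩
        refine ⟨⟨fun i hi => ?_, by simpa using ha (k + 1) (by simp)⟩, hl⟩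
        rw [← hup i hi]
        exact ha i (by simp only [Finset.mem_Icc] at *; omega)
    have e2 : {ω | ∀ i ∈ Finset.Icc 1 k, X i ω ∈ E i} ∩ Λ ⁻¹' {l} =
        {ω | Λ ω = l ∧ ∀ i ∈ Finset.Icc 1 k, X i ω ∈ E i} := by
      ext ω; simp [and_comm]
    rw [e1, e2, h1, h2, Finset.prod_Icc_succ_top (by omega), Function.update_self, ← hνB,
      Finset.prod_congr rfl fun i hi => by rw [hup i hi]]
    ring
  have e : ∀ A : Set Ω, MeasurableSet A → P.restrict (X (k + 1) ⁻¹' B ∩ Λ ⁻¹' {l}) A =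
      P (A ∩ X (k + 1) ⁻¹' B ∩ Λ ⁻¹' {l}) := fun A hA => by
    rw [Measure.restrict_apply hA, inter_assoc]
  have hle := obsInfo_le h k
  have hmem : ∀ A ∈ obsCylinders X k, MeasurableSet A := fun A hA => hle _ (by
    rw [obsInfo_eq_generateFrom]; exact MeasurableSpace.measurableSet_generateFrom hA)
  have hkey : ∀ A ∈ obsCylinders X k, P.restrict (X (k + 1) ⁻¹' B ∩ Λ ⁻¹' {l}) A =
      (ν B • P.restrict (Λ ⁻¹' {l})) A := fun A hA => by
    rw [e A (hmem A hA), key A hA, Measure.smul_apply, Measure.restrict_apply (hmem A hA),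
      smul_eq_mul]
  have := ext_on_measurableSpace_of_generate_finite m0 (obsCylinders X k) hkey hle
    (obsInfo_eq_generateFrom X k) (isPiSystem_obsCylinders X k)
    (hkey univ ⟨fun _ => univ, fun _ => MeasurableSet.univ, by simp⟩) hA
  rwa [e A (hle _ hA), Measure.smul_apply, Measure.restrict_apply (hle _ hA), smul_eq_mul] at this

/-- For `k < l` the variables `X 1, …, X k` precede the change both under `Λ = l` and under `Λ = l +
1`, so only the prior weights differ, by the factor `1 - ρ`. -/
lemma measure_obsInfo_succ (h : IsChangePointModel P π₀ ρ f₀ f₁ Λ X) (hρ₁ : ρ < 1)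
    {l k : ℕ} (hkl : k < l) {A : Set Ω}
    (hA : MeasurableSet[obsInfo X k] A) :
    P (A ∩ Λ ⁻¹' {l + 1}) = ENNReal.ofReal (1 - ρ) * P (A ∩ Λ ⁻¹' {l}) := by
  have hle := obsInfo_le h k
  have hprior : P {ω | Λ ω = l + 1} = ENNReal.ofReal (1 - ρ) * P {ω | Λ ω = l} := by
    rw [h.prior_pos l (by omega), h.prior_pos (l + 1) (by omega),
      ← ENNReal.ofReal_mul (by linarith)]
    congr 1
    obtain ⟨j, rfl⟩ : ∃ j, l = j + 1 := ⟨l - 1, by omega⟩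
    simp only [Nat.add_sub_cancel, pow_succ]
    ring
  have hmem : ∀ A ∈ obsCylinders X k, MeasurableSet A := fun A hA => hle _ (by
    rw [obsInfo_eq_generateFrom]; exact MeasurableSpace.measurableSet_generateFrom hA)
  have hkey : ∀ A ∈ obsCylinders X k, P.restrict (Λ ⁻¹' {l + 1}) A =
      (ENNReal.ofReal (1 - ρ) • P.restrict (Λ ⁻¹' {l})) A := fun A hA => by
    rw [Measure.smul_apply, Measure.restrict_apply (hmem A hA),
      Measure.restrict_apply (hmem A hA), smul_eq_mul]
    obtain ⟨E, hE, rfl⟩ := hA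
    have e2 : ∀ l, {ω | ∀ i ∈ Finset.Icc 1 k, X i ω ∈ E i} ∩ Λ ⁻¹' {l} =
        {ω | Λ ω = l ∧ ∀ i ∈ Finset.Icc 1 k, X i ω ∈ E i} := fun l => by
      ext ω; simp [and_comm]
    rw [e2, e2, h.joint_law _ k E hE, h.joint_law _ k E hE, hprior, mul_assoc]
    congr 2
    refine Finset.prod_congr rfl fun i hi => ?_
    have := (Finset.mem_Icc.1 hi).2
    simp only [if_pos (show i < l by omega), if_pos (show i < l + 1 by omega)]
  have := ext_on_measurableSpace_of_generate_finite m0 (obsCylinders X k) hkey hle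
    (obsInfo_eq_generateFrom X k) (isPiSystem_obsCylinders X k)
    (hkey univ ⟨fun _ => univ, fun _ => MeasurableSet.univ, by simp⟩) hA
  rwa [Measure.smul_apply, Measure.restrict_apply (hle _ hA), Measure.restrict_apply (hle _ hA),
    smul_eq_mul] at this

/-- Given the past and `Λ ∈ D`, the next observation has the density `f`. -/
lemma measure_inter_obs (h : IsChangePointModel P π₀ ρ f₀ f₁ Λ X)
    (h𝒢 : 𝒢 ≤ MeasurableSpace.generateFrom {{ω | Λ ω = 0}}) {k : ℕ}
    {A : Set Ω} (hA : MeasurableSet[𝒢 ⊔ obsInfo X k] A) {B : Set ℝ} (hB : MeasurableSet B)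
    {D : Set ℕ} {f : ℝ → ℝ} (hD : ∀ l ∈ D, (if k + 1 < l then f₀ else f₁) = f) :
    P (A ∩ X (k + 1) ⁻¹' B ∩ Λ ⁻¹' D) = P (A ∩ Λ ⁻¹' D) * pdfLaw f B := by
  have hA0 : MeasurableSet A := (sup_le (initial_le h h𝒢) (obsInfo_le h k)) A hA
  obtain ⟨A', hA', hAA', -⟩ := exists_obsInfo_trace h𝒢 hA
  rw [measure_inter_mem_eq_tsum h.measurable_changePoint hA0,
    measure_inter_mem_eq_tsum h.measurable_changePoint (hA0.inter (h.measurable_obs _ hB)),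
    ← ENNReal.tsum_mul_right]
  refine tsum_congr fun l => ?_
  rw [inter_right_comm, hAA', inter_right_comm, measure_obsInfo_inter h l k hB (hA' l),
    hD l l.2, mul_comm]

/-- Given the past and `k < Λ`, the change occurs at time `k + 1` with probability `ρ`. -/
lemma measure_inter_changePoint (h : IsChangePointModel P π₀ ρ f₀ f₁ Λ X)
    (hρ₀ : 0 < ρ) (hρ₁ : ρ < 1) (h𝒢 : 𝒢 ≤ MeasurableSpace.generateFrom {{ω | Λ ω = 0}}) {k : ℕ}
    {A : Set Ω} (hA : MeasurableSet[𝒢 ⊔ obsInfo X k] A) :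
    P (A ∩ Λ ⁻¹' {k + 1}) = ENNReal.ofReal ρ * P (A ∩ Λ ⁻¹' Ioi k) := by
  have hA0 : MeasurableSet A := (sup_le (initial_le h h𝒢) (obsInfo_le h k)) A hA
  obtain ⟨A', hA', hAA', hA1⟩ := exists_obsInfo_trace h𝒢 hA
  -- The masses of `{Λ = k + 1 + j}` within `A` are geometric with ratio `1 - ρ`, so their sum over
  -- `j` is the first one divided by `ρ`.
  have hgeom : ∀ j : ℕ, P (A ∩ Λ ⁻¹' {k + 1 + j}) =
      ENNReal.ofReal (1 - ρ) ^ j * P (A ∩ Λ ⁻¹' {k + 1}) := by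
    intro j
    induction j with
    | zero => simp
    | succ j ih =>
      rw [pow_succ', mul_assoc, ← ih, hAA', hAA', ← add_assoc, hA1 (k + 1 + j),
        show k + 1 + j = (k + j) + 1 by omega, hA1 (k + j)]
      exact measure_obsInfo_succ h hρ₁ (by omega) (hA' 1)
  have hsum : P (A ∩ Λ ⁻¹' Ioi k) = ∑' j : ℕ, P (A ∩ Λ ⁻¹' {k + 1 + j}) := by
    rw [← measure_iUnion]
    · congr 1
      ext ω
      simp only [mem_inter_iff, mem_preimage, mem_Ioi, mem_iUnion, mem_singleton_iff]
      exact ⟨fun hω => ⟨Λ ω - (k + 1), hω.1, by omega⟩, fun ⟨j, ha, hj⟩ => ⟨ha, by omega⟩⟩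
    · intro a b hab
      refine disjoint_left.2 fun ω h1 h2 => hab ?_
      have := h1.2.symm.trans h2.2
      omega
    · exact fun l => hA0.inter (h.measurable_changePoint (measurableSet_singleton _))
  have hr : (1 : ENNReal) - ENNReal.ofReal (1 - ρ) = ENNReal.ofReal ρ := by
    rw [← ENNReal.ofReal_one, ← ENNReal.ofReal_sub _ (by linarith)]
    congr 1; ring
  rw [hsum, tsum_congr hgeom, ENNReal.tsum_mul_right, ENNReal.tsum_geometric, hr, ← mul_assoc,
    ENNReal.mul_inv_cancel (by simpa using hρ₀) ENNReal.ofReal_ne_top, one_mul]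

end

/-! ### The information of the observer -/

variable {𝒢 : MeasurableSpace Ω} {X : ℕ → Ω → ℝ} {μ : ℕ → Ω → Bool}

lemma info_zero (𝒢 : MeasurableSpace Ω) (X : ℕ → Ω → ℝ) (μ : ℕ → Ω → Bool) :
    info 𝒢 X μ 0 = 𝒢 := by simp [info]

lemma info_succ (𝒢 : MeasurableSpace Ω) (X : ℕ → Ω → ℝ) (μ : ℕ → Ω → Bool) (k : ℕ) :
    info 𝒢 X μ (k + 1) =
      info 𝒢 X μ k ⊔ MeasurableSpace.comap (Z X μ (k + 1)) inferInstance := by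
  have : Finset.Icc 1 (k + 1) = insert (k + 1) (Finset.Icc 1 k) := by
    ext; simp only [Finset.mem_Icc, Finset.mem_insert]; omega
  unfold info
  rw [this, Finset.iSup_insert, sup_assoc]
  congr 1
  exact sup_comm _ _

lemma info_mono (𝒢 : MeasurableSpace Ω) (X : ℕ → Ω → ℝ) (μ : ℕ → Ω → Bool) :
    Monotone (info 𝒢 X μ) :=
  monotone_nat_of_le_succ fun k => by rw [info_succ]; exact le_sup_left

lemma measurable_Z (m : MeasurableSpace Ω) {k : ℕ} (hμ : Measurable (μ k)) (hX : Measurable (X k)) :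
    Measurable (Z X μ k) :=
  Measurable.ite (hμ (measurableSet_singleton true)) (measurable_inr.comp hX) measurable_const

/-- By causality the decision to sample at `k + 1` is already a function of the earlier
observations, so the choice itself reveals nothing new. -/
lemma info_le (hμ : ∀ k, Measurable[info 𝒢 X μ k] (μ (k + 1))) (k : ℕ) :
    info 𝒢 X μ k ≤ 𝒢 ⊔ obsInfo X k := by
  induction k with
  | zero => rw [info_zero]; exact le_sup_left
  | succ k ih =>
    have hmono : 𝒢 ⊔ obsInfo X k ≤ 𝒢 ⊔ obsInfo X (k + 1) :=
      sup_le_sup_left (biSup_mono fun i hi => by simp only [Finset.mem_Icc] at *; omega) _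
    rw [info_succ]
    refine sup_le (ih.trans hmono) (Measurable.comap_le ?_)
    exact measurable_Z _ ((hμ k).mono (ih.trans hmono) le_rfl)
      ((measurable_obsInfo X (by simp)).mono le_sup_right le_rfl)

end

/-! ### One observation: the disintegration of the joint law -/

section

variable {Ω Ω' : Type*} [MeasurableSpace Ω] [MeasurableSpace Ω'] {P : Measure Ω}
  {φ : Ω → Ω'} {Y : Ω → ℝ} {E : Set Ω} {q : Ω' → ℝ} {f₀ f₁ : ℝ → ℝ}

/-- The law of `φ` restricted to `E` has density `q` with respect to the law of `φ`. -/
lemma setLIntegral_eq_mul (hφ : Measurable φ) (hq : Measurable q)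
    (hE : ∀ A, MeasurableSet A → P (φ ⁻¹' A ∩ E) = ∫⁻ ω in φ ⁻¹' A, ENNReal.ofReal (q (φ ω)) ∂P)
    {g : Ω' → ENNReal} (hg : Measurable g) :
    ∫⁻ ω in E, g (φ ω) ∂P = ∫⁻ ω, ENNReal.ofReal (q (φ ω)) * g (φ ω) ∂P := by
  have key : (P.restrict E).map φ = (P.map φ).withDensity fun a => ENNReal.ofReal (q a) := by
    ext A hA
    rw [Measure.map_apply hφ hA, Measure.restrict_apply (hφ hA), hE A hA,
      withDensity_apply _ hA, setLIntegral_map hA hq.ennreal_ofReal hφ]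
  rw [← lintegral_map hg hφ, key, lintegral_withDensity_eq_lintegral_mul _ hq.ennreal_ofReal hg,
    lintegral_map (hq.ennreal_ofReal.mul hg) hφ]
  rfl

variable [IsProbabilityMeasure P]

/-- On `E` the joint law of past and observation is a product measure, and Tonelli applies. -/
lemma setLIntegral_obs (hφ : Measurable φ) (hY : Measurable Y) {f : ℝ → ℝ} (hf : IsPdf f)
    (h : ∀ A, MeasurableSet A → ∀ B, MeasurableSet B →
      P (φ ⁻¹' A ∩ Y ⁻¹' B ∩ E) = P (φ ⁻¹' A ∩ E) * pdfLaw f B)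
    {g : Ω' × ℝ → ENNReal} (hg : Measurable g) :
    ∫⁻ ω in E, g (φ ω, Y ω) ∂P =
      ∫⁻ ω in E, (∫⁻ x, ENNReal.ofReal (f x) * g (φ ω, x)) ∂P := by
  have := hf.isProbabilityMeasure
  have key : ((P.restrict E).map φ).prod (pdfLaw f) = (P.restrict E).map fun ω => (φ ω, Y ω) := by
    refine Measure.prod_eq fun A B hA hB => ?_
    rw [Measure.map_apply (hφ.prodMk hY) (hA.prod hB), Measure.map_apply hφ hA,
      Measure.restrict_apply (hφ hA), Measure.restrict_apply (hφ.prodMk hY (hA.prod hB)),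
      ← h A hA B hB]
    rfl
  rw [← lintegral_map (g := fun ω => (φ ω, Y ω)) hg (hφ.prodMk hY), ← key,
    lintegral_prod _ hg.aemeasurable, lintegral_map hg.lintegral_prod_right' hφ]
  refine lintegral_congr fun ω => ?_
  have hgω : Measurable fun x => g (φ ω, x) := hg.comp measurable_prodMk_left
  rw [pdfLaw, lintegral_withDensity_eq_lintegral_mul _ hf.measurable.ennreal_ofReal hgω]
  rfl

/-- The joint law of the past, of the event `E` of prior probability `q`, and of the next
observation, which has density `f₁` on `E` and density `f₀` on `Eᶜ`. -/
structure IsObservation (P : Measure Ω) (φ : Ω → Ω') (Y : Ω → ℝ) (E : Set Ω) (q : Ω' → ℝ)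
    (f₀ f₁ : ℝ → ℝ) : Prop where
  past : Measurable φ
  obs : Measurable Y
  event : MeasurableSet E
  measurable_prior : Measurable q
  prior_mem : ∀ a, q a ∈ Icc (0 : ℝ) 1
  prior : ∀ A, MeasurableSet A →
    P (φ ⁻¹' A ∩ E) = ∫⁻ ω in φ ⁻¹' A, ENNReal.ofReal (q (φ ω)) ∂P
  law : ∀ A, MeasurableSet A → ∀ B, MeasurableSet B →
    P (φ ⁻¹' A ∩ Y ⁻¹' B ∩ E) = P (φ ⁻¹' A ∩ E) * pdfLaw f₁ B
  law_compl : ∀ A, MeasurableSet A → ∀ B, MeasurableSet B →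
    P (φ ⁻¹' A ∩ Y ⁻¹' B ∩ Eᶜ) = P (φ ⁻¹' A ∩ Eᶜ) * pdfLaw f₀ B

/-- The probability of the complement, from the probability of the event. -/
lemma measure_inter_compl_eq {A : Set Ω} (hE : MeasurableSet E) {r : Ω → ℝ}
    (hr : Measurable r) (hr01 : ∀ ω, r ω ∈ Icc (0 : ℝ) 1)
    (h : P (A ∩ E) = ∫⁻ ω in A, ENNReal.ofReal (r ω) ∂P) :
    P (A ∩ Eᶜ) = ∫⁻ ω in A, ENNReal.ofReal (1 - r ω) ∂P := by
  have h1 : P (A ∩ E) + P (A ∩ Eᶜ) = P A := by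
    rw [← sdiff_eq]; exact measure_inter_add_sdiff A hE
  have h2 : ∫⁻ ω in A, ENNReal.ofReal (r ω) ∂P + ∫⁻ ω in A, ENNReal.ofReal (1 - r ω) ∂P = P A := by
    rw [← lintegral_add_left hr.ennreal_ofReal, ← setLIntegral_one]
    refine lintegral_congr fun ω => ?_
    rw [← ENNReal.ofReal_add (hr01 ω).1 (by linarith [(hr01 ω).2])]
    simp
  rw [← h2, ← h] at h1
  exact (ENNReal.add_right_inj (measure_ne_top P _)).1 h1

lemma measurable_lintegral_pdf (hf₁ : IsPdf f₁) {g : Ω' × ℝ → ENNReal} (hg : Measurable g) :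
    Measurable fun a => ∫⁻ x, ENNReal.ofReal (f₁ x) * g (a, x) := by
  have : Measurable fun z : Ω' × ℝ => ENNReal.ofReal (f₁ z.2) * g z :=
    (hf₁.measurable.comp measurable_snd).ennreal_ofReal.mul hg
  exact this.lintegral_prod_right'

lemma IsObservation.setLIntegral_event (hO : IsObservation P φ Y E q f₀ f₁) (hf₁ : IsPdf f₁)
    {g : Ω' × ℝ → ENNReal} (hg : Measurable g) :
    ∫⁻ ω in E, g (φ ω, Y ω) ∂P =
      ∫⁻ ω, (∫⁻ x, ENNReal.ofReal (q (φ ω) * f₁ x) * g (φ ω, x)) ∂P := by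
  rw [setLIntegral_obs hO.past hO.obs hf₁ hO.law hg,
    setLIntegral_eq_mul hO.past hO.measurable_prior hO.prior (measurable_lintegral_pdf hf₁ hg)]
  refine lintegral_congr fun ω => ?_
  rw [← lintegral_const_mul' _ _ ENNReal.ofReal_ne_top]
  simp only [ENNReal.ofReal_mul (hO.prior_mem _).1, mul_assoc]

lemma IsObservation.lintegral (hO : IsObservation P φ Y E q f₀ f₁)
    (hf₀ : IsPdf f₀) (hf₁ : IsPdf f₁) {g : Ω' × ℝ → ENNReal} (hg : Measurable g) :
    ∫⁻ ω, g (φ ω, Y ω) ∂P =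
      ∫⁻ ω, (∫⁻ x, ENNReal.ofReal (mixDens f₀ f₁ (q (φ ω)) x) * g (φ ω, x)) ∂P := by
  have hc : ∫⁻ ω in Eᶜ, g (φ ω, Y ω) ∂P =
      ∫⁻ ω, (∫⁻ x, ENNReal.ofReal ((1 - q (φ ω)) * f₀ x) * g (φ ω, x)) ∂P := by
    rw [setLIntegral_obs hO.past hO.obs hf₀ hO.law_compl hg,
      setLIntegral_eq_mul (q := fun a => 1 - q a) hO.past (hO.measurable_prior.const_sub 1)
        (fun A hA => measure_inter_compl_eq hO.event (hO.measurable_prior.comp hO.past)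
          (fun ω => hO.prior_mem _) (hO.prior A hA)) (measurable_lintegral_pdf hf₀ hg)]
    refine lintegral_congr fun ω => ?_
    rw [← lintegral_const_mul' _ _ ENNReal.ofReal_ne_top]
    simp only [ENNReal.ofReal_mul (sub_nonneg.2 (hO.prior_mem (φ ω)).2), mul_assoc]
  have hm : Measurable fun z : Ω' × ℝ => ENNReal.ofReal (q z.1 * f₁ z.2) * g z :=
    ((hO.measurable_prior.comp measurable_fst).mul
      (hf₁.measurable.comp measurable_snd)).ennreal_ofReal.mul hg
  have hmφ : Measurable fun ω => ∫⁻ x, ENNReal.ofReal (q (φ ω) * f₁ x) * g (φ ω, x) :=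
    hm.lintegral_prod_right'.comp hO.past
  rw [← lintegral_add_compl _ hO.event, hO.setLIntegral_event hf₁ hg, hc, ← lintegral_add_left hmφ]
  refine lintegral_congr fun ω => ?_
  have hm' : Measurable fun x => ENNReal.ofReal (q (φ ω) * f₁ x) * g (φ ω, x) :=
    hm.comp measurable_prodMk_left
  rw [← lintegral_add_left hm']
  refine lintegral_congr fun x => ?_
  rw [← add_mul, mixDens, ENNReal.ofReal_add (mul_nonneg (hO.prior_mem _).1 (hf₁.nonneg x))
    (mul_nonneg (sub_nonneg.2 (hO.prior_mem _).2) (hf₀.nonneg x))]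

/-- The posterior probability of `E`, when the observation is taken if `s = true`. -/
def nextPost (f₀ f₁ : ℝ → ℝ) (s : Ω' → Bool) (q : Ω' → ℝ) (z : Ω' × ℝ) : ℝ :=
  if s z.1 = true then bayes f₀ f₁ (q z.1) z.2 else q z.1

lemma measurable_ite_bool {α β : Type*} [MeasurableSpace α] [MeasurableSpace β] {s : α → Bool}
    (hs : Measurable s) {g h : α → β} (hg : Measurable g) (hh : Measurable h) :
    Measurable fun a => if s a = true then g a else h a :=
  Measurable.ite (hs (measurableSet_singleton true)) hg hh

lemma measurable_nextPost (hf₀ : IsPdf f₀) (hf₁ : IsPdf f₁) {s : Ω' → Bool} (hs : Measurable s)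
    (hq : Measurable q) : Measurable (nextPost f₀ f₁ s q) :=
  measurable_ite_bool (hs.comp measurable_fst)
    ((measurable_bayes hf₀ hf₁).comp
      (g := fun z : ℝ × ℝ => bayes f₀ f₁ z.1 z.2) (f := fun z : Ω' × ℝ => (q z.1, z.2))
      ((hq.comp measurable_fst).prodMk measurable_snd)) (hq.comp measurable_fst)

lemma nextPost_mem {Ω' : Type*} {q : Ω' → ℝ} (hf₀ : IsPdf f₀) (hf₁ : IsPdf f₁) {s : Ω' → Bool}
    (hq : ∀ a, q a ∈ Icc (0 : ℝ) 1) (z : Ω' × ℝ) : nextPost f₀ f₁ s q z ∈ Icc (0 : ℝ) 1 := by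
  unfold nextPost
  split_ifs
  exacts [bayes_mem hf₀ hf₁ (hq _) _, hq _]

lemma lintegral_pdf_mul_const {f : ℝ → ℝ} (hf : IsPdf f) (a : ENNReal) :
    ∫⁻ x, ENNReal.ofReal (f x) * a = a := by
  rw [lintegral_mul_const _ hf.measurable.ennreal_ofReal, hf.lintegral_eq_one, one_mul]

lemma isPdf_mixDens (hf₀ : IsPdf f₀) (hf₁ : IsPdf f₁) {p : ℝ} (hp : p ∈ Icc (0 : ℝ) 1) :
    IsPdf (mixDens f₀ f₁ p) := by
  refine ⟨measurable_mixDens_right hf₀ hf₁ p, mixDens_nonneg hf₀ hf₁ hp, ?_⟩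
  rw [← ofReal_integral_eq_lintegral_ofReal (integrable_mixDens hf₀ hf₁ p)
    (Filter.Eventually.of_forall (mixDens_nonneg hf₀ hf₁ hp)), integral_mixDens hf₀ hf₁]
  simp

/-- Bayes' formula. -/
lemma IsObservation.setLIntegral_nextPost (hO : IsObservation P φ Y E q f₀ f₁)
    (hf₀ : IsPdf f₀) (hf₁ : IsPdf f₁) {s : Ω' → Bool} (hs : Measurable s)
    {H : Ω' × (Unit ⊕ ℝ) → ENNReal} (hH : Measurable H) :
    ∫⁻ ω in E, H (φ ω, if s (φ ω) = true then Sum.inr (Y ω) else Sum.inl ()) ∂P =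
      ∫⁻ ω, ENNReal.ofReal (nextPost f₀ f₁ s q (φ ω, Y ω)) *
        H (φ ω, if s (φ ω) = true then Sum.inr (Y ω) else Sum.inl ()) ∂P := by
  set g : Ω' × ℝ → ENNReal :=
    fun z => H (z.1, if s z.1 = true then Sum.inr z.2 else Sum.inl ()) with hg
  have hgm : Measurable g := hH.comp (measurable_fst.prodMk (measurable_ite_bool
    (hs.comp measurable_fst) (measurable_inr.comp measurable_snd) measurable_const))
  have hrm : Measurable fun z => ENNReal.ofReal (nextPost f₀ f₁ s q z) * g z :=
    (measurable_nextPost hf₀ hf₁ hs hO.measurable_prior).ennreal_ofReal.mul hgm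
  refine (hO.setLIntegral_event hf₁ hgm).trans
    (Eq.trans ?_ (hO.lintegral hf₀ hf₁ hrm).symm)
  refine lintegral_congr fun ω => ?_
  have hq := hO.prior_mem (φ ω)
  cases hsω : s (φ ω) with
  -- With an observation the integrands agree pointwise by Bayes' rule. Without one they depend on
  -- `x` only through densities of integral `1`.
  | true =>
    refine lintegral_congr fun x => ?_
    simp only [nextPost, hsω, if_true]
    rw [← mul_assoc, ← ENNReal.ofReal_mul (mixDens_nonneg hf₀ hf₁ hq x),
      mixDens_mul_bayes hf₀ hf₁ hq]
  | false =>
    have e : ∀ x, g (φ ω, x) = H (φ ω, Sum.inl ()) := fun x => by simp [hg, hsω]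
    simp only [nextPost, hsω, e, Bool.false_eq_true, if_false]
    rw [lintegral_pdf_mul_const (isPdf_mixDens hf₀ hf₁ hq)]
    simp only [ENNReal.ofReal_mul hq.1, mul_assoc]
    rw [lintegral_const_mul' _ _ ENNReal.ofReal_ne_top, lintegral_pdf_mul_const hf₁]

/-- The expected value of a regular function at the next posterior. -/
lemma IsObservation.setLIntegral_value (hO : IsObservation P φ Y E q f₀ f₁)
    (hf₀ : IsPdf f₀) (hf₁ : IsPdf f₁) {s : Ω' → Bool} (hs : Measurable s)
    {v : ℕ → ℝ → ℝ} (hv : ∀ n, IsRegular (v n)) {n : Ω' → ℕ} (hn : Measurable n)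
    {A : Set Ω'} (hA : MeasurableSet A) :
    ∫⁻ ω in φ ⁻¹' A, ENNReal.ofReal (v (n (φ ω)) (nextPost f₀ f₁ s q (φ ω, Y ω))) ∂P =
      ∫⁻ ω in φ ⁻¹' A, ENNReal.ofReal (if s (φ ω) = true
        then obsValue f₀ f₁ (v (n (φ ω))) (q (φ ω)) else v (n (φ ω)) (q (φ ω))) ∂P := by
  choose w hw hwv using fun n => (hv n).exists_measurable
  have hw2 : Measurable fun z : ℕ × ℝ => w z.1 z.2 := measurable_from_prod_countable_right hw
  have hmem := nextPost_mem hf₀ hf₁ (s := s) hO.prior_mem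
  have hgm : Measurable fun z : Ω' × ℝ => A.indicator (1 : Ω' → ENNReal) z.1 *
      ENNReal.ofReal (w (n z.1) (nextPost f₀ f₁ s q z)) :=
    ((measurable_one.indicator hA).comp measurable_fst).mul
      (hw2.comp ((hn.comp measurable_fst).prodMk
        (measurable_nextPost hf₀ hf₁ hs hO.measurable_prior))).ennreal_ofReal
  rw [← lintegral_indicator (hO.past hA), ← lintegral_indicator (hO.past hA)]
  refine Eq.trans (lintegral_congr fun ω => ?_)
    ((hO.lintegral hf₀ hf₁ hgm).trans (lintegral_congr fun ω => ?_))
  · by_cases hω : φ ω ∈ A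
    · rw [indicator_of_mem (show ω ∈ φ ⁻¹' A from hω), hwv _ _ (hmem _)]
      simp [hω]
    · rw [indicator_of_notMem (show ω ∉ φ ⁻¹' A from hω)]
      simp [hω]
  · have hq := hO.prior_mem (φ ω)
    by_cases hω : φ ω ∈ A
    · rw [indicator_of_mem (show ω ∈ φ ⁻¹' A from hω)]
      simp only [indicator_of_mem hω, Pi.one_apply, one_mul, hwv _ _ (hmem _)]
      cases hsω : s (φ ω) with
      | true =>
        simp only [nextPost, hsω, if_true]
        rw [ofReal_obsValue hf₀ hf₁ (hv _) hq]
      | false =>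
        simp only [nextPost, hsω, Bool.false_eq_true, if_false]
        rw [lintegral_pdf_mul_const (isPdf_mixDens hf₀ hf₁ hq)]
    · rw [indicator_of_notMem (show ω ∉ φ ⁻¹' A from hω)]
      simp [hω]

end

/-! ### The posterior process -/

/-- `r` is a version of the conditional probability of `E` given `m`, with values in `[0,1]`. -/
structure IsCondProb {Ω : Type*} (m : MeasurableSpace Ω) [MeasurableSpace Ω] (P : Measure Ω)
    (E : Set Ω) (r : Ω → ℝ) : Prop where
  measurable : Measurable[m] r
  mem : ∀ ω, r ω ∈ Icc (0 : ℝ) 1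
  measure_inter : ∀ A, MeasurableSet[m] A → P (A ∩ E) = ∫⁻ ω in A, ENNReal.ofReal (r ω) ∂P

/-- The recursion for the posterior probabilities, from the initial value `p₀`. -/
def posterior {Ω : Type*} (ρ : ℝ) (f₀ f₁ : ℝ → ℝ) (X : ℕ → Ω → ℝ) (μ : ℕ → Ω → Bool) (p₀ : Ω → ℝ) :
    ℕ → Ω → ℝ
  | 0 => p₀
  | k + 1 => fun ω =>
    if μ (k + 1) ω = true then Phi1 ρ f₀ f₁ (X (k + 1) ω) (posterior ρ f₀ f₁ X μ p₀ k ω)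
    else Phi0 ρ (posterior ρ f₀ f₁ X μ p₀ k ω)

/-- `X (k + 1)` itself need not be measurable for the observer, but where a sample is taken it can
be read off from `Z`; the value `0` elsewhere is never used. -/
lemma measurable_info_succ_update {Ω : Type*} (m : MeasurableSpace Ω) {ρ : ℝ} {f₀ f₁ : ℝ → ℝ}
    {X : ℕ → Ω → ℝ} {μ : ℕ → Ω → Bool} {r : Ω → ℝ}
    (hf₀ : IsPdf f₀) (hf₁ : IsPdf f₁) {k : ℕ} (hr : Measurable r)
    (hμ : Measurable (μ (k + 1))) (hZ : Measurable (Z X μ (k + 1))) :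
    Measurable fun ω => if μ (k + 1) ω = true then Phi1 ρ f₀ f₁ (X (k + 1) ω) (r ω)
      else Phi0 ρ (r ω) := by
  have hy : Measurable fun z : Unit ⊕ ℝ => Sum.elim (fun _ => (0 : ℝ)) id z :=
    measurable_const.sumElim measurable_id
  have e : (fun ω => if μ (k + 1) ω = true then Phi1 ρ f₀ f₁ (X (k + 1) ω) (r ω)
      else Phi0 ρ (r ω)) = fun ω => if μ (k + 1) ω = true then
        bayes f₀ f₁ (Phi0 ρ (r ω)) (Sum.elim (fun _ => (0 : ℝ)) id (Z X μ (k + 1) ω))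
      else Phi0 ρ (r ω) := by
    funext ω
    split_ifs with hω
    · simp [Z, hω, Phi1_eq_bayes]
    · rfl
  have hq : Measurable fun ω => Phi0 ρ (r ω) := (continuous_Phi0 ρ).measurable.comp hr
  rw [e]
  exact measurable_ite_bool hμ ((measurable_bayes hf₀ hf₁).comp
    (g := fun z : ℝ × ℝ => bayes f₀ f₁ z.1 z.2) (hq.prodMk (hy.comp hZ))) hq

lemma info_le_ambient {Ω : Type*} {𝒢 : MeasurableSpace Ω} [m0 : MeasurableSpace Ω]
    {P : Measure Ω} {Λ : Ω → ℕ} {π₀ ρ : ℝ} {f₀ f₁ : ℝ → ℝ} {X : ℕ → Ω → ℝ} {μ : ℕ → Ω → Bool}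
    (h : IsChangePointModel P π₀ ρ f₀ f₁ Λ X)
    (h𝒢 : 𝒢 ≤ MeasurableSpace.generateFrom {{ω | Λ ω = 0}})
    (hμ : ∀ k, Measurable[info 𝒢 X μ k] (μ (k + 1))) (k : ℕ) : info 𝒢 X μ k ≤ m0 :=
  (info_le hμ k).trans (sup_le (initial_le h h𝒢) (obsInfo_le h k))

section

variable {Ω : Type*} {m : MeasurableSpace Ω} {𝒢 : MeasurableSpace Ω} [m0 : MeasurableSpace Ω]
  {P : Measure Ω} {E : Set Ω} {r : Ω → ℝ}

variable [IsProbabilityMeasure P]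

lemma integrable_of_mem_Icc (hr : Measurable r) (h : ∀ ω, r ω ∈ Icc (0 : ℝ) 1) :
    Integrable r P :=
  Integrable.of_bound hr.aestronglyMeasurable 1 (Filter.Eventually.of_forall fun ω => by
    rw [Real.norm_eq_abs, abs_of_nonneg (h ω).1]; exact (h ω).2)

lemma IsCondProb.ae_eq_condExp (h : IsCondProb m P E r) (hm : m ≤ m0) (hE : MeasurableSet E) :
    r =ᵐ[P] P[E.indicator (fun _ => (1 : ℝ)) | m] := by
  have hr : Measurable r := h.measurable.mono hm le_rfl
  refine ae_eq_condExp_of_forall_setIntegral_eq hm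
    ((integrable_const (1 : ℝ)).indicator hE)
    (fun _ _ _ => (integrable_of_mem_Icc hr h.mem).integrableOn) (fun A hA _ => ?_)
    h.measurable.stronglyMeasurable.aestronglyMeasurable
  rw [integral_eq_lintegral_of_nonneg_ae (Filter.Eventually.of_forall fun ω => (h.mem ω).1)
    hr.aestronglyMeasurable, ← h.measure_inter A hA, integral_indicator_const _ hE,
    measureReal_def, Measure.restrict_apply hE, inter_comm]
  simp

/-- Truncating the conditional expectation to `[0,1]` makes the bounds hold everywhere and changes
it only on a null set. -/
lemma exists_isCondProb (hm : m ≤ m0) (hE : MeasurableSet E) : ∃ r, IsCondProb m P E r := by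
  set f : Ω → ℝ := E.indicator fun _ => (1 : ℝ) with hf
  have hfi : Integrable f P := (integrable_const (1 : ℝ)).indicator hE
  have hm1 : Measurable[m] (P[f | m]) := stronglyMeasurable_condExp.measurable
  have h0 : 0 ≤ᵐ[P] P[f | m] := condExp_nonneg (Filter.Eventually.of_forall
    (indicator_nonneg fun _ _ => zero_le_one))
  have h1 : P[f | m] ≤ᵐ[P] fun _ => (1 : ℝ) := by
    have := condExp_mono (m := m) hfi (integrable_const (1 : ℝ))
      (Filter.Eventually.of_forall (indicator_le_self' (s := E) fun _ _ => zero_le_one))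
    rwa [condExp_const hm] at this
  refine ⟨fun ω => max 0 (min 1 ((P[f | m]) ω)), ?_, fun ω => ?_, fun A hA => ?_⟩
  · exact measurable_const.max (measurable_const.min hm1)
  · exact ⟨le_max_left _ _, max_le zero_le_one (min_le_left _ _)⟩
  · have e : ∀ᵐ ω ∂P.restrict A, ENNReal.ofReal (max 0 (min 1 ((P[f | m]) ω))) =
        ENNReal.ofReal ((P[f | m]) ω) := by
      filter_upwards [ae_restrict_of_ae h0, ae_restrict_of_ae h1] with ω hω hω'
      have hω0 : 0 ≤ (P[f | m]) ω := hω
      rw [min_eq_right hω', max_eq_right hω0]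
    rw [lintegral_congr_ae e, ← ofReal_integral_eq_lintegral_ofReal
      integrable_condExp.integrableOn (ae_restrict_of_ae h0), setIntegral_condExp hm hfi hA, hf,
      integral_indicator_const _ hE, measureReal_def, Measure.restrict_apply hE, inter_comm]
    simp

lemma IsCondProb.measure_inter_compl (h : IsCondProb m P E r) (hm : m ≤ m0)
    (hE : MeasurableSet E) {A : Set Ω} (hA : MeasurableSet[m] A) :
    P (A ∩ Eᶜ) = ∫⁻ ω in A, ENNReal.ofReal (1 - r ω) ∂P :=
  measure_inter_compl_eq hE (h.measurable.mono hm le_rfl) h.mem (h.measure_inter A hA)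

variable {Λ : Ω → ℕ} {π₀ ρ : ℝ} {f₀ f₁ : ℝ → ℝ} {X : ℕ → Ω → ℝ} {μ : ℕ → Ω → Bool}

/-- Prediction of the next step. -/
lemma IsCondProb.predict (h : IsChangePointModel P π₀ ρ f₀ f₁ Λ X)
    (hρ₀ : 0 < ρ) (hρ₁ : ρ < 1) (h𝒢 : 𝒢 ≤ MeasurableSpace.generateFrom {{ω | Λ ω = 0}})
    (hμ : ∀ k, Measurable[info 𝒢 X μ k] (μ (k + 1))) {k : ℕ}
    (hr : IsCondProb (info 𝒢 X μ k) P (Λ ⁻¹' Iic k) r) :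
    IsCondProb (info 𝒢 X μ k) P (Λ ⁻¹' Iic (k + 1)) fun ω => Phi0 ρ (r ω) := by
  have hm := info_le_ambient h h𝒢 hμ k
  have hΛ := h.measurable_changePoint
  refine ⟨(continuous_Phi0 ρ).measurable.comp hr.measurable,
    fun ω => Phi0_mem hρ₀ hρ₁ (hr.mem ω), fun A hA => ?_⟩
  have hE : MeasurableSet (Λ ⁻¹' Iic k) := hΛ measurableSet_Iic
  have hrm : Measurable r := hr.measurable.mono hm le_rfl
  have e1 : A ∩ Λ ⁻¹' Iic (k + 1) = (A ∩ Λ ⁻¹' Iic k) ∪ (A ∩ Λ ⁻¹' {k + 1}) := by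
    rw [← inter_union_distrib_left]
    congr 1
    ext ω
    simp only [mem_preimage, mem_Iic, mem_union, mem_singleton_iff]
    omega
  have e2 : (Λ ⁻¹' Iic k)ᶜ = Λ ⁻¹' Ioi k := by
    rw [← preimage_compl, compl_Iic]
  have hc := hr.measure_inter_compl hm hE hA
  rw [e2] at hc
  have hd : Disjoint (A ∩ Λ ⁻¹' Iic k) (A ∩ Λ ⁻¹' {k + 1}) := by
    refine disjoint_left.2 fun ω h1 h2 => ?_
    have h3 : Λ ω ≤ k := h1.2
    have h4 : Λ ω = k + 1 := h2.2
    omega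
  rw [e1, measure_union hd ((hm A hA).inter (hΛ (measurableSet_singleton _))),
    measure_inter_changePoint h hρ₀ hρ₁ h𝒢 (info_le hμ k A hA), hr.measure_inter A hA, hc,
    ← lintegral_const_mul' _ _ ENNReal.ofReal_ne_top, ← lintegral_add_left hrm.ennreal_ofReal]
  refine lintegral_congr fun ω => ?_
  have hω := hr.mem ω
  rw [← ENNReal.ofReal_mul hρ₀.le, ← ENNReal.ofReal_add hω.1
    (mul_nonneg hρ₀.le (by linarith [hω.2])), Phi0, mul_comm ρ]

/-- The past is encoded by the identity map into `Ω` with the smaller σ-algebra `info 𝒢 X μ k`. -/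
lemma IsCondProb.isObservation (h : IsChangePointModel P π₀ ρ f₀ f₁ Λ X)
    (hρ₀ : 0 < ρ) (hρ₁ : ρ < 1) (h𝒢 : 𝒢 ≤ MeasurableSpace.generateFrom {{ω | Λ ω = 0}})
    (hμ : ∀ k, Measurable[info 𝒢 X μ k] (μ (k + 1))) {k : ℕ}
    (hr : IsCondProb (info 𝒢 X μ k) P (Λ ⁻¹' Iic k) r) :
    @IsObservation Ω Ω m0 (info 𝒢 X μ k) P id (X (k + 1)) (Λ ⁻¹' Iic (k + 1))
      (fun ω => Phi0 ρ (r ω)) f₀ f₁ := by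
  have hm := info_le_ambient h h𝒢 hμ k
  have hp := hr.predict h hρ₀ hρ₁ h𝒢 hμ
  refine @IsObservation.mk Ω Ω m0 (info 𝒢 X μ k) _ _ _ _ _ _ _ (measurable_id'' hm)
    (h.measurable_obs _) (h.measurable_changePoint measurableSet_Iic)
    hp.measurable hp.mem hp.measure_inter (fun A hA B hB => ?_) fun A hA B hB => ?_
  · exact measure_inter_obs h h𝒢 (info_le hμ k A hA) hB fun l hl =>
      if_neg (not_lt.2 hl)
  · rw [← preimage_compl, compl_Iic]
    exact measure_inter_obs h h𝒢 (info_le hμ k A hA) hB fun l hl => if_pos hl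

lemma IsCondProb.update (h : IsChangePointModel P π₀ ρ f₀ f₁ Λ X)
    (hf₀ : IsPdf f₀) (hf₁ : IsPdf f₁)
    (hρ₀ : 0 < ρ) (hρ₁ : ρ < 1) (h𝒢 : 𝒢 ≤ MeasurableSpace.generateFrom {{ω | Λ ω = 0}})
    (hμ : ∀ k, Measurable[info 𝒢 X μ k] (μ (k + 1))) {k : ℕ}
    (hr : IsCondProb (info 𝒢 X μ k) P (Λ ⁻¹' Iic k) r) :
    IsCondProb (info 𝒢 X μ (k + 1)) P (Λ ⁻¹' Iic (k + 1)) fun ω =>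
      if μ (k + 1) ω = true then Phi1 ρ f₀ f₁ (X (k + 1) ω) (r ω) else Phi0 ρ (r ω) := by
  have hle := info_mono 𝒢 X μ (Nat.le_succ k)
  have hO := hr.isObservation h hρ₀ hρ₁ h𝒢 hμ
  refine ⟨?_, fun ω => ?_, fun C hC => ?_⟩
  · refine measurable_info_succ_update (info 𝒢 X μ (k + 1)) hf₀ hf₁
      (hr.measurable.mono hle le_rfl) ((hμ k).mono hle le_rfl) (Measurable.of_comap_le ?_)
    rw [info_succ]
    exact le_sup_right
  · split_ifs
    · exact bayes_mem hf₀ hf₁ (Phi0_mem hρ₀ hρ₁ (hr.mem ω)) _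
    · exact Phi0_mem hρ₀ hρ₁ (hr.mem ω)
  · have hC0 := info_le_ambient h h𝒢 hμ (k + 1) C hC
    have hE : MeasurableSet (Λ ⁻¹' Iic (k + 1)) := h.measurable_changePoint measurableSet_Iic
    -- Every event known at time `k + 1` has the form `{(ω, Z_{k+1} ω) ∈ D}`, so Bayes' formula is
    -- applied to the indicator of `D`.
    have hcomap := @MeasurableSpace.comap_prodMk Ω Ω (Unit ⊕ ℝ) (info 𝒢 X μ k) inferInstance id
      (Z X μ (k + 1))
    rw [info_succ, ← @MeasurableSpace.comap_id Ω (info 𝒢 X μ k), ← hcomap] at hC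
    obtain ⟨D, hD, rfl⟩ := hC
    have key := @IsObservation.setLIntegral_nextPost Ω Ω m0 (info 𝒢 X μ k) P _ _ _ _ _ _ _ hO
      hf₀ hf₁ (μ (k + 1)) (hμ k) (D.indicator fun _ => 1)
      (Measurable.indicator measurable_const hD)
    rw [← lintegral_indicator_one₀ (hC0.inter hE).nullMeasurableSet, inter_comm,
      ← indicator_indicator, lintegral_indicator hE, ← lintegral_indicator hC0]
    refine Eq.trans ?_ (key.trans ?_)
    · rfl
    · refine lintegral_congr fun ω => ?_
      by_cases hω : (ω, Z X μ (k + 1) ω) ∈ D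
      · have hω' : (id ω, if μ (k + 1) (id ω) = true then Sum.inr (X (k + 1) ω)
            else Sum.inl ()) ∈ D := hω
        rw [indicator_of_mem hω', indicator_of_mem (by exact hω)]
        simp [nextPost, Phi1_eq_bayes]
      · have hω' : (id ω, if μ (k + 1) (id ω) = true then Sum.inr (X (k + 1) ω)
            else Sum.inl ()) ∉ D := hω
        rw [indicator_of_notMem hω', indicator_of_notMem (by exact hω), mul_zero]

lemma isCondProb_posterior (h : IsChangePointModel P π₀ ρ f₀ f₁ Λ X)
    (hf₀ : IsPdf f₀) (hf₁ : IsPdf f₁)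
    (hρ₀ : 0 < ρ) (hρ₁ : ρ < 1) (h𝒢 : 𝒢 ≤ MeasurableSpace.generateFrom {{ω | Λ ω = 0}})
    (hμ : ∀ k, Measurable[info 𝒢 X μ k] (μ (k + 1))) {p₀ : Ω → ℝ}
    (hp₀ : IsCondProb 𝒢 P (Λ ⁻¹' Iic 0) p₀) (k : ℕ) :
    IsCondProb (info 𝒢 X μ k) P (Λ ⁻¹' Iic k) (posterior ρ f₀ f₁ X μ p₀ k) := by
  induction k with
  | zero => rw [info_zero]; exact hp₀
  | succ k ih => exact ih.update h hf₀ hf₁ hρ₀ hρ₁ h𝒢 hμ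

lemma post_ae_eq_posterior (h : IsChangePointModel P π₀ ρ f₀ f₁ Λ X)
    (hf₀ : IsPdf f₀) (hf₁ : IsPdf f₁)
    (hρ₀ : 0 < ρ) (hρ₁ : ρ < 1) (h𝒢 : 𝒢 ≤ MeasurableSpace.generateFrom {{ω | Λ ω = 0}})
    (hμ : ∀ k, Measurable[info 𝒢 X μ k] (μ (k + 1))) {p₀ : Ω → ℝ}
    (hp₀ : IsCondProb 𝒢 P (Λ ⁻¹' Iic 0) p₀) :
    ∀ᵐ ω ∂P, ∀ k, post 𝒢 P Λ X μ k ω = posterior ρ f₀ f₁ X μ p₀ k ω := by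
  rw [ae_all_iff]
  intro k
  have := (isCondProb_posterior h hf₀ hf₁ hρ₀ hρ₁ h𝒢 hμ hp₀ k).ae_eq_condExp
    (info_le_ambient h h𝒢 hμ k) (h.measurable_changePoint measurableSet_Iic)
  filter_upwards [this] with ω hω
  rw [hω]
  rfl

end

/-! ### The risk as a series -/

/-- The delay counts the instants `k` with `l ≤ k < t`, also when `t` is infinite. -/
lemma coe_tsub_eq_tsum (t : ℕ∞) (l : ℕ) :
    ((t - (l : ℕ∞) : ℕ∞) : ENNReal) =
      ∑' k : ℕ, {k : ℕ | l ≤ k ∧ (k : ℕ∞) < t}.indicator (1 : ℕ → ENNReal) k := by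
  have h : ∑' k : ℕ, {k : ℕ | l ≤ k ∧ (k : ℕ∞) < t}.indicator (1 : ℕ → ENNReal) k =
      ({k : ℕ | l ≤ k ∧ (k : ℕ∞) < t}.encard : ENNReal) := by
    rw [← ENNReal.tsum_set_one, ← tsum_subtype]
    rfl
  rw [h]
  congr 1
  induction t with
  | top =>
    have : {k : ℕ | l ≤ k ∧ (k : ℕ∞) < ⊤} = Ici l := by
      ext k; simp
    rw [this, (Set.Ici_infinite l).encard_eq]
    rfl
  | coe n =>
    have : {k : ℕ | l ≤ k ∧ (k : ℕ∞) < n} = (Finset.Ico l n : Set ℕ) := by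
      ext k; simp
    rw [this, encard_coe_eq_coe_finsetCard, Nat.card_Ico]
    rfl

lemma indicator_lt_eq_tsum (t : ℕ∞) (l : ℕ) :
    (if t < (l : ℕ∞) then 1 else 0 : ENNReal) =
      ∑' k : ℕ, if t = (k : ℕ∞) ∧ k < l then 1 else 0 := by
  induction t with
  | top => simp
  | coe n =>
    rw [tsum_eq_single n fun k hk => if_neg fun h => hk (Nat.cast_injective h.1).symm]
    simp

section

variable {Ω : Type*} [m0 : MeasurableSpace Ω] {P : Measure Ω} {Λ : Ω → ℕ} {τ : Ω → ℕ∞} {c : ℝ}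

/-- Term by term the risk involves only `{Λ ≤ k}` intersected with events known at time `k`, so the
posterior can be inserted. -/
lemma risk_eq_tsum (hΛ : Measurable Λ)
    (hgt : ∀ k : ℕ, MeasurableSet {ω | (k : ℕ∞) < τ ω})
    (heq : ∀ k : ℕ, MeasurableSet {ω | τ ω = (k : ℕ∞)}) :
    risk P c Λ τ =
      ∑' k : ℕ, ENNReal.ofReal c * P ({ω | (k : ℕ∞) < τ ω} ∩ Λ ⁻¹' Iic k) +
      ∑' k : ℕ, P ({ω | τ ω = (k : ℕ∞)} ∩ Λ ⁻¹' Ioi k) := by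
  have h1 : ∀ k : ℕ, MeasurableSet ({ω | (k : ℕ∞) < τ ω} ∩ Λ ⁻¹' Iic k) := fun k =>
    (hgt k).inter (hΛ measurableSet_Iic)
  have h2 : ∀ k : ℕ, MeasurableSet ({ω | τ ω = (k : ℕ∞)} ∩ Λ ⁻¹' Ioi k) := fun k =>
    (heq k).inter (hΛ measurableSet_Ioi)
  have e : ∀ ω, ENNReal.ofReal c * ((τ ω - (Λ ω : ℕ∞) : ℕ∞) : ENNReal)
      + {ω' | τ ω' < (Λ ω' : ℕ∞)}.indicator 1 ω =
      ∑' k : ℕ, ENNReal.ofReal c * ({ω | (k : ℕ∞) < τ ω} ∩ Λ ⁻¹' Iic k).indicator 1 ω +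
      ∑' k : ℕ, ({ω | τ ω = (k : ℕ∞)} ∩ Λ ⁻¹' Ioi k).indicator (1 : Ω → ENNReal) ω := fun ω => by
    rw [ENNReal.tsum_mul_left]
    congr 1
    · rw [coe_tsub_eq_tsum]
      congr 2
      funext k
      simp only [indicator, mem_inter_iff, mem_preimage, mem_Iic, mem_ofPred_eq, Pi.one_apply,
        and_comm]
    · have := indicator_lt_eq_tsum (τ ω) (Λ ω)
      simpa only [indicator, mem_inter_iff, mem_preimage, mem_Ioi, mem_ofPred_eq, Pi.one_apply]
        using this
  unfold risk
  rw [lintegral_congr e, lintegral_add_left (Measurable.tsum fun k =>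
      ((measurable_one.indicator (h1 k)).const_mul _)),
    lintegral_tsum fun k => ((measurable_one.indicator (h1 k)).const_mul _).aemeasurable,
    lintegral_tsum fun k => (measurable_one.indicator (h2 k)).aemeasurable]
  congr 1
  · refine tsum_congr fun k => ?_
    rw [lintegral_const_mul _ (measurable_one.indicator (h1 k)), lintegral_indicator_one (h1 k)]
  · exact tsum_congr fun k => lintegral_indicator_one (h2 k)

end

/-! ### Verification -/

/-- The number of samples up to time `k`. -/
def sampleCount (s : ℕ → Bool) (k : ℕ) : ℕ := ((Finset.Icc 1 k).filter fun i => s i = true).card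

@[simp] lemma sampleCount_zero (s : ℕ → Bool) : sampleCount s 0 = 0 := by simp [sampleCount]

lemma sampleCount_succ (s : ℕ → Bool) (k : ℕ) :
    sampleCount s (k + 1) = sampleCount s k + if s (k + 1) = true then 1 else 0 := by
  simp only [sampleCount, Finset.card_filter]
  exact Finset.sum_Icc_succ_top (by omega) _

/-- The expected value of the next state. -/
def nextValue (c ρ : ℝ) (f₀ f₁ : ℝ → ℝ) (n : ℕ) (s : Bool) (p : ℝ) : ℝ :=
  if s = true then obsValue f₀ f₁ (V c ρ f₀ f₁ n) (Phi0 ρ p) else V c ρ f₀ f₁ n (Phi0 ρ p)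

/-- A trajectory along which the dynamic programming inequalities are equalities. -/
structure IsTight (c ρ : ℝ) (f₀ f₁ : ℝ → ℝ) (N : ℕ) (q : ℕ → ℝ) (s : ℕ → Bool) (T : ℕ∞) :
    Prop where
  step : ∀ k : ℕ, (k : ℕ∞) < T → V c ρ f₀ f₁ (N - sampleCount s k) (q k) =
    c * q k + nextValue c ρ f₀ f₁ (N - sampleCount s (k + 1)) (s (k + 1)) (q k)
  terminal : ∀ k : ℕ, T = (k : ℕ∞) → V c ρ f₀ f₁ (N - sampleCount s k) (q k) = 1 - q k

lemma V_le_nextValue {c ρ : ℝ} {f₀ f₁ : ℝ → ℝ} (hc : 0 < c) (hρ₀ : 0 < ρ) (hρ₁ : ρ < 1)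
    (hf₀ : IsPdf f₀) (hf₁ : IsPdf f₁) {N : ℕ} {s : ℕ → Bool} (hs : ∀ k, sampleCount s k ≤ N)
    (k : ℕ) {p : ℝ} (hp : p ∈ Icc (0 : ℝ) 1) :
    V c ρ f₀ f₁ (N - sampleCount s k) p ≤
      c * p + nextValue c ρ f₀ f₁ (N - sampleCount s (k + 1)) (s (k + 1)) p := by
  have hk := hs (k + 1)
  unfold nextValue
  rw [sampleCount_succ] at hk ⊢
  split_ifs with h
  · rw [if_pos h] at hk
    -- The budget holds after this sample too, so a right was left before it.
    obtain ⟨j, hj⟩ : ∃ j, N - sampleCount s k = j + 1 := ⟨N - sampleCount s k - 1, by omega⟩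
    rw [hj, show N - (sampleCount s k + 1) = j by omega]
    exact V_succ_le_obsValue hc hρ₀ hρ₁ hf₀ hf₁ j hp
  · exact V_le_blind hc hρ₀ hρ₁ hf₀ hf₁ _ hp

lemma nextValue_nonneg {c ρ : ℝ} {f₀ f₁ : ℝ → ℝ} (hc : 0 < c) (hρ₀ : 0 < ρ) (hρ₁ : ρ < 1)
    (hf₀ : IsPdf f₀) (hf₁ : IsPdf f₁) (n : ℕ) (s : Bool) {p : ℝ} (hp : p ∈ Icc (0 : ℝ) 1) :
    0 ≤ nextValue c ρ f₀ f₁ n s p := by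
  have hp' := Phi0_mem hρ₀ hρ₁ hp
  unfold nextValue
  split_ifs
  · exact obsValue_nonneg hf₀ hf₁ (isRegular_V hc hρ₀ hρ₁ hf₀ hf₁ n) hp'
  · exact (isRegular_V hc hρ₀ hρ₁ hf₀ hf₁ n).nonneg _ hp'

section

variable {Ω : Type*} {𝒢 : MeasurableSpace Ω} {X : ℕ → Ω → ℝ} {N : ℕ} {μ : ℕ → Ω → Bool}
  {τ : Ω → ℕ∞}

/-- The count at `k + 1` is known at time `k`, because sampling decisions are made one step ahead.
-/
lemma measurable_sampleCount (hμ : ∀ k, Measurable[info 𝒢 X μ k] (μ (k + 1))) (k : ℕ) :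
    Measurable[info 𝒢 X μ k] fun ω => sampleCount (fun i => μ i ω) (k + 1) := by
  simp only [sampleCount, Finset.card_filter]
  refine @Finset.measurable_fun_sum _ _ _ _ _ _ (info 𝒢 X μ k) _ _ fun i hi => ?_
  rw [Finset.mem_Icc] at hi
  obtain ⟨j, rfl⟩ : ∃ j, i = j + 1 := ⟨i - 1, by omega⟩
  have hj : Measurable[info 𝒢 X μ k] (μ (j + 1)) :=
    (hμ j).mono (info_mono 𝒢 X μ (by omega)) le_rfl
  exact Measurable.ite (hj (measurableSet_singleton true)) measurable_const measurable_const

lemma IsAdmissible.measurableSet_lt (ha : IsAdmissible 𝒢 X N μ τ) (k : ℕ) :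
    MeasurableSet[info 𝒢 X μ k] {ω | (k : ℕ∞) < τ ω} := by
  have : {ω | (k : ℕ∞) < τ ω} = {ω | τ ω ≤ (k : ℕ∞)}ᶜ := by ext; simp
  rw [this]
  exact (ha.stopping k).compl

lemma IsAdmissible.measurableSet_eq (ha : IsAdmissible 𝒢 X N μ τ) (k : ℕ) :
    MeasurableSet[info 𝒢 X μ k] {ω | τ ω = (k : ℕ∞)} := by
  cases k with
  | zero =>
    have : {ω | τ ω = ((0 : ℕ) : ℕ∞)} = {ω | τ ω ≤ ((0 : ℕ) : ℕ∞)} := by ext; simp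
    rw [this]
    exact ha.stopping 0
  | succ k =>
    have : {ω | τ ω = ((k + 1 : ℕ) : ℕ∞)} =
        {ω | τ ω ≤ ((k + 1 : ℕ) : ℕ∞)} ∩ {ω | (k : ℕ∞) < τ ω} := by
      ext ω
      simp only [mem_inter_iff, mem_ofPred_eq]
      rw [Nat.cast_succ, ← ENat.natCast_add_one_le_iff]
      exact le_antisymm_iff
    rw [this]
    exact (ha.stopping (k + 1)).inter
      (info_mono 𝒢 X μ (Nat.le_succ k) _ (ha.measurableSet_lt k))

lemma setOf_lt_eq_union (τ : Ω → ℕ∞) (k : ℕ) : {ω | (k : ℕ∞) < τ ω} =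
    {ω | ((k + 1 : ℕ) : ℕ∞) < τ ω} ∪ {ω | τ ω = ((k + 1 : ℕ) : ℕ∞)} := by
  ext ω
  simp only [mem_union, mem_ofPred_eq]
  rw [Nat.cast_succ, ← ENat.natCast_add_one_le_iff, le_iff_lt_or_eq, eq_comm (a := τ ω)]

end

section

variable {Ω : Type*} {𝒢 : MeasurableSpace Ω} [m0 : MeasurableSpace Ω] {P : Measure Ω}
  {Λ : Ω → ℕ} {c π₀ ρ : ℝ} {f₀ f₁ : ℝ → ℝ} {X : ℕ → Ω → ℝ} {N : ℕ}
  {μ : ℕ → Ω → Bool} {τ : Ω → ℕ∞} {p₀ : Ω → ℝ}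

lemma setLIntegral_lt_eq_add {f : Ω → ENNReal} (ha : IsAdmissible 𝒢 X N μ τ)
    (hm : ∀ k, info 𝒢 X μ k ≤ m0) (k : ℕ) :
    ∫⁻ ω in {ω | (k : ℕ∞) < τ ω}, f ω ∂P =
      ∫⁻ ω in {ω | ((k + 1 : ℕ) : ℕ∞) < τ ω}, f ω ∂P +
        ∫⁻ ω in {ω | τ ω = ((k + 1 : ℕ) : ℕ∞)}, f ω ∂P := by
  rw [setOf_lt_eq_union, lintegral_union (hm _ _ (ha.measurableSet_eq (k + 1)))]
  exact disjoint_left.2 fun ω h1 h2 => ne_of_gt h1 h2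

lemma lintegral_eq_add {f : Ω → ENNReal} (ha : IsAdmissible 𝒢 X N μ τ)
    (hm : ∀ k, info 𝒢 X μ k ≤ m0) :
    ∫⁻ ω, f ω ∂P = ∫⁻ ω in {ω | ((0 : ℕ) : ℕ∞) < τ ω}, f ω ∂P +
        ∫⁻ ω in {ω | τ ω = ((0 : ℕ) : ℕ∞)}, f ω ∂P := by
  rw [← lintegral_union (hm _ _ (ha.measurableSet_eq 0)), ← setLIntegral_univ]
  · congr 2
    ext ω
    simp only [mem_univ, mem_union, mem_ofPred_eq, true_iff]
    rw [Nat.cast_zero, or_comm, eq_comm]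
    exact eq_or_lt_of_le zero_le
  · exact disjoint_left.2 fun ω h1 h2 => ne_of_gt h1 h2

variable [IsProbabilityMeasure P]

lemma setLIntegral_V_posterior (h : IsChangePointModel P π₀ ρ f₀ f₁ Λ X) (hc : 0 < c)
    (hf₀ : IsPdf f₀) (hf₁ : IsPdf f₁)
    (hρ₀ : 0 < ρ) (hρ₁ : ρ < 1) (h𝒢 : 𝒢 ≤ MeasurableSpace.generateFrom {{ω | Λ ω = 0}})
    (hμ : ∀ k, Measurable[info 𝒢 X μ k] (μ (k + 1)))
    (hp₀ : IsCondProb 𝒢 P (Λ ⁻¹' Iic 0) p₀) (N k : ℕ) {A : Set Ω}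
    (hA : MeasurableSet[info 𝒢 X μ k] A) :
    ∫⁻ ω in A, ENNReal.ofReal (V c ρ f₀ f₁ (N - sampleCount (fun i => μ i ω) (k + 1))
        (posterior ρ f₀ f₁ X μ p₀ (k + 1) ω)) ∂P =
      ∫⁻ ω in A, ENNReal.ofReal (nextValue c ρ f₀ f₁ (N - sampleCount (fun i => μ i ω) (k + 1))
        (μ (k + 1) ω) (posterior ρ f₀ f₁ X μ p₀ k ω)) ∂P := by
  have hO := (isCondProb_posterior h hf₀ hf₁ hρ₀ hρ₁ h𝒢 hμ hp₀ k).isObservation h hρ₀ hρ₁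
    h𝒢 hμ
  have hn : Measurable[info 𝒢 X μ k] fun ω => N - sampleCount (fun i => μ i ω) (k + 1) :=
    (measurable_of_countable (fun j : ℕ => N - j)).comp (measurable_sampleCount hμ k)
  exact @IsObservation.setLIntegral_value Ω Ω m0 (info 𝒢 X μ k) P _ _ _ _ _ _ _ hO hf₀ hf₁
    (μ (k + 1)) (hμ k) (V c ρ f₀ f₁) (fun n => isRegular_V hc hρ₀ hρ₁ hf₀ hf₁ n) _ hn A hA

/-- One step of the dynamic program, integrated over an event of the past. -/
lemma setLIntegral_step (h : IsChangePointModel P π₀ ρ f₀ f₁ Λ X) (hc : 0 < c)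
    (hf₀ : IsPdf f₀) (hf₁ : IsPdf f₁)
    (hρ₀ : 0 < ρ) (hρ₁ : ρ < 1) (h𝒢 : 𝒢 ≤ MeasurableSpace.generateFrom {{ω | Λ ω = 0}})
    (hμ : ∀ k, Measurable[info 𝒢 X μ k] (μ (k + 1)))
    (hp₀ : IsCondProb 𝒢 P (Λ ⁻¹' Iic 0) p₀) (N k : ℕ) {A : Set Ω}
    (hA : MeasurableSet[info 𝒢 X μ k] A) :
    ∫⁻ ω in A, ENNReal.ofReal (c * posterior ρ f₀ f₁ X μ p₀ k ω +
        nextValue c ρ f₀ f₁ (N - sampleCount (fun i => μ i ω) (k + 1))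
        (μ (k + 1) ω) (posterior ρ f₀ f₁ X μ p₀ k ω)) ∂P =
      ENNReal.ofReal c * P (A ∩ Λ ⁻¹' Iic k) +
      ∫⁻ ω in A, ENNReal.ofReal (V c ρ f₀ f₁ (N - sampleCount (fun i => μ i ω) (k + 1))
        (posterior ρ f₀ f₁ X μ p₀ (k + 1) ω)) ∂P := by
  have hr := isCondProb_posterior h hf₀ hf₁ hρ₀ hρ₁ h𝒢 hμ hp₀ k
  have hrm := hr.measurable.mono (info_le_ambient h h𝒢 hμ k) le_rfl
  rw [setLIntegral_V_posterior h hc hf₀ hf₁ hρ₀ hρ₁ h𝒢 hμ hp₀ N k hA, hr.measure_inter A hA,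
    ← lintegral_const_mul _ hrm.ennreal_ofReal,
    ← lintegral_add_left (hrm.ennreal_ofReal.const_mul _)]
  refine lintegral_congr fun ω => ?_
  rw [ENNReal.ofReal_add (mul_nonneg hc.le (hr.mem ω).1)
    (nextValue_nonneg hc hρ₀ hρ₁ hf₀ hf₁ _ _ (hr.mem ω)), ENNReal.ofReal_mul hc.le]

/-- No admissible pair has a smaller risk than the value function. -/
lemma value_le_risk (h : IsChangePointModel P π₀ ρ f₀ f₁ Λ X) (hc : 0 < c)
    (hf₀ : IsPdf f₀) (hf₁ : IsPdf f₁)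
    (hρ₀ : 0 < ρ) (hρ₁ : ρ < 1) (h𝒢 : 𝒢 ≤ MeasurableSpace.generateFrom {{ω | Λ ω = 0}})
    (hp₀ : IsCondProb 𝒢 P (Λ ⁻¹' Iic 0) p₀) (ha : IsAdmissible 𝒢 X N μ τ) :
    ∫⁻ ω, ENNReal.ofReal (V c ρ f₀ f₁ N (p₀ ω)) ∂P ≤ risk P c Λ τ := by
  have hm := info_le_ambient h h𝒢 ha.causal
  have hr := isCondProb_posterior h hf₀ hf₁ hρ₀ hρ₁ h𝒢 ha.causal hp₀
  set W : ℕ → Ω → ENNReal := fun k ω => ENNReal.ofReal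
    (V c ρ f₀ f₁ (N - sampleCount (fun i => μ i ω) k) (posterior ρ f₀ f₁ X μ p₀ k ω)) with hW
  set b : ℕ → ENNReal := fun k => ENNReal.ofReal c * P ({ω | (k : ℕ∞) < τ ω} ∩ Λ ⁻¹' Iic k)
  set d : ℕ → ENNReal := fun k => P ({ω | τ ω = (k : ℕ∞)} ∩ Λ ⁻¹' Ioi k)
  have hWle : ∀ k, ∀ A, MeasurableSet[info 𝒢 X μ k] A →
      ∫⁻ ω in A, W k ω ∂P ≤ P (A ∩ Λ ⁻¹' Ioi k) := fun k A hA => by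
    have := (hr k).measure_inter_compl (hm k) (h.measurable_changePoint measurableSet_Iic) hA
    rw [← preimage_compl, compl_Iic] at this
    rw [this]
    exact lintegral_mono fun ω => ENNReal.ofReal_le_ofReal
      ((isRegular_V hc hρ₀ hρ₁ hf₀ hf₁ _).le _ ((hr k).mem ω))
  -- The submartingale inequality on `{τ > k}`; the part that stops at `k + 1` is bounded by its
  -- false-alarm probability.
  have hstep : ∀ k : ℕ, ∫⁻ ω in {ω | (k : ℕ∞) < τ ω}, W k ω ∂P ≤
      b k + (∫⁻ ω in {ω | ((k + 1 : ℕ) : ℕ∞) < τ ω}, W (k + 1) ω ∂P + d (k + 1)) := fun k => by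
    refine le_trans (lintegral_mono fun ω => ENNReal.ofReal_le_ofReal
      (V_le_nextValue hc hρ₀ hρ₁ hf₀ hf₁ (fun k => ha.budget ω k) k ((hr k).mem ω))) ?_
    rw [setLIntegral_step h hc hf₀ hf₁ hρ₀ hρ₁ h𝒢 ha.causal hp₀ N k (ha.measurableSet_lt k),
      setLIntegral_lt_eq_add ha hm]
    gcongr
    exact hWle _ _ (ha.measurableSet_eq (k + 1))
  have hsum : ∀ K : ℕ, ∫⁻ ω, W 0 ω ∂P ≤ ∑ k ∈ Finset.range K, b k +
      ∑ k ∈ Finset.range (K + 1), d k + ∫⁻ ω in {ω | (K : ℕ∞) < τ ω}, W K ω ∂P := fun K => by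
    induction K with
    | zero =>
      rw [lintegral_eq_add ha hm, add_comm]
      simp only [Finset.range_zero, Finset.sum_empty, zero_add, Finset.sum_range_one]
      exact add_le_add (hWle 0 _ (ha.measurableSet_eq 0)) le_rfl
    | succ K ih =>
      refine ih.trans ((add_le_add le_rfl (hstep K)).trans_eq ?_)
      rw [Finset.sum_range_succ b K, Finset.sum_range_succ d (K + 1)]
      ring
  -- The value left at horizon `K` is at most `P(Λ > K)`, so no integrability or finiteness of `τ`
  -- is needed.
  have htail : Filter.Tendsto (fun K : ℕ => P (Λ ⁻¹' Ioi K)) Filter.atTop (nhds 0) := by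
    have := tendsto_measure_iInter_atTop (μ := P) (s := fun K : ℕ => Λ ⁻¹' Ioi K)
      (fun K => (h.measurable_changePoint measurableSet_Ioi).nullMeasurableSet)
      (fun a b hab => preimage_mono (Ioi_subset_Ioi hab)) ⟨0, measure_ne_top _ _⟩
    have e : ⋂ K : ℕ, Λ ⁻¹' Ioi K = ∅ := by
      ext ω
      simp only [mem_iInter, mem_preimage, mem_Ioi, mem_empty_iff_false, iff_false, not_forall]
      exact ⟨Λ ω, lt_irrefl _⟩
    rwa [e, measure_empty] at this
  rw [risk_eq_tsum h.measurable_changePoint (fun k => hm k _ (ha.measurableSet_lt k))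
    fun k => hm k _ (ha.measurableSet_eq k)]
  have e0 : ∫⁻ ω, ENNReal.ofReal (V c ρ f₀ f₁ N (p₀ ω)) ∂P = ∫⁻ ω, W 0 ω ∂P := by
    simp [hW, posterior]
  rw [e0]
  have hlim := htail.const_add (∑' k, b k + ∑' k, d k)
  rw [add_zero] at hlim
  refine ge_of_tendsto' hlim fun K => (hsum K).trans ?_
  gcongr
  · exact ENNReal.sum_le_tsum _
  · exact ENNReal.sum_le_tsum _
  · exact (hWle K _ (ha.measurableSet_lt K)).trans (measure_mono inter_subset_right)

/-- An admissible pair with tight trajectories attains the value function. -/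
lemma risk_le_value (h : IsChangePointModel P π₀ ρ f₀ f₁ Λ X) (hc : 0 < c)
    (hf₀ : IsPdf f₀) (hf₁ : IsPdf f₁)
    (hρ₀ : 0 < ρ) (hρ₁ : ρ < 1) (h𝒢 : 𝒢 ≤ MeasurableSpace.generateFrom {{ω | Λ ω = 0}})
    (hp₀ : IsCondProb 𝒢 P (Λ ⁻¹' Iic 0) p₀) (ha : IsAdmissible 𝒢 X N μ τ)
    (ht : ∀ᵐ ω ∂P, IsTight c ρ f₀ f₁ N (fun k => posterior ρ f₀ f₁ X μ p₀ k ω)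
      (fun k => μ k ω) (τ ω)) :
    risk P c Λ τ ≤ ∫⁻ ω, ENNReal.ofReal (V c ρ f₀ f₁ N (p₀ ω)) ∂P := by
  have hm := info_le_ambient h h𝒢 ha.causal
  have hr := isCondProb_posterior h hf₀ hf₁ hρ₀ hρ₁ h𝒢 ha.causal hp₀
  set W : ℕ → Ω → ENNReal := fun k ω => ENNReal.ofReal
    (V c ρ f₀ f₁ (N - sampleCount (fun i => μ i ω) k) (posterior ρ f₀ f₁ X μ p₀ k ω)) with hW
  set b : ℕ → ENNReal := fun k => ENNReal.ofReal c * P ({ω | (k : ℕ∞) < τ ω} ∩ Λ ⁻¹' Iic k)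
  set d : ℕ → ENNReal := fun k => P ({ω | τ ω = (k : ℕ∞)} ∩ Λ ⁻¹' Ioi k)
  have hterm : ∀ k : ℕ, ∫⁻ ω in {ω | τ ω = (k : ℕ∞)}, W k ω ∂P = d k := fun k => by
    have hA := ha.measurableSet_eq k
    have := (hr k).measure_inter_compl (hm k) (h.measurable_changePoint measurableSet_Iic) hA
    rw [← preimage_compl, compl_Iic] at this
    change _ = P _
    rw [this]
    refine setLIntegral_congr_fun_ae (hm k _ hA) ?_
    filter_upwards [ht] with ω hω hk
    exact congrArg ENNReal.ofReal (hω.terminal k hk)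
  have hstep : ∀ k : ℕ, ∫⁻ ω in {ω | (k : ℕ∞) < τ ω}, W k ω ∂P =
      b k + (∫⁻ ω in {ω | ((k + 1 : ℕ) : ℕ∞) < τ ω}, W (k + 1) ω ∂P + d (k + 1)) := fun k => by
    have hA := ha.measurableSet_lt k
    rw [← hterm, ← setLIntegral_lt_eq_add ha hm,
      ← setLIntegral_step h hc hf₀ hf₁ hρ₀ hρ₁ h𝒢 ha.causal hp₀ N k hA]
    refine setLIntegral_congr_fun_ae (hm k _ hA) ?_
    filter_upwards [ht] with ω hω hk
    exact congrArg ENNReal.ofReal (hω.step k hk)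
  have hsum : ∀ K : ℕ, ∫⁻ ω, W 0 ω ∂P = ∑ k ∈ Finset.range K, b k +
      ∑ k ∈ Finset.range (K + 1), d k + ∫⁻ ω in {ω | (K : ℕ∞) < τ ω}, W K ω ∂P := fun K => by
    induction K with
    | zero =>
      rw [lintegral_eq_add ha hm, hterm, add_comm]
      simp
    | succ K ih =>
      rw [ih, hstep, Finset.sum_range_succ b K, Finset.sum_range_succ d (K + 1)]
      ring
  have e0 : ∫⁻ ω, ENNReal.ofReal (V c ρ f₀ f₁ N (p₀ ω)) ∂P = ∫⁻ ω, W 0 ω ∂P := by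
    simp [hW, posterior]
  rw [risk_eq_tsum h.measurable_changePoint (fun k => hm k _ (ha.measurableSet_lt k))
    fun k => hm k _ (ha.measurableSet_eq k), e0, ← ENNReal.tsum_add]
  -- In this direction the value left at horizon `K` is nonnegative and is simply dropped.
  refine ENNReal.tsum_le_of_sum_range_le fun K => ?_
  rw [hsum K, Finset.sum_add_distrib, Finset.sum_range_succ d]
  exact le_trans (add_le_add le_rfl le_self_add) le_self_add

end

/-! ### Trajectories that follow the threshold rule are tight -/

/-- During a wait the principle of optimality carries equality from each instant to the next, and a
remaining wait of one step gives equality at the sample. After the last sample `V_0` is below `1 -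
p` until the threshold is met. -/
lemma FollowsThresholdRule.isTight {c ρ : ℝ} {f₀ f₁ : ℝ → ℝ} (hc : 0 < c) (hρ₀ : 0 < ρ)
    (hρ₁ : ρ < 1) (hf₀ : IsPdf f₀) (hf₁ : IsPdf f₁) {N : ℕ} {q : ℕ → ℝ} {s : ℕ → Bool} {T : ℕ∞}
    (hq : ∀ k, q k ∈ Icc (0 : ℝ) 1) (hq' : ∀ k, s (k + 1) = false → q (k + 1) = Phi0 ρ (q k))
    (h : FollowsThresholdRule c ρ f₀ f₁ N q s T) : IsTight c ρ f₀ f₁ N q s T := by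
  obtain ⟨η, t, hη, ht0, hlt, hge, hnext, hs, hT, hT'⟩ := h
  have hstep : ∀ n < η, t n < t (n + 1) := fun n hn => by
    obtain ⟨m, hm, e, -⟩ := hnext n hn
    omega
  have hmono : ∀ n j, n + j ≤ η → t n + j ≤ t (n + j) := fun n j => by
    induction j with
    | zero => simp
    | succ j ih =>
      intro hj
      have := ih (by omega)
      have := hstep (n + j) (by omega)
      rw [← add_assoc n j 1]
      omega
  have hmono' : ∀ n n', n ≤ n' → n' ≤ η → t n ≤ t n' := fun n n' hn hn' => by
    have := hmono n (n' - n) (by omega)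
    rw [Nat.add_sub_cancel' hn] at this
    omega
  have hηT : (t η : ℕ∞) ≤ T := by
    rcases hη.lt_or_eq with h | h
    · exact (hT h).ge
    · obtain ⟨k, rfl, hk⟩ := hT' h
      rw [h]
      exact_mod_cast hk.1.1
  -- Up to time `T`, the sample count is the index of the interval `[t n, t (n + 1))` that contains
  -- `k`; the last interval has no right end.
  have hcount : ∀ k n : ℕ, (k : ℕ∞) ≤ T → n ≤ η → t n ≤ k → (n < η → k < t (n + 1)) →
      sampleCount s k = n := by
    intro k
    induction k with
    | zero =>
      intro n _ hn htn _
      have := hmono 0 n (by omega)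
      rw [zero_add] at this
      rw [sampleCount_zero]
      omega
    | succ k ih =>
      intro n hk hn htn hlt'
      have hk' : (k : ℕ∞) ≤ T := le_trans (by exact_mod_cast Nat.le_succ k) hk
      have hsk := hs (k + 1) (by omega) hk
      rw [sampleCount_succ]
      rcases htn.lt_or_eq with h | h
      · have : ¬ s (k + 1) = true := fun h' => by
          obtain ⟨n', h1, h2, h3⟩ := hsk.1 h'
          rcases Nat.lt_or_ge n n' with h4 | h4
          · have := hlt' (by omega)
            have := hmono' (n + 1) n' h4 h2
            omega
          · have := hmono' n' n h4 hn
            omega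
        rw [if_neg this, add_zero, ih n hk' hn (by omega) fun h' => by have := hlt' h'; omega]
      · obtain ⟨j, rfl⟩ : ∃ j, n = j + 1 := ⟨n - 1, by
          rcases Nat.eq_zero_or_pos n with rfl | h'
          · omega
          · omega⟩
        have := hstep j (by omega)
        rw [if_pos (hsk.2 ⟨j + 1, by omega, hn, h⟩), ih j hk' (by omega) (by omega)
          fun _ => by omega]
  have hV := fun n => isRegular_V hc hρ₀ hρ₁ hf₀ hf₁ n
  have hfalse : ∀ k n : ℕ, ((k + 1 : ℕ) : ℕ∞) ≤ T → sampleCount s k = n →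
      sampleCount s (k + 1) = n → s (k + 1) = false := fun k n _ h1 h2 => by
    rw [sampleCount_succ, h1] at h2
    by_contra h
    rw [Bool.not_eq_false] at h
    rw [if_pos h] at h2
    omega
  have hwait : ∀ n < η, ∃ m, 1 ≤ m ∧ t (n + 1) = t n + m ∧ ∀ j < m,
      V c ρ f₀ f₁ (N - n) (q (t n + j)) =
        waitCost c ρ f₀ f₁ (V c ρ f₀ f₁ (N - n - 1)) (q (t n + j)) (m - j) := by
    intro n hn
    obtain ⟨m, hm, htm, hmin⟩ := hnext n hn
    obtain ⟨r, hr⟩ : ∃ r, N - n = r + 1 := ⟨N - n - 1, by omega⟩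
    rw [hr, Nat.add_sub_cancel] at hmin ⊢
    refine ⟨m, hm, htm, fun j => ?_⟩
    induction j with
    | zero =>
      intro _
      have h1 := (lt_threshold_iff hc hρ₀ hρ₁ hf₀ hf₁ N n (hq (t n))).1 (hlt n hn)
      rw [hr] at h1
      refine V_succ_eq_waitCost hc hρ₀ hρ₁ hf₀ hf₁ (hq _) h1 hm fun m' hm' => ?_
      have := hmin m' hm'
      rwa [continuationCost_eq hρ₀ hρ₁ hf₀ hf₁ (hV r) (hq _) hm,
        continuationCost_eq hρ₀ hρ₁ hf₀ hf₁ (hV r) (hq _) hm'] at this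
    | succ j ih =>
      intro hj
      have h1 := ih (by omega)
      have hle : ((t n + j + 1 : ℕ) : ℕ∞) ≤ T := le_trans (by
        have := hmono' (n + 1) η hn le_rfl
        exact_mod_cast (by omega)) hηT
      have hle' : ((t n + j : ℕ) : ℕ∞) ≤ T := le_trans (by exact_mod_cast Nat.le_succ _) hle
      have hs' := hfalse (t n + j) n hle (hcount _ n hle' hn.le (by omega) fun _ => by omega)
        (hcount _ n hle hn.le (by omega) fun _ => by omega)
      rw [show m - j = (m - (j + 1)) + 1 by omega] at h1
      have := (V_succ_eq_of_waitCost hc hρ₀ hρ₁ hf₀ hf₁ (hq _) (by omega) h1).2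
      rw [← hq' _ hs'] at this
      exact this
  refine ⟨fun k hk => ?_, fun k hk => ?_⟩
  · have hk1 : ((k + 1 : ℕ) : ℕ∞) ≤ T := by
      rw [Nat.cast_succ, ENat.natCast_add_one_le_iff]; exact hk
    rcases Nat.lt_or_ge k (t η) with hkη | hkη
    · obtain ⟨n, hn, hnk, hkn⟩ : ∃ n < η, t n ≤ k ∧ k < t (n + 1) := by
        have hex : ∃ n, k < t n := ⟨η, hkη⟩
        have hpos : Nat.find hex ≠ 0 := fun h0 => by
          have := Nat.find_spec hex
          rw [h0, ht0] at this
          omega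
        obtain ⟨n, hn⟩ := Nat.exists_eq_succ_of_ne_zero hpos
        refine ⟨n, ?_, ?_, ?_⟩
        · have := Nat.find_min' hex hkη
          omega
        · exact not_lt.1 (Nat.find_min hex (by omega))
        · have := Nat.find_spec hex
          rwa [hn] at this
      obtain ⟨m, hm, htm, hw⟩ := hwait n hn
      obtain ⟨j, rfl⟩ : ∃ j, k = t n + j := ⟨k - t n, by omega⟩
      have hj : j < m := by omega
      have hc1 := hcount (t n + j) n hk.le hn.le hnk fun _ => hkn
      have hw' := hw j hj
      obtain ⟨r, hr⟩ : ∃ r, N - n = r + 1 := ⟨N - n - 1, by omega⟩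
      have hr' : N - (n + 1) = r := by omega
      rw [hc1]
      rcases Nat.lt_or_ge (j + 1) m with hjm | hjm
      · have hc2 := hcount (t n + j + 1) n hk1 hn.le (by omega) fun _ => by omega
        have hs' := hfalse _ n hk1 hc1 hc2
        rw [hc2, nextValue, hs', if_neg (by simp)]
        rw [hr, Nat.add_sub_cancel, show m - j = (m - (j + 1)) + 1 by omega] at hw'
        rw [hr]
        exact (V_succ_eq_of_waitCost hc hρ₀ hρ₁ hf₀ hf₁ (hq _) (by omega) hw').1
      · have hjm' : t n + j + 1 = t (n + 1) := by omega
        have hs' := (hs (t n + j + 1) (by omega) hk1).2 ⟨n + 1, by omega, hn, hjm'.symm⟩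
        rw [sampleCount_succ, hc1, nextValue, hs', if_pos rfl, if_pos rfl, hr', hr]
        rw [hr, Nat.add_sub_cancel, show m - j = 0 + 1 by omega, waitCost_succ,
          waitCost_zero] at hw'
        exact hw'
    -- Before `T` but not before `t η`: only possible if all samples are used, since otherwise `T =
    -- t η`.
    · have hηN : η = N := by
        by_contra hne
        rw [hT (by omega)] at hk
        have : k < t η := by exact_mod_cast hk
        omega
      subst hηN
      have hc1 := hcount k η hk.le le_rfl hkη fun h => absurd h (lt_irrefl _)
      have hc2 := hcount (k + 1) η hk1 le_rfl (by omega) fun h => absurd h (lt_irrefl _)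
      have hs' := hfalse _ η hk1 hc1 hc2
      rw [hc1, hc2, nextValue, hs', if_neg (by simp), Nat.sub_self]
      refine V_zero_eq_of_lt hc hρ₀ hρ₁ hf₀ hf₁ (hq k) ?_
      have := lt_threshold_iff hc hρ₀ hρ₁ hf₀ hf₁ η η (hq k)
      rw [Nat.sub_self] at this
      rw [← this]
      obtain ⟨k', rfl, hk'⟩ := hT' rfl
      have hkk' : k < k' := by exact_mod_cast hk
      by_contra! hge'
      exact absurd (hk'.2 ⟨hkη, hge'⟩) (not_le.2 hkk')
  · subst hk
    rcases hη.lt_or_eq with h | h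
    · have hk : k = t η := by exact_mod_cast hT h
      rw [hcount k η le_rfl le_rfl hk.ge fun h => absurd h (lt_irrefl _), hk]
      exact (threshold_le_iff hc hρ₀ hρ₁ hf₀ hf₁ N η (hq _)).1 (hge h)
    · obtain ⟨k', hkk', hk'⟩ := hT' h
      obtain rfl : k = k' := by exact_mod_cast hkk'
      subst h
      rw [hcount k η le_rfl le_rfl hk'.1.1 fun h => absurd h (lt_irrefl _)]
      exact (threshold_le_iff hc hρ₀ hρ₁ hf₀ hf₁ η η (hq _)).1 hk'.1.2

/-! ### Implementing the threshold rule online -/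

section

variable {c ρ : ℝ} {f₀ f₁ : ℝ → ℝ} {N : ℕ} {q : ℕ → ℝ} {s : ℕ → Bool}

/-- Waiting until sampling at the next step is optimal realizes an optimal waiting time. -/
lemma exists_first_sampling {v : ℝ → ℝ} (m : ℕ) {p : ℝ}
    (hm : ∀ i, 1 ≤ i → waitCost c ρ f₀ f₁ v p (m + 1) ≤ waitCost c ρ f₀ f₁ v p i) :
    ∃ j, (∀ i < j, ¬ ∀ l, 1 ≤ l → waitCost c ρ f₀ f₁ v (blindPost ρ p i) 1 ≤
        waitCost c ρ f₀ f₁ v (blindPost ρ p i) l) ∧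
      (∀ l, 1 ≤ l → waitCost c ρ f₀ f₁ v (blindPost ρ p j) 1 ≤
        waitCost c ρ f₀ f₁ v (blindPost ρ p j) l) ∧
      ∀ l, 1 ≤ l → waitCost c ρ f₀ f₁ v p (j + 1) ≤ waitCost c ρ f₀ f₁ v p l := by
  induction m generalizing p with
  | zero => exact ⟨0, by simp, by simpa using hm, hm⟩
  | succ m ih =>
    by_cases hB : ∀ l, 1 ≤ l → waitCost c ρ f₀ f₁ v p 1 ≤ waitCost c ρ f₀ f₁ v p l
    · exact ⟨0, by simp, by simpa using hB, hB⟩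
    · obtain ⟨j, h1, h2, h3⟩ := ih (p := Phi0 ρ p) fun i hi => by
        have := hm (i + 1) (by omega)
        rw [waitCost_succ, waitCost_succ (m := i)] at this
        linarith
      refine ⟨j + 1, fun i hi => ?_, by simpa only [blindPost_Phi0] using h2, fun l hl => ?_⟩
      · cases i with
        | zero => simpa using hB
        | succ i => simpa only [blindPost_Phi0] using h1 i (by omega)
      · have h4 : waitCost c ρ f₀ f₁ v p (j + 1 + 1) ≤ waitCost c ρ f₀ f₁ v p (m + 1 + 1) := by
          rw [waitCost_succ, waitCost_succ (m := m + 1)]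
          linarith [h3 (m + 1) (by omega)]
        exact h4.trans (hm l hl)

/-- The condition to stop at time `k`. -/
def StopsAt (c ρ : ℝ) (f₀ f₁ : ℝ → ℝ) (N : ℕ) (q : ℕ → ℝ) (s : ℕ → Bool) (k : ℕ) : Prop :=
  -- While samples are left, stopping is allowed only at a sampling time; time `0` counts as one
  -- through the convention `s 0 = true`.
  (sampleCount s k < N ∧ s k = true ∧ threshold c ρ f₀ f₁ N (sampleCount s k) ≤ q k) ∨
    (sampleCount s k = N ∧ threshold c ρ f₀ f₁ N N ≤ q k)

/-- A trajectory that takes a sample whenever this is optimal at the next step. -/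
structure IsOnline (c ρ : ℝ) (f₀ f₁ : ℝ → ℝ) (N : ℕ) (q : ℕ → ℝ) (s : ℕ → Bool) : Prop where
  mem : ∀ k, q k ∈ Icc (0 : ℝ) 1
  zero : s 0 = true
  blind : ∀ k, s (k + 1) = false → q (k + 1) = Phi0 ρ (q k)
  sample : ∀ k, s (k + 1) = true ↔ sampleCount s k < N ∧ ∀ l, 1 ≤ l →
    waitCost c ρ f₀ f₁ (V c ρ f₀ f₁ (N - sampleCount s k - 1)) (q k) 1 ≤
      waitCost c ρ f₀ f₁ (V c ρ f₀ f₁ (N - sampleCount s k - 1)) (q k) l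

/-- The threshold rule has been followed up to the `n`-th sample, taken at time `t n`. -/
structure IsPartialRule (c ρ : ℝ) (f₀ f₁ : ℝ → ℝ) (N : ℕ) (q : ℕ → ℝ) (s : ℕ → Bool)
    (n : ℕ) (t : ℕ → ℕ) : Prop where
  zero : t 0 = 0
  le : ∀ i ≤ n, t i ≤ t n
  count : sampleCount s (t n) = n
  fresh : s (t n) = true
  not_stopsAt : ∀ k < t n, ¬ StopsAt c ρ f₀ f₁ N q s k
  lt_threshold : ∀ i < n, q (t i) < threshold c ρ f₀ f₁ N i
  next : ∀ i < n, ∃ m : ℕ, 1 ≤ m ∧ t (i + 1) = t i + m ∧ ∀ m' : ℕ, 1 ≤ m' →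
    continuationCost c ρ f₀ f₁ (V c ρ f₀ f₁ (N - i - 1)) (q (t i)) m ≤
      continuationCost c ρ f₀ f₁ (V c ρ f₀ f₁ (N - i - 1)) (q (t i)) m'
  times : ∀ k, 1 ≤ k → k ≤ t n → (s k = true ↔ ∃ i, 1 ≤ i ∧ i ≤ n ∧ t i = k)

/-- Blind evolution between the samples. -/
lemma IsOnline.blindPost_of_forall (h : IsOnline c ρ f₀ f₁ N q s) {k j : ℕ}
    (hs : ∀ i < j, q (k + i) = blindPost ρ (q k) i → sampleCount s (k + i) = sampleCount s k →
      s (k + i + 1) = false) :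
    ∀ i ≤ j, q (k + i) = blindPost ρ (q k) i ∧ sampleCount s (k + i) = sampleCount s k ∧
      ∀ l < i, s (k + l + 1) = false := by
  intro i
  induction i with
  | zero => simp
  | succ i ih =>
    intro hi
    obtain ⟨h1, h2, h3⟩ := ih (by omega)
    have h4 := hs i (by omega) h1 h2
    refine ⟨?_, ?_, fun l hl => ?_⟩
    · rw [← add_assoc, h.blind _ h4, h1, Phi0_blindPost]
    · rw [← add_assoc, sampleCount_succ, h4, h2]
      simp
    · rcases Nat.lt_succ_iff_lt_or_eq.1 hl with h5 | rfl
      · exact h3 l h5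
      · exact h4

/-- The next sample falls one step after the first time at which a wait of length one is optimal;
until then the posterior evolves blindly, so `exists_first_sampling` shows that the whole wait is
optimal. -/
lemma IsPartialRule.exists_succ (hc : 0 < c) (hρ₀ : 0 < ρ) (hρ₁ : ρ < 1)
    (hf₀ : IsPdf f₀) (hf₁ : IsPdf f₁) (h : IsOnline c ρ f₀ f₁ N q s) {n : ℕ} {t : ℕ → ℕ}
    (ht : IsPartialRule c ρ f₀ f₁ N q s n t) (hn : n < N)
    (hlt : q (t n) < threshold c ρ f₀ f₁ N n) :
    ∃ t', IsPartialRule c ρ f₀ f₁ N q s (n + 1) t' := by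
  have hV := isRegular_V hc hρ₀ hρ₁ hf₀ hf₁ (N - n - 1)
  have hq := h.mem (t n)
  obtain ⟨m, hm1, hm⟩ := exists_argmin_waitCost hc hρ₀ hρ₁ hf₀ hf₁ hV hq
  obtain ⟨m, rfl⟩ : ∃ m', m = m' + 1 := ⟨m - 1, by omega⟩
  obtain ⟨j, hj1, hj2, hj3⟩ := exists_first_sampling m hm
  have hbl := h.blindPost_of_forall (k := t n) (j := j) fun i hi h1 h2 => by
    rw [← Bool.not_eq_true, h.sample, h1, h2, ht.count]
    exact fun h' => hj1 i hi h'.2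
  obtain ⟨hqj, hcj, hsj⟩ := hbl j le_rfl
  have hsj1 : s (t n + j + 1) = true := by
    rw [h.sample, hqj, hcj, ht.count]
    exact ⟨hn, hj2⟩
  set t' := Function.update t (n + 1) (t n + j + 1) with ht'
  have e1 : t' (n + 1) = t n + j + 1 := Function.update_self ..
  have e2 : ∀ i ≤ n, t' i = t i := fun i hi => Function.update_of_ne (by omega) _ _
  refine ⟨t', ?_, fun i hi => ?_, ?_, ?_, fun k hk => ?_, fun i hi => ?_, fun i hi => ?_,
    fun k hk1 hk => ?_⟩
  · rw [e2 0 (by omega), ht.zero]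
  · rcases Nat.lt_or_ge n i with hi' | hi'
    · rw [show i = n + 1 by omega]
    · rw [e1, e2 i hi']
      have := ht.le i hi'
      omega
  · rw [e1, sampleCount_succ, hcj, ht.count, hsj1]
    simp
  · rw [e1, hsj1]
  · rw [e1] at hk
    rcases Nat.lt_or_ge k (t n) with hk' | hk'
    · exact ht.not_stopsAt k hk'
    · obtain ⟨i, rfl⟩ : ∃ i, k = t n + i := ⟨k - t n, by omega⟩
      have hci := (hbl i (by omega)).2.1
      rw [ht.count] at hci
      rintro (⟨-, h2, h3⟩ | ⟨h1, -⟩)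
      · cases i with
        | zero =>
          rw [hci] at h3
          exact absurd h3 (not_le.2 hlt)
        | succ i =>
          have := hsj i (by omega)
          rw [← add_assoc, this] at h2
          exact absurd h2 (by simp)
      · omega
  · rcases Nat.lt_or_ge i n with hi' | hi'
    · rw [e2 i hi'.le]
      exact ht.lt_threshold i hi'
    · obtain rfl : i = n := by omega
      rw [e2 i le_rfl]
      exact hlt
  · rcases Nat.lt_or_ge i n with hi' | hi'
    · rw [e2 i hi'.le, e2 (i + 1) hi']
      exact ht.next i hi'
    · obtain rfl : i = n := by omega
      rw [e2 i le_rfl, e1]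
      refine ⟨j + 1, by omega, by omega, fun m' hm' => ?_⟩
      rw [continuationCost_eq hρ₀ hρ₁ hf₀ hf₁ hV hq (by omega),
        continuationCost_eq hρ₀ hρ₁ hf₀ hf₁ hV hq hm']
      exact hj3 m' hm'
  · rw [e1] at hk
    rcases Nat.lt_or_ge (t n) k with hk' | hk'
    · obtain ⟨i, rfl⟩ : ∃ i, k = t n + i + 1 := ⟨k - t n - 1, by omega⟩
      rcases Nat.lt_or_ge i j with hij | hij
      · rw [hsj i hij]
        refine ⟨fun h' => absurd h' (by simp), fun ⟨l, _, hl, hl'⟩ => ?_⟩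
        rcases Nat.lt_or_ge n l with h5 | h5
        · rw [show l = n + 1 by omega, e1] at hl'
          omega
        · rw [e2 l h5] at hl'
          have := ht.le l h5
          omega
      · obtain rfl : i = j := by omega
        exact ⟨fun _ => ⟨n + 1, by omega, le_rfl, e1⟩, fun _ => hsj1⟩
    · rw [ht.times k hk1 hk']
      refine ⟨fun ⟨i, h1, h2, h3⟩ => ⟨i, h1, by omega, by rw [e2 i h2, h3]⟩,
        fun ⟨i, h1, h2, h3⟩ => ?_⟩
      rcases Nat.lt_or_ge n i with h5 | h5
      · rw [show i = n + 1 by omega, e1] at h3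
        omega
      · exact ⟨i, h1, h5, by rw [← h3, e2 i h5]⟩

/-- An online trajectory, stopped at the first time that satisfies the stopping condition,
follows the threshold rule. -/
lemma IsOnline.followsThresholdRule (hc : 0 < c) (hρ₀ : 0 < ρ) (hρ₁ : ρ < 1)
    (hf₀ : IsPdf f₀) (hf₁ : IsPdf f₁) (h : IsOnline c ρ f₀ f₁ N q s) {T : ℕ∞}
    (hT : ∀ k : ℕ, StopsAt c ρ f₀ f₁ N q s k → (∀ j < k, ¬ StopsAt c ρ f₀ f₁ N q s j) →
      T = (k : ℕ∞)) : FollowsThresholdRule c ρ f₀ f₁ N q s T := by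
  -- If the rule fails, no stop occurs at any `t n` with `n < N`, since such a stop would itself be
  -- a valid trajectory. So the partial rule extends to all `N` samples.
  by_contra hcon
  have key : ∀ n ≤ N, ∃ t, IsPartialRule c ρ f₀ f₁ N q s n t := by
    intro n
    induction n with
    | zero =>
      intro _
      refine ⟨fun _ => 0, rfl, fun _ _ => le_rfl, sampleCount_zero s, h.zero, ?_, ?_, ?_, ?_⟩
      · intro k hk; exact absurd hk (Nat.not_lt_zero k)
      · intro k hk; exact absurd hk (Nat.not_lt_zero k)
      · intro k hk; exact absurd hk (Nat.not_lt_zero k)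
      · intro k hk hk'; exact absurd hk' (by omega)
    | succ n ih =>
      intro hn
      obtain ⟨t, ht⟩ := ih (by omega)
      rcases lt_or_ge (q (t n)) (threshold c ρ f₀ f₁ N n) with hlt | hge
      · exact ht.exists_succ hc hρ₀ hρ₁ hf₀ hf₁ h (by omega) hlt
      · have hTn : T = (t n : ℕ∞) := hT (t n) (Or.inl (by
          rw [ht.count]; exact ⟨by omega, ht.fresh, hge⟩)) ht.not_stopsAt
        exact absurd ⟨n, t, by omega, ht.zero, ht.lt_threshold, fun _ => hge, ht.next,
          fun k hk hk' => ht.times k hk (by rw [hTn] at hk'; exact_mod_cast hk'),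
          fun _ => hTn, fun h' => absurd h' (by omega)⟩ hcon
  obtain ⟨t, ht⟩ := key N le_rfl
  have hbl : ∀ i, q (t N + i) = blindPost ρ (q (t N)) i ∧
      sampleCount s (t N + i) = sampleCount s (t N) ∧ ∀ l < i, s (t N + l + 1) = false :=
    fun i => h.blindPost_of_forall (k := t N) (j := i) (fun i _ _ h2 => by
      rw [← Bool.not_eq_true, h.sample, h2, ht.count]
      exact fun h' => lt_irrefl _ h'.1) i le_rfl
  obtain ⟨i, hi⟩ := exists_threshold_le_blindPost hc hρ₀ hρ₁ hf₀ hf₁ N (h.mem (t N))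
  have hex : ∃ k, StopsAt c ρ f₀ f₁ N q s k := ⟨t N + i, Or.inr
    ⟨(hbl i).2.1.trans ht.count, by rw [(hbl i).1]; exact hi⟩⟩
  classical
  have hTk := hT (Nat.find hex) (Nat.find_spec hex) fun j hj => Nat.find_min hex hj
  have hle : t N ≤ Nat.find hex := by
    by_contra! hlt
    exact ht.not_stopsAt _ hlt (Nat.find_spec hex)
  have hcount : ∀ k, t N ≤ k → sampleCount s k = N := fun k hk => by
    have := (hbl (k - t N)).2.1
    rwa [Nat.add_sub_cancel' hk, ht.count] at this
  refine hcon ⟨N, t, le_rfl, ht.zero, ht.lt_threshold, fun h' => absurd h' (lt_irrefl _), ht.next,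
    fun k hk _ => ?_, fun h' => absurd h' (lt_irrefl _),
    fun _ => ⟨Nat.find hex, hTk, ⟨hle, ?_⟩, fun j hj => ?_⟩⟩
  · rcases Nat.lt_or_ge (t N) k with hk' | hk'
    · obtain ⟨l, rfl⟩ : ∃ l, k = t N + l + 1 := ⟨k - t N - 1, by omega⟩
      rw [(hbl (l + 1)).2.2 l (by omega)]
      refine ⟨fun h' => absurd h' (by simp), fun ⟨i, _, hi, hi'⟩ => ?_⟩
      have := ht.le i hi
      omega
    · exact ht.times k hk hk'
  · rcases Nat.find_spec hex with h' | h'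
    · have := hcount _ hle
      omega
    · exact h'.2
  · exact Nat.find_min' hex (Or.inr ⟨hcount j hj.1, hj.2⟩)

end

/-! ### The online strategy -/

open Classical in
/-- Take a sample at the next step, given the posterior probability and the number of samples. -/
def decideSample (c ρ : ℝ) (f₀ f₁ : ℝ → ℝ) (N : ℕ) (z : ℝ × ℕ) : Bool :=
  decide (z.2 < N ∧ ∀ l, 1 ≤ l →
    waitCost c ρ f₀ f₁ (V c ρ f₀ f₁ (N - z.2 - 1)) (projIcc (0 : ℝ) 1 zero_le_one z.1) 1 ≤
      waitCost c ρ f₀ f₁ (V c ρ f₀ f₁ (N - z.2 - 1)) (projIcc (0 : ℝ) 1 zero_le_one z.1) l)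

lemma decideSample_eq_true_iff {c ρ : ℝ} {f₀ f₁ : ℝ → ℝ} {N : ℕ} (z : ℝ × ℕ) :
    decideSample c ρ f₀ f₁ N z = true ↔ z.2 < N ∧ ∀ l, 1 ≤ l →
    waitCost c ρ f₀ f₁ (V c ρ f₀ f₁ (N - z.2 - 1)) (projIcc (0 : ℝ) 1 zero_le_one z.1) 1 ≤
      waitCost c ρ f₀ f₁ (V c ρ f₀ f₁ (N - z.2 - 1)) (projIcc (0 : ℝ) 1 zero_le_one z.1) l := by
  classical exact decide_eq_true_iff

/-- The projection makes the cost Borel on the whole line and is the identity at posteriors. -/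
lemma measurable_waitCost_projIcc {c ρ : ℝ} {f₀ f₁ : ℝ → ℝ} (hρ₀ : 0 < ρ) (hρ₁ : ρ < 1)
    (hf₀ : IsPdf f₀) (hf₁ : IsPdf f₁) {v : ℝ → ℝ} (hv : IsRegular v) (m : ℕ) :
    Measurable fun p : ℝ => waitCost c ρ f₀ f₁ v (projIcc (0 : ℝ) 1 zero_le_one p) m := by
  obtain ⟨W, hW, hWv⟩ := exists_measurable_obsValue hf₀ hf₁ hv
  have hproj : Measurable fun p : ℝ => ((projIcc (0 : ℝ) 1 zero_le_one p : Icc (0 : ℝ) 1) : ℝ) :=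
    (continuous_subtype_val.comp continuous_projIcc).measurable
  unfold waitCost
  simp only [← hWv _ (blindPost_mem hρ₀ hρ₁ (projIcc (0 : ℝ) 1 zero_le_one _).2 m)]
  exact (((continuous_sum_blindPost ρ m).measurable.comp hproj).const_mul c).add
    (hW.comp ((continuous_blindPost ρ m).measurable.comp hproj))

lemma measurable_decideSample {c ρ : ℝ} {f₀ f₁ : ℝ → ℝ} (hc : 0 < c) (hρ₀ : 0 < ρ) (hρ₁ : ρ < 1)
    (hf₀ : IsPdf f₀) (hf₁ : IsPdf f₁) (N : ℕ) : Measurable (decideSample c ρ f₀ f₁ N) := by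
  refine measurable_from_prod_countable_left fun n => measurable_to_bool ?_
  have hm := fun m => measurable_waitCost_projIcc (c := c) hρ₀ hρ₁ hf₀ hf₁
    (isRegular_V hc hρ₀ hρ₁ hf₀ hf₁ (N - n - 1)) m
  have e : (fun p => decideSample c ρ f₀ f₁ N (p, n)) ⁻¹' {true} = {_p : ℝ | n < N} ∩
      ⋂ l : ℕ, ⋂ _ : 1 ≤ l, {p : ℝ |
        waitCost c ρ f₀ f₁ (V c ρ f₀ f₁ (N - n - 1)) (projIcc (0 : ℝ) 1 zero_le_one p) 1 ≤
          waitCost c ρ f₀ f₁ (V c ρ f₀ f₁ (N - n - 1)) (projIcc (0 : ℝ) 1 zero_le_one p) l} := by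
    ext p
    simp [decideSample_eq_true_iff]
  rw [e]
  exact (MeasurableSet.const _).inter (MeasurableSet.iInter fun l => MeasurableSet.iInter fun _ =>
    measurableSet_le (hm 1) (hm l))

section

variable {Ω : Type*} {c ρ : ℝ} {f₀ f₁ : ℝ → ℝ} {N : ℕ} {X : ℕ → Ω → ℝ} {p₀ : Ω → ℝ}

/-- The posterior probability and the number of samples under the online strategy. -/
def onlineState (c ρ : ℝ) (f₀ f₁ : ℝ → ℝ) (N : ℕ) (X : ℕ → Ω → ℝ) (p₀ : Ω → ℝ) :
    ℕ → Ω → ℝ × ℕ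
  | 0 => fun ω => (p₀ ω, 0)
  | k + 1 => fun ω =>
    if decideSample c ρ f₀ f₁ N (onlineState c ρ f₀ f₁ N X p₀ k ω) = true then
      (Phi1 ρ f₀ f₁ (X (k + 1) ω) (onlineState c ρ f₀ f₁ N X p₀ k ω).1,
        (onlineState c ρ f₀ f₁ N X p₀ k ω).2 + 1)
    else (Phi0 ρ (onlineState c ρ f₀ f₁ N X p₀ k ω).1, (onlineState c ρ f₀ f₁ N X p₀ k ω).2)

/-- The online sampling strategy; its value at time `0` plays no role. -/
def onlineSampling (c ρ : ℝ) (f₀ f₁ : ℝ → ℝ) (N : ℕ) (X : ℕ → Ω → ℝ) (p₀ : Ω → ℝ) :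
    ℕ → Ω → Bool
  | 0 => fun _ => true
  | k + 1 => fun ω => decideSample c ρ f₀ f₁ N (onlineState c ρ f₀ f₁ N X p₀ k ω)

lemma posterior_succ (μ : ℕ → Ω → Bool) (k : ℕ) (ω : Ω) :
    posterior ρ f₀ f₁ X μ p₀ (k + 1) ω = if μ (k + 1) ω = true
      then Phi1 ρ f₀ f₁ (X (k + 1) ω) (posterior ρ f₀ f₁ X μ p₀ k ω)
      else Phi0 ρ (posterior ρ f₀ f₁ X μ p₀ k ω) := rfl

/-- The posterior depends on the strategy and the strategy on the posterior. The state is defined by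
a recursion of its own, and only then identified with the posterior and sample count of the strategy
it generates. -/
lemma onlineState_eq (k : ℕ) (ω : Ω) : onlineState c ρ f₀ f₁ N X p₀ k ω =
    (posterior ρ f₀ f₁ X (onlineSampling c ρ f₀ f₁ N X p₀) p₀ k ω,
      sampleCount (fun i => onlineSampling c ρ f₀ f₁ N X p₀ i ω) k) := by
  induction k with
  | zero => simp [onlineState, posterior]
  | succ k ih =>
    have e : onlineState c ρ f₀ f₁ N X p₀ (k + 1) ω =
        if onlineSampling c ρ f₀ f₁ N X p₀ (k + 1) ω = true then
          (Phi1 ρ f₀ f₁ (X (k + 1) ω) (onlineState c ρ f₀ f₁ N X p₀ k ω).1,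
            (onlineState c ρ f₀ f₁ N X p₀ k ω).2 + 1)
        else (Phi0 ρ (onlineState c ρ f₀ f₁ N X p₀ k ω).1,
          (onlineState c ρ f₀ f₁ N X p₀ k ω).2) := rfl
    rw [e, sampleCount_succ, ih, posterior_succ]
    split_ifs <;> rfl

lemma onlineSampling_succ (k : ℕ) (ω : Ω) : onlineSampling c ρ f₀ f₁ N X p₀ (k + 1) ω =
    decideSample c ρ f₀ f₁ N (posterior ρ f₀ f₁ X (onlineSampling c ρ f₀ f₁ N X p₀) p₀ k ω,
      sampleCount (fun i => onlineSampling c ρ f₀ f₁ N X p₀ i ω) k) := by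
  rw [← onlineState_eq]
  rfl

lemma sampleCount_onlineSampling_le (k : ℕ) (ω : Ω) :
    sampleCount (fun i => onlineSampling c ρ f₀ f₁ N X p₀ i ω) k ≤ N := by
  induction k with
  | zero => simp
  | succ k ih =>
    rw [sampleCount_succ]
    split_ifs with h
    · rw [onlineSampling_succ, decideSample_eq_true_iff] at h
      exact h.1
    · exact ih

lemma isOnline_onlineSampling {q : ℕ → ℝ} {ω : Ω}
    (hq : ∀ k, q k = posterior ρ f₀ f₁ X (onlineSampling c ρ f₀ f₁ N X p₀) p₀ k ω)
    (hmem : ∀ k, q k ∈ Icc (0 : ℝ) 1) :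
    IsOnline c ρ f₀ f₁ N q fun i => onlineSampling c ρ f₀ f₁ N X p₀ i ω := by
  refine ⟨hmem, rfl, fun k hk => ?_, fun k => ?_⟩
  · rw [hq, hq, posterior_succ, hk, if_neg (by simp)]
  · rw [onlineSampling_succ, decideSample_eq_true_iff, ← hq,
      projIcc_of_mem zero_le_one (hmem k)]

open Classical in
/-- The first time at which the stopping condition holds. -/
def onlineTime (c ρ : ℝ) (f₀ f₁ : ℝ → ℝ) (N : ℕ) (X : ℕ → Ω → ℝ) (p₀ : Ω → ℝ) (ω : Ω) : ℕ∞ :=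
  if h : ∃ k, StopsAt c ρ f₀ f₁ N (fun k => (onlineState c ρ f₀ f₁ N X p₀ k ω).1)
    (fun k => onlineSampling c ρ f₀ f₁ N X p₀ k ω) k then (Nat.find h : ℕ∞) else ⊤

lemma onlineTime_le_iff (k : ℕ) (ω : Ω) : onlineTime c ρ f₀ f₁ N X p₀ ω ≤ (k : ℕ∞) ↔
    ∃ j ≤ k, StopsAt c ρ f₀ f₁ N (fun k => (onlineState c ρ f₀ f₁ N X p₀ k ω).1)
      (fun k => onlineSampling c ρ f₀ f₁ N X p₀ k ω) j := by
  classical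
  unfold onlineTime
  split_ifs with h
  · rw [Nat.cast_le, Nat.find_le_iff]
  · simp only [top_le_iff, ENat.natCast_ne_top, false_iff]
    exact fun ⟨j, _, hj⟩ => h ⟨j, hj⟩

lemma onlineTime_eq {k : ℕ} {ω : Ω}
    (h : StopsAt c ρ f₀ f₁ N (fun k => (onlineState c ρ f₀ f₁ N X p₀ k ω).1)
      (fun k => onlineSampling c ρ f₀ f₁ N X p₀ k ω) k)
    (h' : ∀ j < k, ¬ StopsAt c ρ f₀ f₁ N (fun k => (onlineState c ρ f₀ f₁ N X p₀ k ω).1)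
      (fun k => onlineSampling c ρ f₀ f₁ N X p₀ k ω) j) :
    onlineTime c ρ f₀ f₁ N X p₀ ω = (k : ℕ∞) := by
  classical
  unfold onlineTime
  rw [dif_pos ⟨k, h⟩, (Nat.find_eq_iff _).2 ⟨h, h'⟩]

variable {𝒢 : MeasurableSpace Ω}

/-- The filtration depends on the strategy being built; the induction closes because the decision
for `k + 1` is a function of the state at `k`. -/
lemma measurable_onlineState (hc : 0 < c) (hρ₀ : 0 < ρ) (hρ₁ : ρ < 1)
    (hf₀ : IsPdf f₀) (hf₁ : IsPdf f₁) (hp₀ : Measurable[𝒢] p₀) (k : ℕ) :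
    Measurable[info 𝒢 X (onlineSampling c ρ f₀ f₁ N X p₀) k]
      (onlineState c ρ f₀ f₁ N X p₀ k) := by
  induction k with
  | zero => rw [info_zero]; exact hp₀.prodMk measurable_const
  | succ k ih =>
    set μ := onlineSampling c ρ f₀ f₁ N X p₀ with hμ
    have hle := info_mono 𝒢 X μ (Nat.le_succ k)
    have hS : Measurable[info 𝒢 X μ (k + 1)] (onlineState c ρ f₀ f₁ N X p₀ k) :=
      ih.mono hle le_rfl
    have hμm : Measurable[info 𝒢 X μ (k + 1)] (μ (k + 1)) :=
      (measurable_decideSample hc hρ₀ hρ₁ hf₀ hf₁ N).comp hS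
    have hZ : Measurable[info 𝒢 X μ (k + 1)] (Z X μ (k + 1)) :=
      Measurable.of_comap_le (by rw [info_succ]; exact le_sup_right)
    have h1 := measurable_info_succ_update (ρ := ρ) (info 𝒢 X μ (k + 1)) hf₀ hf₁
      (measurable_fst.comp hS) hμm hZ
    have h2 : Measurable[info 𝒢 X μ (k + 1)] fun ω => if μ (k + 1) ω = true then
        (onlineState c ρ f₀ f₁ N X p₀ k ω).2 + 1 else (onlineState c ρ f₀ f₁ N X p₀ k ω).2 :=
      Measurable.ite (hμm (measurableSet_singleton true))
        ((measurable_of_countable (· + 1)).comp (measurable_snd.comp hS)) (measurable_snd.comp hS)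
    convert h1.prodMk h2 using 1
    funext ω
    simp only [onlineState, hμ, onlineSampling]
    split_ifs <;> rfl

lemma isAdmissible_online (hc : 0 < c) (hρ₀ : 0 < ρ) (hρ₁ : ρ < 1)
    (hf₀ : IsPdf f₀) (hf₁ : IsPdf f₁) (hp₀ : Measurable[𝒢] p₀) :
    IsAdmissible 𝒢 X N (onlineSampling c ρ f₀ f₁ N X p₀) (onlineTime c ρ f₀ f₁ N X p₀) := by
  set μ := onlineSampling c ρ f₀ f₁ N X p₀ with hμ
  have hS := fun k => measurable_onlineState (X := X) (N := N) hc hρ₀ hρ₁ hf₀ hf₁ hp₀ k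
  have hcausal : ∀ k, Measurable[info 𝒢 X μ k] (μ (k + 1)) := fun k =>
    (measurable_decideSample hc hρ₀ hρ₁ hf₀ hf₁ N).comp (hS k)
  have hfresh : ∀ k, Measurable[info 𝒢 X μ k] (μ k) := fun k => by
    cases k with
    | zero => exact measurable_const
    | succ k => exact (hcausal k).mono (info_mono 𝒢 X μ (Nat.le_succ k)) le_rfl
  refine ⟨hcausal, fun ω k => sampleCount_onlineSampling_le k ω, fun k => ?_⟩
  have e : {ω | onlineTime c ρ f₀ f₁ N X p₀ ω ≤ (k : ℕ∞)} = ⋃ j ∈ Finset.range (k + 1),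
      {ω | StopsAt c ρ f₀ f₁ N (fun k => (onlineState c ρ f₀ f₁ N X p₀ k ω).1)
        (fun k => μ k ω) j} := by
    ext ω
    simp only [mem_ofPred_eq, onlineTime_le_iff, mem_iUnion, Finset.mem_range, exists_prop,
      Nat.lt_succ_iff, hμ]
  rw [e]
  refine Finset.measurableSet_biUnion _ fun j hj => ?_
  have hle : info 𝒢 X μ j ≤ info 𝒢 X μ k :=
    info_mono 𝒢 X μ (by have := Finset.mem_range.1 hj; omega)
  refine hle _ ?_
  have hthr : Measurable fun z : ℝ × ℕ => z.1 - threshold c ρ f₀ f₁ N z.2 :=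
    measurable_from_prod_countable_left fun n => by fun_prop
  have hA : MeasurableSet {z : ℝ × ℕ | z.2 < N ∧ threshold c ρ f₀ f₁ N z.2 ≤ z.1} := by
    have : {z : ℝ × ℕ | z.2 < N ∧ threshold c ρ f₀ f₁ N z.2 ≤ z.1} =
        Prod.snd ⁻¹' Iio N ∩ (fun z : ℝ × ℕ => z.1 - threshold c ρ f₀ f₁ N z.2) ⁻¹' Ici 0 := by
      ext z; simp
    rw [this]
    exact (measurable_snd measurableSet_Iio).inter (hthr measurableSet_Ici)
  have hB : MeasurableSet {z : ℝ × ℕ | z.2 = N ∧ threshold c ρ f₀ f₁ N N ≤ z.1} := by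
    have : {z : ℝ × ℕ | z.2 = N ∧ threshold c ρ f₀ f₁ N N ≤ z.1} =
        Prod.snd ⁻¹' {N} ∩ Prod.fst ⁻¹' Ici (threshold c ρ f₀ f₁ N N) := by
      ext z; simp
    rw [this]
    exact (measurable_snd (measurableSet_singleton N)).inter (measurable_fst measurableSet_Ici)
  have e2 : {ω | StopsAt c ρ f₀ f₁ N (fun k => (onlineState c ρ f₀ f₁ N X p₀ k ω).1)
        (fun k => μ k ω) j} =
      (onlineState c ρ f₀ f₁ N X p₀ j ⁻¹'
        {z : ℝ × ℕ | z.2 < N ∧ threshold c ρ f₀ f₁ N z.2 ≤ z.1} ∩ μ j ⁻¹' {true}) ∪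
      onlineState c ρ f₀ f₁ N X p₀ j ⁻¹'
        {z : ℝ × ℕ | z.2 = N ∧ threshold c ρ f₀ f₁ N N ≤ z.1} := by
    ext ω
    simp only [StopsAt, mem_union, mem_inter_iff, mem_preimage, mem_ofPred_eq, mem_singleton_iff,
      onlineState_eq]
    tauto
  rw [e2]
  exact ((hS j hA).inter (hfresh j (measurableSet_singleton true))).union (hS j hB)

lemma followsThresholdRule_online (hc : 0 < c) (hρ₀ : 0 < ρ) (hρ₁ : ρ < 1)
    (hf₀ : IsPdf f₀) (hf₁ : IsPdf f₁) {q : ℕ → ℝ} {ω : Ω}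
    (hq : ∀ k, q k = posterior ρ f₀ f₁ X (onlineSampling c ρ f₀ f₁ N X p₀) p₀ k ω)
    (hmem : ∀ k, q k ∈ Icc (0 : ℝ) 1) :
    FollowsThresholdRule c ρ f₀ f₁ N q (fun k => onlineSampling c ρ f₀ f₁ N X p₀ k ω)
      (onlineTime c ρ f₀ f₁ N X p₀ ω) := by
  have e : q = fun k => (onlineState c ρ f₀ f₁ N X p₀ k ω).1 := funext fun k => by
    rw [hq, onlineState_eq]
  refine (isOnline_onlineSampling hq hmem).followsThresholdRule hc hρ₀ hρ₁ hf₀ hf₁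
    fun k hk hk' => ?_
  rw [e] at hk hk'
  exact onlineTime_eq hk hk'

end

end QuickestDetection

end

/-! ### Assembly of the four claims -/

theorem theorem2 (c ρ : ℝ) (f₀ f₁ : ℝ → ℝ) (hc : 0 < c) (hρ₀ : 0 < ρ) (hρ₁ : ρ < 1)
    (hf₀ : QuickestDetection.IsPdf f₀) (hf₁ : QuickestDetection.IsPdf f₁) (N : ℕ) :
    -- the expectations in the definition of `V_1, …, V_N` exist
    (∀ n < N, ∀ p ∈ Set.Icc (0 : ℝ) 1, ∀ m : ℕ, 1 ≤ m →
      MeasureTheory.Integrable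
        (fun x => QuickestDetection.V c ρ f₀ f₁ n
          (QuickestDetection.Phi1 ρ f₀ f₁ x (QuickestDetection.blindPost ρ p (m - 1))))
        (QuickestDetection.obsLaw ρ f₀ f₁ p m)) ∧
    -- concavity, and the value at `1`
    (∀ n ≤ N, ConcaveOn ℝ (Set.Icc (0 : ℝ) 1) (QuickestDetection.V c ρ f₀ f₁ n) ∧
      QuickestDetection.V c ρ f₀ f₁ n 1 = 0) ∧
    -- the stopping domains are given by the thresholds
    (∀ n < N, ∀ p ∈ Set.Icc (0 : ℝ) 1,
      (1 - p ≤ ⨅ m : ℕ+, QuickestDetection.continuationCost c ρ f₀ f₁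
          (QuickestDetection.V c ρ f₀ f₁ (N - n - 1)) p m) ↔
        QuickestDetection.threshold c ρ f₀ f₁ N n ≤ p) ∧
    -- the threshold rule can be implemented, and it is optimal
    (∀ (Ω : Type*) (𝒢 : MeasurableSpace Ω) [MeasurableSpace Ω] (P : MeasureTheory.Measure Ω)
      [MeasureTheory.IsProbabilityMeasure P] (π₀ : ℝ) (Λ : Ω → ℕ) (X : ℕ → Ω → ℝ),
      0 ≤ π₀ → π₀ < 1 →
      QuickestDetection.IsChangePointModel P π₀ ρ f₀ f₁ Λ X →
      -- the initial information is trivial or generated by `{Λ = 0}`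
      𝒢 ≤ MeasurableSpace.generateFrom {{ω | Λ ω = 0}} →
      (∃ (μ : ℕ → Ω → Bool) (τ : Ω → ℕ∞), QuickestDetection.IsAdmissible 𝒢 X N μ τ ∧
        ∀ᵐ ω ∂P, QuickestDetection.FollowsThresholdRule c ρ f₀ f₁ N
          (fun k => QuickestDetection.post 𝒢 P Λ X μ k ω) (fun k => μ k ω) (τ ω)) ∧
      (∀ (μ : ℕ → Ω → Bool) (τ : Ω → ℕ∞), QuickestDetection.IsAdmissible 𝒢 X N μ τ →
        (∀ᵐ ω ∂P, QuickestDetection.FollowsThresholdRule c ρ f₀ f₁ N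
          (fun k => QuickestDetection.post 𝒢 P Λ X μ k ω) (fun k => μ k ω) (τ ω)) →
        QuickestDetection.IsOptimal 𝒢 P c Λ X N μ τ)) := by
  have hV := QuickestDetection.isRegular_V (f₀ := f₀) (f₁ := f₁) hc hρ₀ hρ₁ hf₀ hf₁
  refine ⟨fun n _ p hp m hm => ?_, fun n _ => ⟨(hV n).concaveOn, (hV n).map_one⟩,
    fun n hn p hp => ?_, ?_⟩
  · simp only [QuickestDetection.Phi1_blindPost hm]
    exact QuickestDetection.integrable_mixLaw hf₀ hf₁ (hV n)
      (QuickestDetection.blindPost_mem hρ₀ hρ₁ hp m)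
  · rw [QuickestDetection.threshold_le_iff hc hρ₀ hρ₁ hf₀ hf₁ N n hp]
    obtain ⟨r, hr⟩ : ∃ r, N - n = r + 1 := ⟨N - n - 1, by omega⟩
    rw [hr, Nat.add_sub_cancel]
    -- `V_{r+1}` is the minimum of `1 - p` and the infimum, so it equals `1 - p` exactly on the
    -- stopping domain.
    exact min_eq_left_iff.symm
  · intro Ω 𝒢 _ P _ π₀ Λ X _ _ h h𝒢
    -- A version of `P(Λ = 0 | 𝒢)` as random initial posterior treats both kinds of initial
    -- information at once.
    obtain ⟨p₀, hp₀⟩ := QuickestDetection.exists_isCondProb (P := P)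
      (QuickestDetection.initial_le h h𝒢) (h.measurable_changePoint (measurableSet_Iic (a := 0)))
    refine ⟨⟨QuickestDetection.onlineSampling c ρ f₀ f₁ N X p₀,
      QuickestDetection.onlineTime c ρ f₀ f₁ N X p₀, ?_⟩, fun μ τ ha hrule => ⟨ha, ?_⟩⟩
    · have ha := QuickestDetection.isAdmissible_online (X := X) (N := N) hc hρ₀ hρ₁ hf₀ hf₁
        hp₀.measurable
      refine ⟨ha, ?_⟩
      filter_upwards [QuickestDetection.post_ae_eq_posterior h hf₀ hf₁ hρ₀ hρ₁ h𝒢 ha.causal hp₀]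
        with ω hω
      refine QuickestDetection.followsThresholdRule_online hc hρ₀ hρ₁ hf₀ hf₁ hω fun k => ?_
      rw [hω k]
      exact (QuickestDetection.isCondProb_posterior h hf₀ hf₁ hρ₀ hρ₁ h𝒢 ha.causal hp₀ k).mem ω
    · intro μ' τ' ha'
      refine (QuickestDetection.risk_le_value h hc hf₀ hf₁ hρ₀ hρ₁ h𝒢 hp₀ ha ?_).trans
        (QuickestDetection.value_le_risk h hc hf₀ hf₁ hρ₀ hρ₁ h𝒢 hp₀ ha')
      filter_upwards [hrule,
        QuickestDetection.post_ae_eq_posterior h hf₀ hf₁ hρ₀ hρ₁ h𝒢 ha.causal hp₀] with ω h1 hω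
      -- Almost surely the conditional expectations agree with the recursion at all times
      -- simultaneously, so the rule may be read for the recursive posterior.
      simp only [hω] at h1
      refine h1.isTight hc hρ₀ hρ₁ hf₀ hf₁ (fun k =>
        (QuickestDetection.isCondProb_posterior h hf₀ hf₁ hρ₀ hρ₁ h𝒢 ha.causal hp₀ k).mem ω)
        fun k hk => ?_
      rw [QuickestDetection.posterior_succ, hk, if_neg (by simp)]
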